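/- Let $k$ be an algebraically closed field, $V$ a finite dimensional vector space, $R\subseteq V\otimes V$, and let $A=TV/(R)$ be a Koszul Artin–Schelter regular algebra of global dimension $d\ge 1$ (i.e. $\operatorname{gldim}A=d$, $\operatorname{Ext}^i_A(k,A)=0$ for $i\ne d$, and $\operatorname{Ext}^d_A(k,A)\cong k(l)$ for some $l$). Put $R_0=k$, $R_1=V$ and $R_l=\bigcap_{i+j+2=l}V^{\otimes i}\otimes R\otimes V^{\otimes j}\subseteq V^{\otimes l}$ for $l\ge 2$. Let $\Lambda=\langle r_1,\dots,r_{d-1},r_d^{\pm1}\rangle$ be the monoid which is the free product of the free monoid on $r_1,\dots,r_{d-1}$ and the infinite cyclic group on $r_d$, and put $r_0=1$. Order $\Lambda$ by the smallest left and right invariant partial order with $r_{a+b}<r_ar_b$ for $a,b\ge1$, $a+b\le d$, and $r_{a+b-d}<r_ar_d^{-1}r_b$ for $1\le a,b\le d-1$, $a+b\ge d$. A subset $\pi\subseteq\Lambda$ is saturated if $\mu\le\lambda\in\pi$ implies $\mu\in\pi$. Let $\mathcal U$ be the strict monoidal category with object monoid $\Lambda$ generated by morphisms $\phi_{a,b}:r_{a+b}\to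 r_ar_b$ ($a,b\ge1$, $a+b\le d$) and $\theta_{a,b}:r_ar_d^{-1}r_b\to r_{a+b-d}$ ($1\le a,b\le d-1$, $a+b\ge d$), subject to the relations $(r_a\phi_{b,c})\phi_{a,b+c}=(\phi_{a,b}r_c)\phi_{a+b,c}$, $\theta_{a+b-d,c}(\theta_{a,b}r_d^{-1}r_c)=\theta_{a,b+c-d}(r_ar_d^{-1}\theta_{b,c})$, $(r_a\theta_{b,c})(\phi_{a,b}r_d^{-1}r_c)=\phi_{a,b+c-d}\,\theta_{a+b,c}$ and $(\theta_{a,b}r_c)(r_ar_d^{-1}\phi_{b,c})=\phi_{a+b-d,c}\,\theta_{a,b+c}$, whenever the generators involved are defined, where one puts $\phi_{a,0}=\operatorname{id}$, $\phi_{0,b}=\operatorname{id}$, $\theta_{d,b}=\operatorname{id}$, $\theta_{a,d}=\operatorname{id}$. Then $\dim R_d=1$, and there is a monoidal functor $M$ from $\mathcal U$ to finite dimensional vector spaces with $M(r_a)=R_a$ for $1\le a\le d$, which sends $\phi_{a,b}$ to the inclusion $R_{a+b}\subseteq R_a\otimes R_b$, sends $\theta_{a,d-a}:r_ar_d^{-1}r_{d-a}\to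 1$ to the map $R_a\otimes R_d^*\otimes R_{d-a}\to k$, $x\otimes\omega^*\otimes y\mapsto (e_\omega^{-1}x)(y)$ (here $0\ne\omega\in R_d\subseteq R_{d-a}\otimes R_a$, $\omega^*\in R_d^*=M(r_d^{-1})$ is the dual basis element, and $e_\omega:R_{d-a}^*\to R_a$, $\xi\mapsto(\xi\otimes\operatorname{id})(\omega)$, which is bijective; the map does not depend on the choice of $\omega$), and sends $\theta_{a,b}$, $a+b>d$, to $(\theta_{a,d-a}\,r_{a+b-d})\circ(r_ar_d^{-1}\phi_{d-a,a+b-d})$. (A choice of a nonzero $\omega\in R_d$ identifies $M(r_d^{\pm1})$ with $k$; the statement holds for each choice.) For $\lambda\in\Lambda$ put $$\nabla(\lambda)=\operatorname{coker}\Big(\bigoplus_{\mu\to\lambda\text{ in }\mathcal U,\ \mu<\lambda}M(\mu)\to M(\lambda)\Big),\qquad \Delta(\lambda)=\ker\Big(M(\lambda)\to\bigoplus_{\lambda\to\mu\text{ in }\mathcal U,\ \mu<\lambda}M(\mu)\Big).$$ Let $\Lambda_1\subseteq\Lambda_2$ be saturated subsets of $\Lambda$ such that the elements of $\Lambda_2-\Lambda_1$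 are pairwise incomparable, let $\mathcal U_i\subseteq\mathcal U$ be the full subcategory with object set $\Lambda_i$, and let $\operatorname{End}_{\mathcal U_i}(M)$ be the algebra of natural endomorphisms of $M|_{\mathcal U_i}$. Then there is an exact sequence $$0\to\prod_{\lambda\in\Lambda_2-\Lambda_1}\operatorname{Hom}_k(\nabla(\lambda),\Delta(\lambda))\xrightarrow{\ \alpha\ }\operatorname{End}_{\mathcal U_2}(M)\xrightarrow{\ \beta\ }\operatorname{End}_{\mathcal U_1}(M)\to0,$$ where $\beta$ is restriction, and $\alpha((f_\lambda)_\lambda)$ is the natural transformation that is $0$ on $M(\mu)$ for $\mu\in\Lambda_1$ and is $M(\lambda)\to\nabla(\lambda)\xrightarrow{f_\lambda}\Delta(\lambda)\to M(\lambda)$ on $M(\lambda)$ for $\lambda\in\Lambda_2-\Lambda_1$. -/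

import Mathlib

open CategoryTheory
open scoped TensorProduct
universe u
namespace UAut

section Quadratic

variable (k : Type u) [Field k] (V : Type u) [AddCommGroup V] [Module k V]

/-- The degree one part `V` of the tensor algebra `TV`. -/
abbrev gens : Submodule k (TensorAlgebra k V) := LinearMap.range (TensorAlgebra.ι k)

/-- A presentation `TV/(R)` with quadratic relations `R ⊆ V ⊗ V ⊆ TV`. -/
structure QuadraticData where
  /-- The space of relations. -/
  rel : Submodule k (TensorAlgebra k V)
  rel_le : rel ≤ gens k V ^ 2

end Quadratic

section Linear
variable {k : Type u} [Field k]

lemma eq_zero_of_contract_right {W Q : Type*} [AddCommGroup W] [Module k W] [AddCommGroup Q]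
    [Module k Q] (s : W ⊗[k] Q)
    (h : ∀ ξ : Module.Dual k Q, TensorProduct.rid k W (LinearMap.lTensor W ξ s) = 0) : s = 0 := by
  classical
  have b := Module.Basis.ofVectorSpace k Q
  apply (TensorProduct.equivFinsuppOfBasisRight (M := W) b).injective
  ext i
  rw [TensorProduct.equivFinsuppOfBasisRight_apply, map_zero, Finsupp.zero_apply]
  exact h (b.coord i)

lemma eq_zero_of_contract_left {W Q : Type*} [AddCommGroup W] [Module k W] [AddCommGroup Q]
    [Module k Q] (s : W ⊗[k] Q)
    (h : ∀ ξ : Module.Dual k W, TensorProduct.lid k Q (LinearMap.rTensor Q ξ s) = 0) : s = 0 := by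
  classical
  have b := Module.Basis.ofVectorSpace k W
  apply (TensorProduct.equivFinsuppOfBasisLeft (N := Q) b).injective
  ext i
  rw [TensorProduct.equivFinsuppOfBasisLeft_apply, map_zero, Finsupp.zero_apply]
  exact h (b.coord i)

lemma contract_right {W W' Q : Type*} [AddCommGroup W] [Module k W] [AddCommGroup W'] [Module k W']
    [AddCommGroup Q] [Module k Q] (f : W →ₗ[k] W') (ξ : Module.Dual k Q) (s : W ⊗[k] Q) :
    TensorProduct.rid k W' (LinearMap.lTensor W' ξ (LinearMap.rTensor Q f s)) =
      f (TensorProduct.rid k W (LinearMap.lTensor W ξ s)) := by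
  induction s with
  | zero => simp
  | tmul x y => simp
  | add x y hx hy => simp only [map_add, hx, hy]

lemma contract_left {W Q Q' : Type*} [AddCommGroup W] [Module k W] [AddCommGroup Q] [Module k Q]
    [AddCommGroup Q'] [Module k Q'] (f : Q →ₗ[k] Q') (ξ : Module.Dual k W) (s : W ⊗[k] Q) :
    TensorProduct.lid k Q' (LinearMap.rTensor Q' ξ (LinearMap.lTensor W f s)) =
      f (TensorProduct.lid k Q (LinearMap.rTensor Q ξ s)) := by
  induction s with
  | zero => simp
  | tmul x y => simp
  | add x y hx hy => simp only [map_add, hx, hy]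

lemma tensor_inf {P Q : Type*} [AddCommGroup P] [Module k P] [AddCommGroup Q] [Module k Q]
    (X : Submodule k P) (Y : Submodule k Q) (t : P ⊗[k] Q)
    (h₁ : t ∈ LinearMap.range (LinearMap.rTensor Q X.subtype))
    (h₂ : t ∈ LinearMap.range (LinearMap.lTensor P Y.subtype)) :
    t ∈ LinearMap.range (TensorProduct.map X.subtype Y.subtype) := by
  obtain ⟨t', rfl⟩ := h₁
  rw [← lTensor_mkQ, LinearMap.mem_ker] at h₂
  have h3 : LinearMap.lTensor X Y.mkQ t' ∈ (⊥ : Submodule k _) := by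
    rw [Submodule.mem_bot]
    apply Module.Flat.rTensor_preserves_injective_linearMap (M := Q ⧸ Y) X.subtype X.subtype_injective
    rw [map_zero, ← h₂]
    simp [← LinearMap.comp_apply]
  rw [Submodule.mem_bot, ← LinearMap.mem_ker, lTensor_mkQ] at h3
  obtain ⟨t'', rfl⟩ := h3
  exact ⟨t'', by simp [← LinearMap.comp_apply]⟩

lemma mem_range_of_contract_right {P Q : Type*} [AddCommGroup P] [Module k P] [AddCommGroup Q]
    [Module k Q] (X : Submodule k P) (t : P ⊗[k] Q)
    (h : ∀ ξ : Module.Dual k Q, TensorProduct.rid k P (LinearMap.lTensor P ξ t) ∈ X) :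
    t ∈ LinearMap.range (LinearMap.rTensor Q X.subtype) := by
  rw [← rTensor_mkQ, LinearMap.mem_ker]
  refine eq_zero_of_contract_right _ fun ξ => ?_
  rw [contract_right, Submodule.mkQ_apply, Submodule.Quotient.mk_eq_zero]
  exact h ξ

lemma mem_range_of_contract_left {P Q : Type*} [AddCommGroup P] [Module k P] [AddCommGroup Q]
    [Module k Q] (Y : Submodule k Q) (t : P ⊗[k] Q)
    (h : ∀ ξ : Module.Dual k P, TensorProduct.lid k Q (LinearMap.rTensor Q ξ t) ∈ Y) :
    t ∈ LinearMap.range (LinearMap.lTensor P Y.subtype) := by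
  rw [← lTensor_mkQ, LinearMap.mem_ker]
  refine eq_zero_of_contract_left _ fun ξ => ?_
  rw [contract_left, Submodule.mkQ_apply, Submodule.Quotient.mk_eq_zero]
  exact h ξ

lemma contract_mem_right {S : Type*} [Ring S] [Algebra k S] {G H X : Submodule k S}
    (hd : G.LinearDisjoint H) (hX : X ≤ G) (t : G ⊗[k] H) (ht : Submodule.mulMap G H t ∈ X * H)
    (ξ : Module.Dual k H) :
    (TensorProduct.rid k G (LinearMap.lTensor G ξ t) : S) ∈ X := by
  rw [← Submodule.mulMap_range] at ht
  obtain ⟨s, hs⟩ := ht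
  rw [← Submodule.mulMap_comp_rTensor H hX] at hs
  obtain rfl := hd.injective hs
  clear hs
  induction s with
  | zero => simp
  | tmul x y => simpa using Submodule.smul_mem _ _ x.2
  | add x y hx hy => simp only [map_add]; exact Submodule.add_mem _ hx hy

lemma contract_mem_left {S : Type*} [Ring S] [Algebra k S] {G H X : Submodule k S}
    (hd : G.LinearDisjoint H) (hX : X ≤ H) (t : G ⊗[k] H) (ht : Submodule.mulMap G H t ∈ G * X)
    (ξ : Module.Dual k G) :
    (TensorProduct.lid k H (LinearMap.rTensor H ξ t) : S) ∈ X := by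
  rw [← Submodule.mulMap_range] at ht
  obtain ⟨s, hs⟩ := ht
  rw [← Submodule.mulMap_comp_lTensor G hX] at hs
  obtain rfl := hd.injective hs
  clear hs
  induction s with
  | zero => simp
  | tmul x y => simpa using Submodule.smul_mem _ _ y.2
  | add x y hx hy => simp only [map_add]; exact Submodule.add_mem _ hx hy

end Linear

section Tensor
variable {k : Type u} [Field k] {V : Type u} [AddCommGroup V] [Module k V]

lemma toTensorAlgebra_injective (n : ℕ) :
    Function.Injective (TensorPower.toTensorAlgebra (R := k) (M := V) (n := n)) := by
  intro x y h
  have key : ∀ z : ⨂[k]^n V,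
      TensorAlgebra.ofDirectSum (DirectSum.of (fun n => ⨂[k]^n V) n z) =
        TensorPower.toTensorAlgebra z := fun z =>
    DirectSum.toSemiring_of (A := fun n => ⨂[k]^n V)
      (fun _ => TensorPower.toTensorAlgebra.toAddMonoidHom)
      TensorPower.toTensorAlgebra_gOne (fun x y => by exact TensorPower.toTensorAlgebra_gMul x y) n z
  refine DirectSum.of_injective n ((TensorAlgebra.equivDirectSum (R := k) (M := V)).symm.injective
    (a₁ := DirectSum.of (fun n => ⨂[k]^n V) n x) (a₂ := DirectSum.of (fun n => ⨂[k]^n V) n y) ?_)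
  exact (key x).trans (h.trans (key y).symm)

lemma range_toTensorAlgebra (n : ℕ) :
    LinearMap.range (TensorPower.toTensorAlgebra (R := k) (M := V) (n := n)) = gens k V ^ n := by
  apply le_antisymm
  · rintro _ ⟨x, rfl⟩
    induction x using PiTensorProduct.induction_on with
    | smul_tprod r f =>
      rw [map_smul, TensorPower.toTensorAlgebra_tprod, TensorAlgebra.tprod_apply]
      refine Submodule.smul_mem _ _ ?_
      have := SetLike.list_prod_ofFn_mem_graded (A := fun n : ℕ => gens k V ^ n) (n := n) (fun _ => 1)
        (fun i => TensorAlgebra.ι k (f i)) (fun j => by simp)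
      simpa using this
    | add x y hx hy => rw [map_add]; exact Submodule.add_mem _ hx hy
  · induction n with
    | zero =>
      rw [pow_zero, Submodule.one_le]
      exact ⟨_, TensorPower.toTensorAlgebra_gOne⟩
    | succ n ih =>
      rw [pow_succ, Submodule.mul_le]
      rintro m hm _ ⟨v, rfl⟩
      obtain ⟨x, rfl⟩ := ih hm
      refine ⟨GradedMonoid.GMul.mul (A := fun n => ⨂[k]^n V) (j := 1) x
        (PiTensorProduct.tprod k (fun _ : Fin 1 => v)), ?_⟩
      rw [TensorPower.toTensorAlgebra_gMul, TensorPower.toTensorAlgebra_tprod]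
      simp [TensorAlgebra.tprod_apply]

lemma linearDisjoint_pow (a b : ℕ) : (gens k V ^ a).LinearDisjoint (gens k V ^ b) := by
  constructor
  let ta : (⨂[k]^a V) →ₗ[k] ↥(gens k V ^ a) := TensorPower.toTensorAlgebra.codRestrict _
    (fun x => (range_toTensorAlgebra (k := k) (V := V) a) ▸ LinearMap.mem_range_self _ x)
  let tb : (⨂[k]^b V) →ₗ[k] ↥(gens k V ^ b) := TensorPower.toTensorAlgebra.codRestrict _
    (fun x => (range_toTensorAlgebra (k := k) (V := V) b) ▸ LinearMap.mem_range_self _ x)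
  have hta : Function.Surjective ta := by
    rintro ⟨x, hx⟩
    rw [← range_toTensorAlgebra] at hx
    obtain ⟨y, rfl⟩ := hx
    exact ⟨y, rfl⟩
  have htb : Function.Surjective tb := by
    rintro ⟨x, hx⟩
    rw [← range_toTensorAlgebra] at hx
    obtain ⟨y, rfl⟩ := hx
    exact ⟨y, rfl⟩
  have hs := TensorProduct.map_surjective hta htb
  have key : (Submodule.mulMap (gens k V ^ a) (gens k V ^ b)) ∘ₗ TensorProduct.map ta tb =
      TensorPower.toTensorAlgebra ∘ₗ (TensorPower.mulEquiv (R := k) (M := V)).toLinearMap := by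
    apply TensorProduct.ext'
    intro x y
    exact (TensorPower.toTensorAlgebra_gMul x y).symm
  intro x y h
  obtain ⟨x, rfl⟩ := hs x
  obtain ⟨y, rfl⟩ := hs y
  have hx := LinearMap.congr_fun key x
  have hy := LinearMap.congr_fun key y
  simp only [LinearMap.comp_apply] at hx hy
  rw [hx, hy] at h
  have := (TensorPower.mulEquiv (R := k) (M := V)).injective (toTensorAlgebra_injective _ h)
  rw [this]


namespace QuadraticData

variable (D : QuadraticData k V)

/-- The spaces `R_l = ⋂_{i+j+2=l} V^i R V^j ⊆ V^l`, with `R_0 = k` and `R_1 = V`. -/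
def R : ℕ → Submodule k (TensorAlgebra k V)
  | 0 => 1
  | 1 => gens k V
  | n + 2 => ⨅ i : Fin (n + 1), gens k V ^ (i : ℕ) * D.rel * gens k V ^ (n - (i : ℕ))

lemma block_le' {i j n : ℕ} (h : i + j + 2 = n) :
    gens k V ^ i * D.rel * gens k V ^ j ≤ gens k V ^ n := by
  calc gens k V ^ i * D.rel * gens k V ^ j
      ≤ gens k V ^ i * gens k V ^ 2 * gens k V ^ j :=
        mul_le_mul' (mul_le_mul' le_rfl D.rel_le) le_rfl
    _ = gens k V ^ n := by rw [← pow_add, ← pow_add]; congr 1; omega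

lemma R_le : ∀ n, D.R n ≤ gens k V ^ n
  | 0 => by simp [R]
  | 1 => by simp [R]
  | n + 2 => (iInf_le _ (0 : Fin (n + 1))).trans (D.block_le' (by simp))

lemma linearDisjoint_R (a b : ℕ) : (D.R a).LinearDisjoint (D.R b) :=
  (linearDisjoint_pow a b).of_le_of_flat_right (D.R_le a) (D.R_le b)

lemma R_eq_biInf {n : ℕ} (hn : 0 < n) :
    D.R n = gens k V ^ n ⊓ ⨅ (i : ℕ) (j : ℕ) (_ : i + j + 2 = n),
      gens k V ^ i * D.rel * gens k V ^ j := by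
  apply le_antisymm
  · refine le_inf (D.R_le n) (le_iInf fun i => le_iInf fun j => le_iInf fun h => ?_)
    subst h
    refine (iInf_le _ (⟨i, by omega⟩ : Fin (i + j + 1))).trans (le_of_eq ?_)
    rw [show i + j - i = j by omega]
  · match n, hn with
    | 1, _ => exact inf_le_left.trans (le_of_eq (pow_one _))
    | n + 2, _ =>
      refine inf_le_right.trans (le_iInf fun i => ?_)
      exact (iInf_le _ (i : ℕ)).trans ((iInf_le _ (n - i)).trans (iInf_le _ (by omega)))

lemma R_add_le {a b : ℕ} (ha : 0 < a) (hb : 0 < b) : D.R (a + b) ≤ D.R a * D.R b := by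
  intro x hx
  rw [D.R_eq_biInf (by omega), Submodule.mem_inf] at hx
  obtain ⟨h0, hx⟩ := hx
  simp only [Submodule.mem_iInf] at hx
  rw [pow_add, ← Submodule.mulMap_range] at h0
  obtain ⟨t, rfl⟩ := h0
  have hd := linearDisjoint_pow (k := k) (V := V) a b
  have hl : t ∈ LinearMap.range (LinearMap.rTensor ↥(gens k V ^ b)
      ((D.R a).comap (gens k V ^ a).subtype).subtype) := by
    refine mem_range_of_contract_right _ t fun ξ => ?_
    rw [Submodule.mem_comap, D.R_eq_biInf ha]
    refine ⟨Subtype.property _, ?_⟩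
    simp only [SetLike.mem_coe, Submodule.mem_iInf]
    intro i j hij
    refine contract_mem_right hd (D.block_le' hij) t ?_ ξ
    have := hx i (j + b) (by omega)
    rwa [pow_add, ← mul_assoc] at this
  have hr : t ∈ LinearMap.range (LinearMap.lTensor ↥(gens k V ^ a)
      ((D.R b).comap (gens k V ^ b).subtype).subtype) := by
    refine mem_range_of_contract_left _ t fun ξ => ?_
    rw [Submodule.mem_comap, D.R_eq_biInf hb]
    refine ⟨Subtype.property _, ?_⟩
    simp only [SetLike.mem_coe, Submodule.mem_iInf]
    intro i j hij
    refine contract_mem_left hd (D.block_le' hij) t ?_ ξ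
    have := hx (a + i) j (by omega)
    rwa [pow_add, mul_assoc, mul_assoc, ← mul_assoc (gens k V ^ i)] at this
  obtain ⟨s, rfl⟩ := tensor_inf _ _ t hl hr
  clear hx hl hr
  induction s with
  | zero => simp
  | tmul x y => exact Submodule.mul_mem_mul x.2 y.2
  | add x y hx hy => simp only [map_add]; exact Submodule.add_mem _ hx hy

/-- The inclusion `R_{a+b} ⊆ R_a ⊗ R_b`. It is the map through which the inclusion
`R_{a+b} ⊆ TV` factors over the (injective) multiplication `R_a ⊗ R_b → TV`. -/
noncomputable def incl {a b : ℕ} (ha : 0 < a) (hb : 0 < b) : D.R (a + b) →ₗ[k] D.R a ⊗[k] D.R b :=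
  (D.linearDisjoint_R a b).mulMap.symm.toLinearMap ∘ₗ Submodule.inclusion (D.R_add_le ha hb)

lemma mulMap_incl {a b : ℕ} (ha : 0 < a) (hb : 0 < b) (x : D.R (a + b)) :
    Submodule.mulMap (D.R a) (D.R b) (D.incl ha hb x) = x := by
  have := (D.linearDisjoint_R a b).mulMap.apply_symm_apply (Submodule.inclusion (D.R_add_le ha hb) x)
  exact congrArg Subtype.val this

end QuadraticData

end Tensor

/-! ### Koszulity and Artin-Schelter regularity -/

namespace QuadraticData

section

variable {k : Type u} [Field k] {V : Type u} [AddCommGroup V] [Module k V] (D : QuadraticData k V)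

/-- The relations `x = 0` for `x ∈ R`. -/
inductive Vanish : TensorAlgebra k V → TensorAlgebra k V → Prop
  | of {x : TensorAlgebra k V} (hx : x ∈ D.rel) : Vanish x 0

/-- The algebra `A = TV/(R)`. -/
abbrev A : Type u := RingQuot D.Vanish

/-- The inclusion of the generators `V → A`. -/
def gen : V →ₗ[k] D.A := (RingQuot.mkAlgHom k D.Vanish).toLinearMap ∘ₗ TensorAlgebra.ι k

/-- The left ideal `A_{≥ 1}`, generated by `V`. -/
def augIdeal : Ideal D.A := Ideal.span (Set.range D.gen)

/-- `A` is Koszul: the trivial left module `k = A/A_{≥ 1}` has a linear free resolution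
`⋯ → ⨁_{I 1} A(-2) → ⨁_{I 0} A(-1) → A → k → 0`. The maps are homogeneous of degree `0`,
i.e. the matrix entries lie in the degree one part `V` of `A`. -/
def IsKoszul : Prop :=
  ∃ (I : ℕ → Type u) (δ₀ : (I 0 →₀ D.A) →ₗ[D.A] D.A)
    (δ : ∀ n, (I (n + 1) →₀ D.A) →ₗ[D.A] (I n →₀ D.A)),
    (∀ i, δ₀ (Finsupp.single i 1) ∈ LinearMap.range D.gen) ∧
    (∀ n i j, δ n (Finsupp.single i 1) j ∈ LinearMap.range D.gen) ∧
    LinearMap.range δ₀ = D.augIdeal ∧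
    Function.Exact (δ 0) δ₀ ∧
    ∀ n, Function.Exact (δ (n + 1)) (δ n)

/-- The trivial left `A`-module `k = A/A_{≥ 1}`. -/
noncomputable def triv : ModuleCat.{u} D.A := ModuleCat.of D.A (D.A ⧸ D.augIdeal)

/-- `A` is Artin-Schelter regular of dimension `d`: it has global dimension `d`,
`Ext^i_A(k, A) = 0` for `i ≠ d`, and `Ext^d_A(k, A)` is the trivial module up to a shift of the
grading, i.e. it is one-dimensional over `k`. -/
def IsASRegular (d : ℕ) : Prop :=
  IsLeast {n : ℕ | ∀ X : ModuleCat.{u} D.A, HasProjectiveDimensionLE X n} d ∧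
  (∀ i : ℕ, i ≠ d → Subsingleton (Abelian.Ext D.triv (ModuleCat.of D.A D.A) i)) ∧
  Module.finrank k (Abelian.Ext D.triv (ModuleCat.of D.A D.A) d) = 1

end

end QuadraticData

/-! ### The ordered monoid `Λ` -/

section Monoid

/-- The indices `1, …, d - 1`. -/
abbrev Letter (d : ℕ) : Type := {a : ℕ // 0 < a ∧ a < d}

/-- The monoid `Λ = ⟨r_1, …, r_{d-1}, r_d^{±1}⟩`: the free product of the free monoid on
`r_1, …, r_{d-1}` and the infinite cyclic group generated by `r_d`. -/
def Lam (d : ℕ) : Type := Monoid.Coprod (FreeMonoid (Letter d)) (Multiplicative ℤ)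

instance (d : ℕ) : Monoid (Lam d) :=
  inferInstanceAs (Monoid (Monoid.Coprod (FreeMonoid (Letter d)) (Multiplicative ℤ)))

variable {d : ℕ}

/-- Homomorphisms out of `Λ`. -/
def Lam.lift {P : Type*} [Monoid P] (f : Letter d → P) (g : Multiplicative ℤ →* P) : Lam d →* P :=
  Monoid.Coprod.lift (FreeMonoid.lift f) g

/-- The power `r_d^n`. -/
def rd (d : ℕ) (n : ℤ) : Lam d :=
  (Monoid.Coprod.inr (Multiplicative.ofAdd n) :
    Monoid.Coprod (FreeMonoid (Letter d)) (Multiplicative ℤ))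

/-- The generator `r_a`, `1 ≤ a ≤ d - 1`. -/
def letter (a : Letter d) : Lam d :=
  (Monoid.Coprod.inl (FreeMonoid.of a) :
    Monoid.Coprod (FreeMonoid (Letter d)) (Multiplicative ℤ))

/-- The elements `r_0 = 1`, `r_1, …, r_d` of `Λ` (not used for indices larger than `d`). -/
def r (d : ℕ) (a : ℕ) : Lam d :=
  if h : 0 < a ∧ a < d then letter ⟨a, h⟩ else if a = 0 then 1 else rd d 1

@[simp] lemma Lam.lift_rd {P : Type*} [Monoid P] (f : Letter d → P) (g : Multiplicative ℤ →* P)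
    (n : ℤ) : Lam.lift f g (rd d n) = g (Multiplicative.ofAdd n) :=
  Monoid.Coprod.lift_apply_inr _ _ _

lemma Lam.lift_r {P : Type*} [Monoid P] (f : Letter d → P) (g : Multiplicative ℤ →* P)
    {a : ℕ} (h : 0 < a ∧ a < d) : Lam.lift f g (r d a) = f ⟨a, h⟩ := by
  rw [r, dif_pos h]
  exact (Monoid.Coprod.lift_apply_inl _ _ _).trans (FreeMonoid.lift_eval_of _ _)

@[simp] lemma r_zero : r d 0 = 1 := by simp [r]

lemma r_self (hd : 0 < d) : r d d = rd d 1 := by simp [r, hd.ne']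

lemma rd_mul (m n : ℤ) : rd d m * rd d n = rd d (m + n) :=
  (map_mul (Monoid.Coprod.inr : _ →* Monoid.Coprod (FreeMonoid (Letter d)) (Multiplicative ℤ))
    (Multiplicative.ofAdd m) (Multiplicative.ofAdd n)).symm

@[simp] lemma rd_zero : rd d 0 = 1 :=
  map_one (Monoid.Coprod.inr : _ →* Monoid.Coprod (FreeMonoid (Letter d)) (Multiplicative ℤ))

/-- The generating inequalities of the order on `Λ`, multiplied on the left and the right. -/
inductive Step (d : ℕ) : Lam d → Lam d → Prop
  | phi (u v : Lam d) (a b : ℕ) (ha : 0 < a) (hb : 0 < b) (hab : a + b ≤ d) :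
      Step d (u * r d (a + b) * v) (u * (r d a * r d b) * v)
  | theta (u v : Lam d) (a b : ℕ) (ha : a < d) (hb : b < d) (hab : d ≤ a + b) :
      Step d (u * r d (a + b - d) * v) (u * (r d a * rd d (-1) * r d b) * v)

/-- An order preserving homomorphism `Λ → ℤ`, `r_a ↦ a (d - a)`; it shows antisymmetry. -/
def weight (d : ℕ) : Lam d →* Multiplicative ℤ :=
  Lam.lift (fun a => Multiplicative.ofAdd ((a.1 : ℤ) * (d - a.1))) 1

lemma weight_r {a : ℕ} (h : a ≤ d) : (weight d (r d a)).toAdd = (a : ℤ) * (d - a) := by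
  by_cases h0 : a = 0
  · subst h0; simp
  by_cases h1 : a = d
  · subst h1; rw [r_self (by omega), weight, Lam.lift_rd]; simp
  · rw [weight, Lam.lift_r _ _ (by omega), toAdd_ofAdd]

lemma Step.weight_lt {x y : Lam d} (h : Step d x y) :
    (weight d x).toAdd < (weight d y).toAdd := by
  cases h with
  | phi u v a b ha hb hab =>
    simp only [map_mul, toAdd_mul, weight_r hab, weight_r (show a ≤ d by omega),
      weight_r (show b ≤ d by omega)]
    push_cast
    have : (0 : ℤ) < a * b := by positivity
    nlinarith
  | theta u v a b ha hb hab =>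
    simp only [map_mul, toAdd_mul, weight_r (show a + b - d ≤ d by omega), weight_r ha.le,
      weight_r hb.le]
    have h3 : (weight d (rd d (-1))).toAdd = 0 := by rw [weight, Lam.lift_rd]; simp
    rw [h3]
    push_cast [Nat.cast_sub hab]
    have : (0 : ℤ) < (d - a) * (d - b) := by
      have h1 : (a : ℤ) < d := by exact_mod_cast ha
      have h2 : (b : ℤ) < d := by exact_mod_cast hb
      exact mul_pos (by linarith) (by linarith)
    nlinarith

lemma weight_mono {x y : Lam d} (h : Relation.ReflTransGen (Step d) x y) :
    x = y ∨ (weight d x).toAdd < (weight d y).toAdd := by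
  induction h with
  | refl => exact Or.inl rfl
  | tail _ h ih =>
    rcases ih with rfl | ih
    · exact Or.inr h.weight_lt
    · exact Or.inr (ih.trans h.weight_lt)

/-- The left and right invariant partial order on `Λ` generated by `r_{a+b} < r_a r_b` and
`r_{a+b-d} < r_a r_d⁻¹ r_b`. -/
instance : PartialOrder (Lam d) where
  le := Relation.ReflTransGen (Step d)
  le_refl _ := Relation.ReflTransGen.refl
  le_trans _ _ _ := Relation.ReflTransGen.trans
  le_antisymm x y h₁ h₂ := by
    rcases weight_mono h₁ with h | h
    · exact h
    · rcases weight_mono h₂ with h' | h'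
      · exact h'.symm
      · exact absurd h' (not_lt.mpr h.le)

end Monoid

/-! ### The category `𝒰` -/

section Category

/-- The generating morphisms `φ_{a,b} : r_{a+b} → r_a r_b` and
`θ_{a,b} : r_a r_d⁻¹ r_b → r_{a+b-d}`. -/
inductive Gen (d : ℕ) : Lam d → Lam d → Type
  | phi (a b : ℕ) (ha : 0 < a) (hb : 0 < b) (hab : a + b ≤ d) :
      Gen d (r d (a + b)) (r d a * r d b)
  | theta (a b : ℕ) (ha : a < d) (hb : b < d) (hab : d ≤ a + b) :
      Gen d (r d a * rd d (-1) * r d b) (r d (a + b - d))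

/-- The whiskered generators `u g v : u s v → u t v`, for `g : s → t` a generating morphism and
`u, v ∈ Λ`. -/
structure Arrow (d : ℕ) (x y : Lam d) : Type where
  /-- The factor on the left. -/
  left : Lam d
  /-- The source of the generator. -/
  src : Lam d
  /-- The target of the generator. -/
  tgt : Lam d
  /-- The factor on the right. -/
  right : Lam d
  /-- The generator. -/
  gen : Gen d src tgt
  hx : x = left * src * right
  hy : y = left * tgt * right

instance (d : ℕ) : Quiver (Lam d) := ⟨Arrow d⟩

/-- The path category of the whiskered generators. -/
abbrev Pre (d : ℕ) : Type := Paths (Lam d)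

variable {d : ℕ}

/-- An element of `Λ` as an object of the path category. -/
abbrev Pre.of (x : Lam d) : Pre d := (Paths.of (Lam d)).obj x

/-- The morphism `u g v` of the path category. -/
def arr {s t : Lam d} (u : Lam d) (g : Gen d s t) (v : Lam d) {x y : Lam d}
    (hx : x = u * s * v) (hy : y = u * t * v) : Pre.of x ⟶ Pre.of y :=
  (Paths.of (Lam d)).map (⟨u, s, t, v, g, hx, hy⟩ : Arrow d x y)

/-- `u φ_{a,b} v`, with the convention that `φ_{0,b}` and `φ_{a,0}` are identities. -/
def phi (u : Lam d) (a b : ℕ) (hab : a + b ≤ d) (v : Lam d) {x y : Lam d}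
    (hx : x = u * r d (a + b) * v) (hy : y = u * (r d a * r d b) * v) :
    Pre.of x ⟶ Pre.of y :=
  if h : 0 < a ∧ 0 < b then arr u (.phi a b h.1 h.2 hab) v hx hy
  else eqToHom (congrArg Pre.of (by
    rw [hx, hy]
    rcases (show a = 0 ∨ b = 0 by omega) with rfl | rfl <;> simp))

/-- `u θ_{a,b} v`, with the convention that `θ_{d,b}` and `θ_{a,d}` are identities. -/
def theta (u : Lam d) (a b : ℕ) (ha : a ≤ d) (hb : b ≤ d) (hd : 0 < d) (hab : d ≤ a + b)
    (v : Lam d) {x y : Lam d}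
    (hx : x = u * (r d a * rd d (-1) * r d b) * v) (hy : y = u * r d (a + b - d) * v) :
    Pre.of x ⟶ Pre.of y :=
  if h : a < d ∧ b < d then arr u (.theta a b h.1 h.2 hab) v hx hy
  else eqToHom (congrArg Pre.of (by
    rw [hx, hy]
    rcases (show a = d ∨ b = d by omega) with rfl | rfl
    · rw [r_self hd, rd_mul]; simp
    · rw [r_self hd, mul_assoc (r b a), rd_mul]; simp))

/-- The relations between the morphisms of `𝒰`: the interchange law of a strict monoidal category,
and the relations on the generators, multiplied on the left and the right by objects. -/
inductive Rel (d : ℕ) : HomRel (Pre d)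
  /-- The interchange law. -/
  | interchange {s t s' t' : Lam d} (u w v : Lam d) (g : Gen d s t) (g' : Gen d s' t') :
      Rel d
        (arr (x := u * s * w * s' * v) (y := u * t * w * s' * v) u g (w * s' * v)
            (by simp only [mul_assoc]) (by simp only [mul_assoc]) ≫
          arr (y := u * t * w * t' * v) (u * t * w) g' v (by simp only [mul_assoc])
            (by simp only [mul_assoc]))
        (arr (x := u * s * w * s' * v) (y := u * s * w * t' * v) (u * s * w) g' v
            (by simp only [mul_assoc]) (by simp only [mul_assoc]) ≫
          arr (y := u * t * w * t' * v) u g (w * t' * v) (by simp only [mul_assoc])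
            (by simp only [mul_assoc]))
  /-- `(r_a φ_{b,c}) ∘ φ_{a,b+c} = (φ_{a,b} r_c) ∘ φ_{a+b,c}` -/
  | phi_phi (u v : Lam d) (a b c : ℕ) (ha : 0 < a) (hb : 0 < b) (hc : 0 < c)
      (h : a + b + c ≤ d) :
      Rel d
        (phi (x := u * r d (a + b + c) * v) (y := u * (r d a * r d (b + c)) * v)
            u a (b + c) (by omega) v (by rw [add_assoc]) rfl ≫
          phi (y := u * (r d a * r d b * r d c) * v) (u * r d a) b c (by omega) v
            (by simp only [mul_assoc]) (by simp only [mul_assoc]))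
        (phi (x := u * r d (a + b + c) * v) (y := u * (r d (a + b) * r d c) * v)
            u (a + b) c (by omega) v rfl rfl ≫
          phi (y := u * (r d a * r d b * r d c) * v) u a b (by omega) (r d c * v)
            (by simp only [mul_assoc]) (by simp only [mul_assoc]))
  /-- `θ_{a+b-d,c} ∘ (θ_{a,b} r_d⁻¹ r_c) = θ_{a,b+c-d} ∘ (r_a r_d⁻¹ θ_{b,c})` -/
  | theta_theta (u v : Lam d) (a b c : ℕ) (ha : a < d) (hb : b < d) (hc : c < d)
      (h : 2 * d ≤ a + b + c) :
      Rel d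
        (theta (x := u * (r d a * rd d (-1) * r d b * rd d (-1) * r d c) * v)
            (y := u * (r d (a + b - d) * rd d (-1) * r d c) * v)
            u a b (by omega) (by omega) (by omega) (by omega) (rd d (-1) * r d c * v)
            (by simp only [mul_assoc]) (by simp only [mul_assoc]) ≫
          theta (y := u * r d (a + b + c - 2 * d) * v)
            u (a + b - d) c (by omega) (by omega) (by omega) (by omega) v rfl
            (by rw [show a + b - d + c - d = a + b + c - 2 * d by omega]))
        (theta (x := u * (r d a * rd d (-1) * r d b * rd d (-1) * r d c) * v)
            (y := u * (r d a * rd d (-1) * r d (b + c - d)) * v)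
            (u * (r d a * rd d (-1))) b c (by omega) (by omega) (by omega) (by omega) v
            (by simp only [mul_assoc]) (by simp only [mul_assoc]) ≫
          theta (y := u * r d (a + b + c - 2 * d) * v)
            u a (b + c - d) (by omega) (by omega) (by omega) (by omega) v rfl
            (by rw [show a + (b + c - d) - d = a + b + c - 2 * d by omega]))
  /-- `(r_a θ_{b,c}) ∘ (φ_{a,b} r_d⁻¹ r_c) = φ_{a,b+c-d} ∘ θ_{a+b,c}` -/
  | phi_theta (u v : Lam d) (a b c : ℕ) (ha : 0 < a) (hb : 0 < b) (hab : a + b ≤ d) (hc : c < d)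
      (h : d ≤ b + c) :
      Rel d
        (phi (x := u * (r d (a + b) * rd d (-1) * r d c) * v)
            (y := u * (r d a * r d b * rd d (-1) * r d c) * v)
            u a b hab (rd d (-1) * r d c * v)
            (by simp only [mul_assoc]) (by simp only [mul_assoc]) ≫
          theta (y := u * (r d a * r d (b + c - d)) * v)
            (u * r d a) b c (by omega) (by omega) (by omega) h v
            (by simp only [mul_assoc]) (by simp only [mul_assoc]))
        (theta (x := u * (r d (a + b) * rd d (-1) * r d c) * v)
            (y := u * r d (a + b + c - d) * v)
            u (a + b) c (by omega) (by omega) (by omega) (by omega) v rfl rfl ≫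
          phi (y := u * (r d a * r d (b + c - d)) * v) u a (b + c - d) (by omega) v
            (by rw [show a + (b + c - d) = a + b + c - d by omega]) rfl)
  /-- `(θ_{a,b} r_c) ∘ (r_a r_d⁻¹ φ_{b,c}) = φ_{a+b-d,c} ∘ θ_{a,b+c}` -/
  | theta_phi (u v : Lam d) (a b c : ℕ) (ha : a < d) (hb : 0 < b) (hc : 0 < c) (hbc : b + c ≤ d)
      (h : d ≤ a + b) :
      Rel d
        (phi (x := u * (r d a * rd d (-1) * r d (b + c)) * v)
            (y := u * (r d a * rd d (-1) * r d b * r d c) * v)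
            (u * (r d a * rd d (-1))) b c hbc v
            (by simp only [mul_assoc]) (by simp only [mul_assoc]) ≫
          theta (y := u * (r d (a + b - d) * r d c) * v)
            u a b (by omega) (by omega) (by omega) h (r d c * v)
            (by simp only [mul_assoc]) (by simp only [mul_assoc]))
        (theta (x := u * (r d a * rd d (-1) * r d (b + c)) * v)
            (y := u * r d (a + b + c - d) * v)
            u a (b + c) (by omega) (by omega) (by omega) (by omega) v rfl
            (by rw [show a + (b + c) - d = a + b + c - d by omega]) ≫
          phi (y := u * (r d (a + b - d) * r d c) * v) u (a + b - d) c (by omega) v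
            (by rw [show a + b - d + c = a + b + c - d by omega]) rfl)

/-- The category `𝒰`, with object set `Λ`. -/
abbrev U (d : ℕ) : Type := CategoryTheory.Quotient (Rel d)

/-- The element of `Λ` that an object of `𝒰` is. -/
def U.lam (X : U d) : Lam d := X.as

/-- The element `u ∈ Λ` as an object of `𝒰`. -/
def U.of (u : Lam d) : U d := ⟨u⟩

end Category

/-! ### The functor `M` -/

namespace QuadraticData

variable {k : Type u} [Field k] {V : Type u} [AddCommGroup V] [Module k V] (D : QuadraticData k V)

/-- The space `R_{a_1} ⊗ (R_{a_2} ⊗ (⋯ ⊗ k))`. -/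
noncomputable def tens : List ℕ → ModuleCat.{u} k
  | [] => ModuleCat.of k k
  | a :: l => ModuleCat.of k (D.R a ⊗[k] tens l)

/-- Concatenation of lists corresponds to the tensor product. -/
noncomputable def tensAppend : ∀ l l' : List ℕ, D.tens (l ++ l') ≃ₗ[k] D.tens l ⊗[k] D.tens l'
  | [], l' => (TensorProduct.lid k (D.tens l')).symm
  | a :: l, l' =>
    (TensorProduct.congr (LinearEquiv.refl k (D.R a)) (tensAppend l l')).trans
      (TensorProduct.assoc k (D.R a) (D.tens l) (D.tens l')).symm

/-- The identity, for equal lists. -/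
noncomputable def tensCast {l l' : List ℕ} (h : l = l') : D.tens l ≃ₗ[k] D.tens l' :=
  h ▸ LinearEquiv.refl k (D.tens l)

variable {d : ℕ}

/-- The indices of the letters `r_1, …, r_{d-1}` in an element of `Λ`, in their order. -/
def letters : Lam d →* FreeMonoid ℕ := Lam.lift (fun a => FreeMonoid.of a.1) 1

/-- The list underlying `letters`. -/
def word (u : Lam d) : List ℕ := FreeMonoid.toList (letters u)

lemma word_mul (u v : Lam d) : word (u * v) = word u ++ word v := by simp [word]

lemma word_rd (n : ℤ) : word (rd d n) = [] := by
  rw [word, letters, Lam.lift_rd]; rfl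

lemma word_r {a : ℕ} (h : 0 < a ∧ a < d) : word (r d a) = [a] := by
  rw [word, letters, Lam.lift_r _ _ h]; rfl

lemma word_zero : word (r d 0) = [] := by rw [r_zero]; simp [word]

lemma word_self : word (r d d) = [] := by
  rcases Nat.eq_zero_or_pos d with rfl | h
  · exact word_zero
  · rw [r_self h, word_rd]

/-- The space `M(u)`, for `u ∈ Λ`: the tensor product of the spaces `R_a`, over the letters `r_a`,
`1 ≤ a ≤ d - 1`, of `u`. The lines `M(r_d) = R_d` and `M(r_d⁻¹)` are identified with `k` by means of
a chosen nonzero element `ω` of `R_d`. -/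
noncomputable abbrev obj (u : Lam d) : ModuleCat.{u} k := D.tens (word u)

/-- `M(uv) = M(u) ⊗ M(v)`. -/
noncomputable def objMul (u v : Lam d) : D.obj (u * v) ≃ₗ[k] D.obj u ⊗[k] D.obj v :=
  (D.tensCast (word_mul u v)).trans (D.tensAppend _ _)

/-- `M(u) = k`, if `u` has no letters. -/
noncomputable def objNil {u : Lam d} (h : word u = []) : D.obj u ≃ₗ[k] k := D.tensCast h

/-- `M(u) = R_a`, if `r_a` is the only letter of `u`. -/
noncomputable def objOne {u : Lam d} {a : ℕ} (h : word u = [a]) : D.obj u ≃ₗ[k] D.R a :=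
  (D.tensCast h).trans (TensorProduct.rid k (D.R a))

/-- `M(u) = R_a ⊗ R_b`, if the letters of `u` are `r_a`, `r_b`. -/
noncomputable def objTwo {u : Lam d} {a b : ℕ} (h : word u = [a, b]) :
    D.obj u ≃ₗ[k] D.R a ⊗[k] D.R b :=
  (D.tensCast h).trans
    (TensorProduct.congr (LinearEquiv.refl k (D.R a)) (TensorProduct.rid k (D.R b)))

/-- The identity `R_a → R_b`, for `a = b`. -/
def castR {a b : ℕ} (h : a = b) : D.R a →ₗ[k] D.R b :=
  Submodule.inclusion (le_of_eq (congrArg D.R h))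

variable (ω : D.R d)

/-- The map `R_a^* → R_b`, `a + b = d`, obtained from `ω ∈ R_d ⊆ R_a ⊗ R_b` by contraction. -/
noncomputable def dualMap (a b : ℕ) (ha : 0 < a) (hb : 0 < b) (h : a + b = d) :
    Module.Dual k (D.R a) →ₗ[k] D.R b where
  toFun ξ := TensorProduct.lid k (D.R b)
    (LinearMap.rTensor (D.R b) ξ (D.incl ha hb (D.castR h.symm ω)))
  map_add' ξ η := by rw [LinearMap.rTensor_add, LinearMap.add_apply, map_add]
  map_smul' c ξ := by rw [LinearMap.rTensor_smul, LinearMap.smul_apply, map_smul]; rfl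

open Classical in
/-- The inverse of a linear map (if it is bijective; for an Artin-Schelter regular algebra this is
only applied to isomorphisms). -/
noncomputable def linv {W W' : Type u} [AddCommGroup W] [Module k W] [AddCommGroup W']
    [Module k W'] (f : W →ₗ[k] W') : W' →ₗ[k] W :=
  if h : Function.Bijective f then (LinearEquiv.ofBijective f h).symm.toLinearMap else 0

/-- The pairing `R_a ⊗ R_b → k`, `a + b = d`, given by the inverse `R_a → R_b^*` of the map
`R_b^* → R_a`. -/
noncomputable def pairing (a b : ℕ) (ha : 0 < a) (hb : 0 < b) (h : a + b = d) :
    D.R a ⊗[k] D.R b →ₗ[k] k :=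
  TensorProduct.lift (linv (D.dualMap ω b a hb ha (by omega)))

/-- The map `R_a ⊗ R_b → R_{a+b-d}`, `a + b > d`: the inclusion
`R_a ⊗ R_b → R_a ⊗ R_{d-a} ⊗ R_{a+b-d}` followed by the pairing of the first two factors. -/
noncomputable def contract (a b : ℕ) (ha : a < d) (hb : b < d) (hab : d < a + b) :
    D.R a ⊗[k] D.R b →ₗ[k] D.R (a + b - d) :=
  (TensorProduct.lid k (D.R (a + b - d))).toLinearMap ∘ₗ
  LinearMap.rTensor (D.R (a + b - d))
    (D.pairing ω a (d - a) (by omega) (by omega) (by omega)) ∘ₗ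
  (TensorProduct.assoc k (D.R a) (D.R (d - a)) (D.R (a + b - d))).symm.toLinearMap ∘ₗ
  LinearMap.lTensor (D.R a)
    (D.incl (a := d - a) (b := a + b - d) (by omega) (by omega) ∘ₗ D.castR (by omega))

/-- The map `M(r_a) → R_a`, `1 ≤ a ≤ d`: the identity for `a < d`, and `1 ↦ ω` for `a = d`. -/
noncomputable def fromObj (a : ℕ) (ha : 0 < a) (had : a ≤ d) : D.obj (r d a) →ₗ[k] D.R a :=
  if h : a < d then (D.objOne (word_r ⟨ha, h⟩)).toLinearMap
  else
    D.castR (by omega) ∘ₗ LinearMap.toSpanSingleton k (D.R d) ω ∘ₗ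
      (D.objNil (by rw [show a = d by omega, word_self])).toLinearMap

/-- `M` on the generating morphisms. -/
noncomputable def genMap {s t : Lam d} : Gen d s t → (D.obj s →ₗ[k] D.obj t)
  | .phi a b ha hb hab =>
    (D.objTwo (by rw [word_mul, word_r (by omega), word_r (by omega)]; rfl)).symm.toLinearMap ∘ₗ
      D.incl ha hb ∘ₗ D.fromObj ω (a + b) (by omega) hab
  | .theta a b ha hb hab =>
    (if h : a + b = d then
      (D.objNil (by rw [show a + b - d = 0 by omega, word_zero])).symm.toLinearMap ∘ₗ
        D.pairing ω a b (by omega) (by omega) h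
    else
      (D.objOne (word_r (by omega))).symm.toLinearMap ∘ₗ
        D.contract ω a b ha hb (by omega)) ∘ₗ
    (D.objTwo (by
      rw [word_mul, word_mul, word_rd, word_r (by omega), word_r (by omega)]; rfl)).toLinearMap

/-- `M` on the morphisms `u g v`: the map `M(u) ⊗ M(g) ⊗ M(v)`. -/
noncomputable def arrowMap {x y : Lam d} (f : Arrow d x y) : D.obj x →ₗ[k] D.obj y :=
  (D.tensCast (congrArg word f.hy)).symm.toLinearMap ∘ₗ
  (D.objMul (f.left * f.tgt) f.right).symm.toLinearMap ∘ₗ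
  LinearMap.rTensor (D.obj f.right)
    ((D.objMul f.left f.tgt).symm.toLinearMap ∘ₗ
      LinearMap.lTensor (D.obj f.left) (D.genMap ω f.gen) ∘ₗ
      (D.objMul f.left f.src).toLinearMap) ∘ₗ
  (D.objMul (f.left * f.src) f.right).toLinearMap ∘ₗ
  (D.tensCast (congrArg word f.hx)).toLinearMap

/-- `M` on the path category of the generators. -/
noncomputable def preM : Pre d ⥤ ModuleCat.{u} k :=
  Paths.lift { obj := fun u => D.obj u, map := fun f => ModuleCat.ofHom (D.arrowMap ω f) }

/-- `M` is compatible with the relations of `𝒰`. -/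
def Compatible : Prop :=
  ∀ (x y : Pre d) (p q : x ⟶ y), Rel d p q → (D.preM ω).map p = (D.preM ω).map q

/-- The functor `M : 𝒰 → Vect`. -/
noncomputable def M (h : D.Compatible ω) : U d ⥤ ModuleCat.{u} k :=
  CategoryTheory.Quotient.lift (Rel d) (D.preM ω) h

end QuadraticData

/-! ### Standard and costandard spaces, endomorphisms of `M` -/

section Standard

variable {k : Type u} [Field k] {d : ℕ} (F : U d ⥤ ModuleCat.{u} k)

/-- The sum of the images of the maps `M(μ) → M(λ)`, for `μ → λ` in `𝒰` and `μ < λ`. -/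
def lowerImage (X : U d) : Submodule k (F.obj X) :=
  ⨆ (Y : U d) (_ : Y.lam < X.lam) (f : Y ⟶ X), LinearMap.range (F.map f).hom

/-- `∇(λ)`, the cokernel of `⨁ M(μ) → M(λ)` over all `μ → λ` in `𝒰` with `μ < λ`. -/
abbrev costandard (X : U d) : Type u := F.obj X ⧸ lowerImage F X

/-- `Δ(λ)`, the kernel of `M(λ) → ⨁ M(μ)` over all `λ → μ` in `𝒰` with `μ < λ`. -/
def standard (X : U d) : Submodule k (F.obj X) :=
  ⨅ (Y : U d) (_ : Y.lam < X.lam) (f : X ⟶ Y), LinearMap.ker (F.map f).hom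

/-- The property of the objects of `𝒰` to lie in `S ⊆ Λ`. -/
def objIn (S : Set (Lam d)) : ObjectProperty (U d) := fun X => X.lam ∈ S

/-- `End_{𝒰_S}(M)`: the natural endomorphisms of the restriction of `M` to the full subcategory
`𝒰_S` of `𝒰` with object set `S`. -/
abbrev EndOn (S : Set (Lam d)) : Type u := End ((objIn S).ι ⋙ F)

/-- The restriction map `End_{𝒰_T}(M) → End_{𝒰_S}(M)`, for `S ⊆ T`. -/
def restrict {S T : Set (Lam d)} (h : S ⊆ T) : EndOn F T →ₗ[k] EndOn F S where
  toFun η := Functor.whiskerLeft (ObjectProperty.ιOfLE (fun _ hX => h hX : objIn S ≤ objIn T)) η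
  map_add' _ _ := rfl
  map_smul' _ _ := rfl

end Standard

end UAut

/-! The left half of the sequence is formal. An endomorphism that vanishes on everything below `λ`
kills all images of maps from below and lands in all kernels of maps to below, so on `M(λ)` it
factors through a map `∇(λ) → Δ(λ)`; conversely every such map is natural. The content is the
existence of `M` and the surjectivity of restriction: an endomorphism `η` given strictly below `λ`
has to be extended to `M(λ)`. Incomparable elements do not interact, because every generator joins
comparable ones.

Every morphism of `𝒰` is a composition of generators `θ`, which descend, followed by generators `φ`,
which ascend (`exists_factorization`). A morphism between objects of a saturated set can therefore
be written inside that set, and naturality only has to be tested on generators.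

For the `φ` with target `λ`: multiplication embeds `M(λ)` in some `V^N`, and the images of the `φ`
are intersections of subspaces `V^i R V^j`. Koszulity makes these subspaces distributive (Backelin),
so maps prescribed on the images glue as soon as they agree on pairwise intersections. Such an
intersection is zero or comes from a common source, where `η` forces agreement
(`IsFrobenius.exists_comm_phi`). For the `θ` with source `λ`: contraction with `ω` pairs `M(u)`
perfectly with `M(σ(u))` for an anti-endomorphism `σ` of `Λ`, and `φ` and `θ` are adjoint for this
pairing, so this case is dual to the previous one (`IsFrobenius.exists_comm_theta`). If `f₁` is
compatible with the `φ` and `f₂` with the `θ`, then `f₁ - f₂` maps the sum `I` of the images of the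
`φ` into the kernels of the `θ`, because a composite `θφ` joins two objects below `λ`, where `η` is
natural. With a projection `π` onto `I`, the map `f₂ + (f₁ - f₂)π` is compatible with both
(`IsFrobenius.exists_component`).

Both inputs come from a linear resolution of `k`. Its terms are forced to be free on bases of the
spaces `R_n` (`LinearResolution.isBase`). Exactness gives the distributive inequality for initial
segments of blocks, from which the general one follows. Since the resolution is minimal, global
dimension `d` gives `R_n = 0` for `n > d`, one-dimensionality of `Ext^d` gives `dim R_d = 1`, and
vanishing of `Ext^i` for `0 < i < d` gives nondegeneracy of `ω` (`isFrobenius`). Inside `TV` the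
generator `φ` is an inclusion and `θ` is a contraction, and the relations of `𝒰` become identities
between contractions (`IsFrobenius.compatible`). -/

namespace UAut

/-! ### Products of subspaces and their lattice, under linear disjointness -/

section LinearDisjointLattice

variable {k : Type*} [Field k] {S : Type*} [Ring S] [Algebra k S] {G H : Submodule k S}

/-- Since `G * H` is `G ⊗ H`, membership in `A * H` can be tested by contracting the second factor
with functionals: all contractions must lie in `A`. Tests for `A` and for `B` together are the test
for `A ⊓ B`. -/
lemma inf_mul_of_linearDisjoint (hd : G.LinearDisjoint H) {A B : Submodule k S} (hA : A ≤ G)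
    (hB : B ≤ G) : (A ⊓ B) * H = A * H ⊓ B * H := by
  refine le_antisymm (le_inf (mul_le_mul' inf_le_left le_rfl) (mul_le_mul' inf_le_right le_rfl)) ?_
  rintro x ⟨h1, h2⟩
  have h0 : x ∈ G * H := mul_le_mul' hA le_rfl h1
  rw [← Submodule.mulMap_range] at h0
  obtain ⟨t, rfl⟩ := h0
  have ht : t ∈ LinearMap.range (LinearMap.rTensor H ((A ⊓ B).comap G.subtype).subtype) :=
    mem_range_of_contract_right _ t fun ξ =>
      ⟨contract_mem_right hd hA t h1 ξ, contract_mem_right hd hB t h2 ξ⟩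
  obtain ⟨s, rfl⟩ := ht
  clear h1 h2
  induction s with
  | zero => simp only [map_zero, Submodule.zero_mem]
  | tmul x y => exact Submodule.mul_mem_mul x.2 y.2
  | add x y hx hy => simp only [map_add]; exact Submodule.add_mem _ hx hy

lemma mul_inf_of_linearDisjoint (hd : G.LinearDisjoint H) {A B : Submodule k S} (hA : A ≤ H)
    (hB : B ≤ H) : G * (A ⊓ B) = G * A ⊓ G * B := by
  refine le_antisymm (le_inf (mul_le_mul' le_rfl inf_le_left) (mul_le_mul' le_rfl inf_le_right)) ?_
  rintro x ⟨h1, h2⟩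
  have h0 : x ∈ G * H := mul_le_mul' le_rfl hA h1
  rw [← Submodule.mulMap_range] at h0
  obtain ⟨t, rfl⟩ := h0
  have ht : t ∈ LinearMap.range (LinearMap.lTensor G ((A ⊓ B).comap H.subtype).subtype) :=
    mem_range_of_contract_left _ t fun ξ =>
      ⟨contract_mem_left hd hA t h1 ξ, contract_mem_left hd hB t h2 ξ⟩
  obtain ⟨s, rfl⟩ := ht
  clear h1 h2
  induction s with
  | zero => simp only [map_zero, Submodule.zero_mem]
  | tmul x y => exact Submodule.mul_mem_mul x.2 y.2
  | add x y hx hy => simp only [map_add]; exact Submodule.add_mem _ hx hy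

lemma mul_eq_inf_of_linearDisjoint (hd : G.LinearDisjoint H) {A B : Submodule k S} (hA : A ≤ G)
    (hB : B ≤ H) : A * B = A * H ⊓ G * B := by
  refine le_antisymm (le_inf (mul_le_mul' le_rfl hB) (mul_le_mul' hA le_rfl)) ?_
  rintro x ⟨h1, h2⟩
  have h0 : x ∈ G * H := mul_le_mul' hA le_rfl h1
  rw [← Submodule.mulMap_range] at h0
  obtain ⟨t, rfl⟩ := h0
  have hl : t ∈ LinearMap.range (LinearMap.rTensor H (A.comap G.subtype).subtype) :=
    mem_range_of_contract_right _ t fun ξ => contract_mem_right hd hA t h1 ξ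
  have hr : t ∈ LinearMap.range (LinearMap.lTensor G (B.comap H.subtype).subtype) :=
    mem_range_of_contract_left _ t fun ξ => contract_mem_left hd hB t h2 ξ
  obtain ⟨s, rfl⟩ := tensor_inf _ _ t hl hr
  clear h1 h2 hl hr
  induction s with
  | zero => simp only [map_zero, Submodule.zero_mem]
  | tmul x y => exact Submodule.mul_mem_mul x.2 y.2
  | add x y hx hy => simp only [map_add]; exact Submodule.add_mem _ hx hy

lemma exists_projection {A C : Submodule k S} (h : Disjoint A C) :
    ∃ P : S →ₗ[k] S, (∀ a ∈ A, P a = 0) ∧ ∀ c ∈ C, P c = c := by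
  obtain ⟨C', hc, hC⟩ := h.exists_isCompl
  refine ⟨Submodule.projection C C' hC.symm, fun a ha => ?_, fun c h => ?_⟩
  · exact (Submodule.projection_apply_eq_zero_iff hC.symm).2 (hc ha)
  · exact Submodule.projection_apply_left hC.symm ⟨c, h⟩

/-- Take a projection `P` that kills `A` and fixes `C`, and a projection `Q` that kills `B` and
fixes `D`. Then `P ⊗ Q` kills `A * H` and `G * B`, but is injective on `C ⊗ D`. -/
lemma disjoint_mul_of_disjoint (hd : G.LinearDisjoint H) {A C B D : Submodule k S}
    (hA : A ≤ G) (hC : C ≤ G) (hB : B ≤ H) (hD : D ≤ H) (hAC : Disjoint A C) (hBD : Disjoint B D) :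
    Disjoint (A * H ⊔ G * B) (C * D) := by
  obtain ⟨P, hPA, hPC⟩ := exists_projection hAC
  obtain ⟨Q, hQB, hQD⟩ := exists_projection hBD
  set Φ := TensorProduct.map (P ∘ₗ G.subtype) (Q ∘ₗ H.subtype)
  rw [Submodule.disjoint_def]
  intro x h1 h2
  obtain ⟨y, hy, z, hz, rfl⟩ := Submodule.mem_sup.1 h1
  have key1 : ∃ t, Submodule.mulMap G H t = y ∧ Φ t = 0 := by
    rw [← Submodule.mulMap_range] at hy
    obtain ⟨s, rfl⟩ := hy
    refine ⟨LinearMap.rTensor H (Submodule.inclusion hA) s, ?_, ?_⟩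
    · rw [← Submodule.mulMap_comp_rTensor H hA]; rfl
    · rw [← LinearMap.comp_apply, LinearMap.map_comp_rTensor]
      rw [show (P ∘ₗ G.subtype) ∘ₗ Submodule.inclusion hA = 0 from
        LinearMap.ext fun a => hPA _ a.2]
      simp
  have key2 : ∃ t, Submodule.mulMap G H t = z ∧ Φ t = 0 := by
    rw [← Submodule.mulMap_range] at hz
    obtain ⟨s, rfl⟩ := hz
    refine ⟨LinearMap.lTensor G (Submodule.inclusion hB) s, ?_, ?_⟩
    · rw [← Submodule.mulMap_comp_lTensor G hB]; rfl
    · rw [← LinearMap.comp_apply, LinearMap.map_comp_lTensor]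
      rw [show (Q ∘ₗ H.subtype) ∘ₗ Submodule.inclusion hB = 0 from
        LinearMap.ext fun a => hQB _ a.2]
      simp
  obtain ⟨t1, rfl, h3⟩ := key1
  obtain ⟨t2, rfl, h4⟩ := key2
  rw [← Submodule.mulMap_range] at h2
  obtain ⟨s, hs⟩ := h2
  have hs' : TensorProduct.map (Submodule.inclusion hC) (Submodule.inclusion hD) s = t1 + t2 := by
    apply hd.injective
    rw [map_add, ← hs]
    clear hs
    induction s with
    | zero => simp
    | tmul x y => simp
    | add x y hx hy => simp only [map_add, hx, hy]
  have h5 : TensorProduct.map C.subtype D.subtype s = 0 := by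
    have : Φ (TensorProduct.map (Submodule.inclusion hC) (Submodule.inclusion hD) s) = 0 := by
      rw [hs', map_add, h3, h4, add_zero]
    rw [← this, ← LinearMap.comp_apply, ← TensorProduct.map_comp]
    congr 2
    · exact LinearMap.ext fun c => (hPC _ c.2).symm
    · exact LinearMap.ext fun c => (hQD _ c.2).symm
  have h6 : s = 0 := by
    have hi := TensorProduct.map_injective_of_flat_flat' C.subtype D.subtype C.subtype_injective
      D.subtype_injective
    exact hi (by rw [h5, map_zero])
  rw [← map_add, ← hs', h6, map_zero, map_zero]

/-- Choose complements `Cᵢ` of `Aᵢ ⊓ Bᵢ` in `Bᵢ`. Then `B₁ * B₂` is the right-hand side plus `C₁ *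
C₂`; the right-hand side lies in `A₁ * H ⊔ G * A₂`, while `C₁ * C₂` is disjoint from it, so the `C₁
* C₂` component vanishes. This carries distributivity from tensor factors to their tensor product.
-/
lemma sup_inf_mul_le_of_linearDisjoint (hd : G.LinearDisjoint H) {A₁ B₁ A₂ B₂ : Submodule k S}
    (hA₁ : A₁ ≤ G) (hB₁ : B₁ ≤ G) (hA₂ : A₂ ≤ H) (hB₂ : B₂ ≤ H) :
    (A₁ * H ⊔ G * A₂) ⊓ B₁ * B₂ ≤ (A₁ ⊓ B₁) * B₂ ⊔ B₁ * (A₂ ⊓ B₂) := by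
  obtain ⟨C₁', hc₁⟩ := exists_isCompl ((A₁ ⊓ B₁).comap B₁.subtype)
  obtain ⟨C₂', hc₂⟩ := exists_isCompl ((A₂ ⊓ B₂).comap B₂.subtype)
  have aux : ∀ {A B : Submodule k S} {C' : Submodule k B}, IsCompl ((A ⊓ B).comap B.subtype) C' →
      (A ⊓ B) ⊔ C'.map B.subtype = B ∧ Disjoint A (C'.map B.subtype) := by
    intro A B C' hc
    constructor
    · have := congrArg (Submodule.map B.subtype) hc.sup_eq_top
      rw [Submodule.map_sup, Submodule.map_comap_eq, Submodule.map_subtype_top,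
        Submodule.range_subtype] at this
      rwa [inf_eq_right.2 inf_le_right] at this
    · rw [Submodule.disjoint_def]
      rintro _ hx ⟨c, hc', rfl⟩
      have := (Submodule.disjoint_def.1 hc.disjoint) c ⟨hx, c.2⟩ hc'
      rw [this, map_zero]
  obtain ⟨h1, h1'⟩ := aux hc₁
  obtain ⟨h2, h2'⟩ := aux hc₂
  set C₁ := C₁'.map B₁.subtype
  set C₂ := C₂'.map B₂.subtype
  have hC₁ : C₁ ≤ B₁ := Submodule.map_subtype_le _ _
  have hC₂ : C₂ ≤ B₂ := Submodule.map_subtype_le _ _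
  have hdis := disjoint_mul_of_disjoint hd hA₁ (hC₁.trans hB₁) hA₂ (hC₂.trans hB₂) h1' h2'
  rintro x ⟨hx1, hx2⟩
  have hx3 : x ∈ ((A₁ ⊓ B₁) * B₂ ⊔ B₁ * (A₂ ⊓ B₂)) ⊔ C₁ * C₂ := by
    have : B₁ * B₂ ≤ ((A₁ ⊓ B₁) * B₂ ⊔ B₁ * (A₂ ⊓ B₂)) ⊔ C₁ * C₂ := by
      calc B₁ * B₂ = (A₁ ⊓ B₁) * B₂ ⊔ C₁ * B₂ := by rw [← Submodule.sup_mul, h1]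
        _ = (A₁ ⊓ B₁) * B₂ ⊔ (C₁ * (A₂ ⊓ B₂) ⊔ C₁ * C₂) := by rw [← Submodule.mul_sup, h2]
        _ ≤ _ := by
          rw [← sup_assoc]
          exact sup_le_sup_right (sup_le_sup_left (mul_le_mul' hC₁ le_rfl) _) _
    exact this hx2
  obtain ⟨y, hy, z, hz, rfl⟩ := Submodule.mem_sup.1 hx3
  have hle : (A₁ ⊓ B₁) * B₂ ⊔ B₁ * (A₂ ⊓ B₂) ≤ A₁ * H ⊔ G * A₂ :=
    sup_le_sup (mul_le_mul' inf_le_left hB₂) (mul_le_mul' hB₁ inf_le_left)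
  have hz' : z ∈ A₁ * H ⊔ G * A₂ := by
    have := Submodule.sub_mem _ hx1 (hle hy)
    rwa [add_sub_cancel_left] at this
  rw [(Submodule.disjoint_def.1 hdis) z hz' hz, add_zero]
  exact hy

end LinearDisjointLattice

/-! ### Distributivity of a finite family of subspaces -/

section Distributive

variable {k : Type*} [Field k] {P : Type*} [AddCommGroup P] [Module k P]

/-- The distributivity of `∑_{i ∈ S} X i` over the intersection of `W` and the `X j`, `j ∈ T`. -/
def DistFor (W : Submodule k P) (X : ℕ → Submodule k P) (S T : Finset ℕ) : Prop :=
  S.sup X ⊓ (W ⊓ T.inf X) ≤ S.sup fun i => X i ⊓ (W ⊓ T.inf X)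

lemma sup_inf_le_inf {X : ℕ → Submodule k P} {S : Finset ℕ} {B : Submodule k P} :
    (S.sup fun i => X i ⊓ B) ≤ S.sup X ⊓ B :=
  le_inf (Finset.sup_mono_fun fun _ _ => inf_le_left) (Finset.sup_le fun _ _ => inf_le_right)

/-- This is the exchange that trades `j` in the sum and `c` in the intersection for the opposite
arrangement. Split `x = z + y` along `X j` and the sum over `S`. Then `z = x - y` lies in `X c` plus
that sum, so it splits as `z2 + z1` inside `X j`, and the rest `z1 + y = x - z2` lies in `X c`,
where the third hypothesis applies. -/
lemma DistFor.swap {W : Submodule k P} {X : ℕ → Submodule k P} {S T : Finset ℕ} {j c : ℕ}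
    (h1 : DistFor W X (insert j S) T) (h2 : DistFor W X (insert c S) (insert j T))
    (h3 : DistFor W X S (insert c T)) : DistFor W X (insert j S) (insert c T) := by
  simp only [DistFor, Finset.sup_insert, Finset.inf_insert] at *
  rintro x ⟨hx, hxB⟩
  have hxW : x ∈ W := hxB.1
  have hxc : x ∈ X c := hxB.2.1
  have hxT : x ∈ T.inf X := hxB.2.2
  obtain ⟨z, hz, y, hy, rfl⟩ := Submodule.mem_sup.1 (h1 ⟨hx, hxW, hxT⟩)
  have hy' := sup_inf_le_inf hy
  have hz2 : z ∈ (X c ⊓ (W ⊓ (X j ⊓ T.inf X))) ⊔ S.sup fun i => X i ⊓ (W ⊓ (X j ⊓ T.inf X)) := by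
    refine h2 ⟨?_, hz.2.1, hz.1, hz.2.2⟩
    have : z = (z + y) - y := by abel
    rw [this]
    exact Submodule.sub_mem _ (Submodule.mem_sup_left hxc) (Submodule.mem_sup_right hy'.1)
  obtain ⟨z2, hz3, z1, hz1, rfl⟩ := Submodule.mem_sup.1 hz2
  have hz1' := sup_inf_le_inf hz1
  have hw : z1 + y ∈ S.sup fun i => X i ⊓ (W ⊓ (X c ⊓ T.inf X)) := by
    refine h3 ⟨Submodule.add_mem _ hz1'.1 hy'.1, Submodule.add_mem _ hz1'.2.1 hy'.2.1, ?_,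
      Submodule.add_mem _ hz1'.2.2.2 hy'.2.2⟩
    have : z1 + y = (z2 + z1 + y) - z2 := by abel
    rw [this]
    exact Submodule.sub_mem _ hxc hz3.1
  rw [add_assoc]
  exact Submodule.add_mem _ (Submodule.mem_sup_left ⟨hz3.2.2.1, hz3.2.1, hz3.1, hz3.2.2.2⟩)
    (Submodule.mem_sup_right hw)

/-- Each inversion `c < j` with `j ∈ S`, `c ∈ T` is removed by `DistFor.swap`. Of its three inputs,
two omit an index and are covered by `hprop`; the third moves `c` to `S` and `j` to `T`, which
lowers `∑ i ∈ S, i`. -/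
lemma distFor_of_initial {W : Submodule k P} {X : ℕ → Submodule k P} {n : ℕ}
    (hprop : ∀ S T : Finset ℕ, Disjoint S T → S ∪ T ⊂ Finset.range n → DistFor W X S T)
    (hinit : ∀ p ≤ n, DistFor W X (Finset.range p) (Finset.Ico p n)) (S T : Finset ℕ)
    (hd : Disjoint S T) (hST : S ∪ T = Finset.range n) : DistFor W X S T := by
  induction hs : ∑ i ∈ S, i using Nat.strong_induction_on generalizing S T with
  | _ s ih =>
  by_cases hex : ∃ j ∈ S, ∃ c ∈ T, c < j
  · obtain ⟨j, hj, c, hc, hcj⟩ := hex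
    have hjT : j ∉ T := Finset.disjoint_left.1 hd hj
    have hcS : c ∉ S := Finset.disjoint_right.1 hd hc
    obtain ⟨S', hjS', rfl⟩ : ∃ S', j ∉ S' ∧ insert j S' = S :=
      ⟨S.erase j, Finset.notMem_erase _ _, Finset.insert_erase hj⟩
    obtain ⟨T', hcT', rfl⟩ : ∃ T', c ∉ T' ∧ insert c T' = T :=
      ⟨T.erase c, Finset.notMem_erase _ _, Finset.insert_erase hc⟩
    simp only [Finset.mem_insert, not_or] at hjT hcS
    have hd' : Disjoint S' T' :=
      hd.mono (Finset.subset_insert _ _) (Finset.subset_insert _ _)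
    have hjn : j ∈ Finset.range n := hST ▸ by simp
    have hcn : c ∈ Finset.range n := hST ▸ by simp
    have hsub : S' ∪ T' ⊆ Finset.range n := by
      rw [← hST]
      exact Finset.union_subset_union (Finset.subset_insert _ _) (Finset.subset_insert _ _)
    refine DistFor.swap ?_ ?_ ?_
    · refine hprop _ _ (hd.mono_right (Finset.subset_insert _ _)) ?_
      refine (Finset.ssubset_iff_of_subset ?_).2 ⟨c, hcn, ?_⟩
      · rw [Finset.insert_union]; exact Finset.insert_subset hjn hsub
      · simp [hcS, hcT']
    · refine ih _ ?_ _ _ ?_ ?_ rfl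
      · rw [← hs, Finset.sum_insert hcS.2, Finset.sum_insert hjS']; omega
      · simp only [Finset.disjoint_insert_left, Finset.disjoint_insert_right, Finset.mem_insert,
          not_or]
        exact ⟨⟨Ne.symm hcS.1, hjS'⟩, hcT', hd'⟩
      · rw [← hST]; ext; simp only [Finset.mem_union, Finset.mem_insert]; tauto
    · refine hprop _ _ (hd.mono_left (Finset.subset_insert _ _)) ?_
      refine (Finset.ssubset_iff_of_subset ?_).2 ⟨j, hjn, ?_⟩
      · rw [Finset.union_insert]; exact Finset.insert_subset hcn hsub
      · simp [hjS', hjT]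
  -- Without inversions `S` is an initial segment and `T` is the rest.
  · push Not at hex
    obtain ⟨p, hp, hpS, hpT⟩ : ∃ p ≤ n, S = Finset.range p ∧ T = Finset.Ico p n := by
      have hmem : ∀ x, x ∈ S ∨ x ∈ T ↔ x < n := fun x => by
        rw [← Finset.mem_union, hST, Finset.mem_range]
      have hST' : ∀ x, x ∈ S → x ∉ T := fun x h => Finset.disjoint_left.1 hd h
      have hdown : ∀ x ∈ S, ∀ y < x, y ∈ S := by
        intro x hx y hy
        rcases (hmem y).2 (hy.trans ((hmem x).1 (Or.inl hx))) with h | h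
        · exact h
        · exact absurd (hex x hx y h) (by omega)
      have hcard : S = Finset.range S.card := by
        obtain ⟨m, hm⟩ : ∃ m, ∀ x, x ∈ S ↔ x < m := by
          by_cases hne : S.Nonempty
          · refine ⟨S.max' hne + 1, fun x => ⟨fun hx => Nat.lt_succ_of_le (S.le_max' x hx), ?_⟩⟩
            intro hx
            rcases Nat.lt_succ_iff_lt_or_eq.1 hx with h | h
            · exact hdown _ (S.max'_mem hne) x h
            · exact h ▸ S.max'_mem hne
          · refine ⟨0, fun x => ?_⟩
            rw [Finset.not_nonempty_iff_eq_empty] at hne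
            simp [hne]
        have : S = Finset.range m := by ext x; simp [hm]
        rw [this, Finset.card_range]
      refine ⟨S.card, ?_, hcard, ?_⟩
      · by_contra hlt
        have : n ∈ S := by rw [hcard]; simpa using hlt
        exact absurd ((hmem n).1 (Or.inl this)) (lt_irrefl _)
      · ext x
        rw [Finset.mem_Ico]
        have h1 : x ∈ S ↔ x < S.card := by rw [hcard]; simp
        have h2 := hmem x
        have h3 := hST' x
        constructor
        · intro hx
          exact ⟨by by_contra h; exact h3 (h1.2 (by omega)) hx, h2.1 (Or.inr hx)⟩
        · rintro ⟨hx, hx'⟩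
          exact (h2.2 hx').resolve_left fun h => by have := h1.1 h; omega
    rw [hpS, hpT]
    exact hinit p hp

end Distributive

/-! ### The subspaces `V^i R V^j` of `V^N` -/

namespace QuadraticData

variable {k : Type u} [Field k] {V : Type u} [AddCommGroup V] [Module k V] (D : QuadraticData k V)

/-- The space `V^c R V^{N-2-c}`. -/
def block (N c : ℕ) : Submodule k (TensorAlgebra k V) :=
  gens k V ^ c * D.rel * gens k V ^ (N - 2 - c)

lemma block_le {N c : ℕ} (h : c + 2 ≤ N) : D.block N c ≤ gens k V ^ N :=
  D.block_le' (by omega)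

lemma block_mul {m c : ℕ} (h : c + 2 ≤ m) (n : ℕ) :
    D.block m c * gens k V ^ n = D.block (m + n) c := by
  rw [block, block, mul_assoc, ← pow_add]
  congr 2; omega

lemma mul_block (m n c : ℕ) :
    gens k V ^ m * D.block n c = D.block (m + n) (m + c) := by
  rw [block, block, ← mul_assoc, ← mul_assoc, ← pow_add]
  congr 2; omega

lemma R_eq_inf {n : ℕ} (hn : 0 < n) :
    D.R n = gens k V ^ n ⊓ (Finset.range (n - 1)).inf (D.block n) := by
  rw [R_eq_biInf D hn]
  congr 1
  apply le_antisymm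
  · refine Finset.le_inf fun c hc => ?_
    rw [Finset.mem_range] at hc
    exact (iInf_le _ c).trans ((iInf_le _ (n - 2 - c)).trans (iInf_le _ (by omega)))
  · refine le_iInf fun i => le_iInf fun j => le_iInf fun h => ?_
    refine (Finset.inf_le (b := i) (by rw [Finset.mem_range]; omega)).trans (le_of_eq ?_)
    rw [block, show n - 2 - i = j by omega]

lemma inf_block_mul {m : ℕ} (n : ℕ) (T : Finset ℕ) (hT : ∀ i ∈ T, i + 2 ≤ m) :
    (gens k V ^ m ⊓ T.inf (D.block m)) * gens k V ^ n =
      gens k V ^ (m + n) ⊓ T.inf (D.block (m + n)) := by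
  classical
  induction T using Finset.induction_on with
  | empty => simp [pow_add]
  | insert i T hi ih =>
    have hi' := hT i (by simp)
    rw [Finset.inf_insert, Finset.inf_insert, inf_left_comm,
      inf_mul_of_linearDisjoint (linearDisjoint_pow m n) (D.block_le hi') inf_le_left,
      ih fun j hj => hT j (Finset.mem_insert_of_mem hj), D.block_mul hi', inf_left_comm]

lemma mul_inf_block (m : ℕ) {n : ℕ} (T : Finset ℕ) (hT : ∀ i ∈ T, i + 2 ≤ n) :
    gens k V ^ m * (gens k V ^ n ⊓ T.inf (D.block n)) =
      gens k V ^ (m + n) ⊓ (T.image (m + ·)).inf (D.block (m + n)) := by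
  classical
  induction T using Finset.induction_on with
  | empty => simp [pow_add]
  | insert i T hi ih =>
    have hi' := hT i (by simp)
    rw [Finset.image_insert, Finset.inf_insert, Finset.inf_insert, inf_left_comm,
      mul_inf_of_linearDisjoint (linearDisjoint_pow m n) (D.block_le hi') inf_le_left,
      ih fun j hj => hT j (Finset.mem_insert_of_mem hj), D.mul_block, inf_left_comm]

lemma sup_block_mul {m : ℕ} (n : ℕ) (T : Finset ℕ) (hT : ∀ i ∈ T, i + 2 ≤ m) :
    T.sup (D.block m) * gens k V ^ n = T.sup (D.block (m + n)) := by
  classical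
  induction T using Finset.induction_on with
  | empty => simp
  | insert i T hi ih =>
    rw [Finset.sup_insert, Finset.sup_insert, Submodule.sup_mul, D.block_mul (hT i (by simp)),
      ih fun j hj => hT j (Finset.mem_insert_of_mem hj)]

lemma mul_sup_block (m n : ℕ) (T : Finset ℕ) :
    gens k V ^ m * T.sup (D.block n) = (T.image (m + ·)).sup (D.block (m + n)) := by
  classical
  induction T using Finset.induction_on with
  | empty => simp
  | insert i T hi ih =>
    rw [Finset.image_insert, Finset.sup_insert, Finset.sup_insert, Submodule.mul_sup, D.mul_block,
      ih]

lemma inf_block_mul_inf_block {m n : ℕ} (T₁ T₂ : Finset ℕ) (h₁ : ∀ i ∈ T₁, i + 2 ≤ m)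
    (h₂ : ∀ i ∈ T₂, i + 2 ≤ n) :
    (gens k V ^ m ⊓ T₁.inf (D.block m)) * (gens k V ^ n ⊓ T₂.inf (D.block n)) =
      gens k V ^ (m + n) ⊓ (T₁ ∪ T₂.image (m + ·)).inf (D.block (m + n)) := by
  classical
  rw [mul_eq_inf_of_linearDisjoint (linearDisjoint_pow m n) inf_le_left inf_le_left,
    D.inf_block_mul n T₁ h₁, D.mul_inf_block m T₂ h₂, Finset.inf_union]
  exact (inf_inf_distrib_left _ _ _).symm

/-- The distributivity of the subspaces `V^i R V^j` of `V^N`. -/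
def Distributive (N : ℕ) : Prop :=
  ∀ S T : Finset ℕ, (∀ i ∈ S, i + 2 ≤ N) → (∀ i ∈ T, i + 2 ≤ N) → Disjoint S T →
    DistFor (gens k V ^ N) (D.block N) S T

/-- When the blocks split between two tensor factors, the intersection is a product `B₁ * B₂` and
the sum has the form `Σ₁ * V^n ⊔ V^m * Σ₂`; `sup_inf_mul_le_of_linearDisjoint` then reduces the
claim to each factor. -/
lemma distFor_add {m n : ℕ} (hm : D.Distributive m) (hn : D.Distributive n)
    {S₁ T₁ S₂ T₂ : Finset ℕ} (hS₁ : ∀ i ∈ S₁, i + 2 ≤ m) (hT₁ : ∀ i ∈ T₁, i + 2 ≤ m)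
    (hS₂ : ∀ i ∈ S₂, i + 2 ≤ n) (hT₂ : ∀ i ∈ T₂, i + 2 ≤ n) (h₁ : Disjoint S₁ T₁)
    (h₂ : Disjoint S₂ T₂) :
    DistFor (gens k V ^ (m + n)) (D.block (m + n)) (S₁ ∪ S₂.image (m + ·))
      (T₁ ∪ T₂.image (m + ·)) := by
  classical
  unfold DistFor
  rw [← D.inf_block_mul_inf_block T₁ T₂ hT₁ hT₂, Finset.sup_union, ← D.sup_block_mul n S₁ hS₁,
    ← D.mul_sup_block]
  set B₁ := gens k V ^ m ⊓ T₁.inf (D.block m)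
  set B₂ := gens k V ^ n ⊓ T₂.inf (D.block n)
  refine (sup_inf_mul_le_of_linearDisjoint (linearDisjoint_pow m n)
    (Finset.sup_le fun i hi => D.block_le (hS₁ i hi)) inf_le_left
    (Finset.sup_le fun i hi => D.block_le (hS₂ i hi)) inf_le_left).trans ?_
  have e₁ : S₁.sup (D.block m) ⊓ B₁ ≤ S₁.sup fun i => D.block m i ⊓ B₁ := hm S₁ T₁ hS₁ hT₁ h₁
  have e₂ : S₂.sup (D.block n) ⊓ B₂ ≤ S₂.sup fun i => D.block n i ⊓ B₂ := hn S₂ T₂ hS₂ hT₂ h₂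
  refine sup_le ((mul_le_mul' e₁ le_rfl).trans ?_) ((mul_le_mul' le_rfl e₂).trans ?_)
  · have : ∀ (S : Finset ℕ), S ⊆ S₁ → (S.sup fun i => D.block m i ⊓ B₁) * B₂ ≤
        (S₁ ∪ S₂.image (m + ·)).sup fun i => D.block (m + n) i ⊓ B₁ * B₂ := by
      intro S
      induction S using Finset.induction_on with
      | empty => simp
      | insert i S hi ih =>
        intro hS
        rw [Finset.sup_insert, Submodule.sup_mul]
        refine sup_le ?_ (ih ((Finset.subset_insert _ _).trans hS))
        have hi' : i ∈ S₁ := hS (Finset.mem_insert_self _ _)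
        refine le_trans ?_ (Finset.le_sup (b := i) (Finset.mem_union_left _ hi'))
        refine le_inf ?_ (mul_le_mul' inf_le_right le_rfl)
        rw [← D.block_mul (hS₁ i hi')]
        exact mul_le_mul' inf_le_left inf_le_left
    exact this S₁ le_rfl
  · have : ∀ (S : Finset ℕ), S ⊆ S₂ → B₁ * (S.sup fun i => D.block n i ⊓ B₂) ≤
        (S₁ ∪ S₂.image (m + ·)).sup fun i => D.block (m + n) i ⊓ B₁ * B₂ := by
      intro S
      induction S using Finset.induction_on with
      | empty => simp
      | insert i S hi ih =>
        intro hS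
        rw [Finset.sup_insert, Submodule.mul_sup]
        refine sup_le ?_ (ih ((Finset.subset_insert _ _).trans hS))
        have hi' : i ∈ S₂ := hS (Finset.mem_insert_self _ _)
        refine le_trans ?_ (Finset.le_sup (b := m + i)
          (Finset.mem_union_right _ (Finset.mem_image_of_mem _ hi')))
        refine le_inf ?_ (mul_le_mul' le_rfl inf_le_right)
        rw [← D.mul_block]
        exact mul_le_mul' inf_le_left inf_le_left
    exact this S₂ le_rfl

/-- A proper subfamily misses some block, and there the tensor power can be cut in two, so induction
on `N` settles it. The full family is reduced to initial segments by `distFor_of_initial`. -/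
lemma distributive_of_initial
    (h : ∀ N p, p ≤ N - 1 → DistFor (gens k V ^ N) (D.block N) (Finset.range p)
      (Finset.Ico p (N - 1))) (N : ℕ) : D.Distributive N := by
  classical
  induction N using Nat.strong_induction_on with
  | _ N ih =>
  have hprop : ∀ S T : Finset ℕ, Disjoint S T → S ∪ T ⊂ Finset.range (N - 1) →
      DistFor (gens k V ^ N) (D.block N) S T := by
    intro S T hd hST
    have hsub := hST.1
    obtain ⟨c, hc, hcST⟩ := Finset.exists_of_ssubset hST
    rw [Finset.mem_range] at hc
    -- Counted from `0`, the block at `c` uses the tensor factors `c` and `c + 1`, so it is the only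
    -- one that straddles a cut after `c + 1` factors.
    obtain ⟨n, rfl⟩ : ∃ n, N = (c + 1) + n := ⟨N - (c + 1), by omega⟩
    have hsplit : ∀ Z ⊆ S ∪ T, ∃ Z₁ Z₂ : Finset ℕ, Z = Z₁ ∪ Z₂.image ((c + 1) + ·) ∧
        (∀ i ∈ Z₁, i + 2 ≤ c + 1) ∧ (∀ i ∈ Z₂, i + 2 ≤ n) := by
      intro Z hZ
      refine ⟨Z.filter (· < c), (Finset.range (n - 1)).filter (fun i => c + 1 + i ∈ Z), ?_, ?_, ?_⟩
      · ext x
        simp only [Finset.mem_union, Finset.mem_filter, Finset.mem_image, Finset.mem_range]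
        constructor
        · intro hx
          have hxc : x ≠ c := fun e => hcST (e ▸ hZ hx)
          have := Finset.mem_range.1 (hsub (hZ hx))
          by_cases hlt : x < c
          · exact Or.inl ⟨hx, hlt⟩
          · refine Or.inr ⟨x - (c + 1), ⟨by omega, ?_⟩, by omega⟩
            rwa [show c + 1 + (x - (c + 1)) = x by omega]
        · rintro (h | ⟨y, ⟨_, h⟩, rfl⟩)
          · exact h.1
          · exact h
      · intro i hi; have := (Finset.mem_filter.1 hi).2; omega
      · intro i hi; have := Finset.mem_range.1 (Finset.mem_filter.1 hi).1; omega
    obtain ⟨S₁, S₂, rfl, hS₁, hS₂⟩ := hsplit S Finset.subset_union_left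
    obtain ⟨T₁, T₂, rfl, hT₁, hT₂⟩ := hsplit T Finset.subset_union_right
    refine D.distFor_add (ih _ (by omega)) (ih _ (by omega)) hS₁ hT₁ hS₂ hT₂
      (hd.mono Finset.subset_union_left Finset.subset_union_left) ?_
    have := hd.mono (Finset.subset_union_right (s₁ := S₁)) (Finset.subset_union_right (s₁ := T₁))
    rw [Finset.disjoint_left] at this ⊢
    exact fun x hx hx' => this (Finset.mem_image_of_mem _ hx) (Finset.mem_image_of_mem _ hx')
  intro S T hS hT hd
  have hsub : S ∪ T ⊆ Finset.range (N - 1) := by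
    intro x hx
    rw [Finset.mem_range]
    rcases Finset.mem_union.1 hx with h | h
    · have := hS x h; omega
    · have := hT x h; omega
  rcases eq_or_ssubset_of_subset hsub with h' | h'
  · exact distFor_of_initial hprop (h N) S T hd h'
  · exact hprop S T hd h'

end QuadraticData

end UAut

/-! ### The algebra `A` and its relations, degree by degree -/

namespace UAut
namespace QuadraticData

variable {k : Type u} [Field k] {V : Type u} [AddCommGroup V] [Module k V] (D : QuadraticData k V)

/-- The quotient map `TV → A`. -/
noncomputable def proj : TensorAlgebra k V →ₐ[k] D.A := RingQuot.mkAlgHom k D.Vanish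

lemma proj_surjective : Function.Surjective D.proj := RingQuot.mkAlgHom_surjective _ _

lemma proj_ι (v : V) : D.proj (TensorAlgebra.ι k v) = D.gen v := rfl

lemma proj_rel {x : TensorAlgebra k V} (hx : x ∈ D.rel) : D.proj x = 0 := by
  rw [proj, RingQuot.mkAlgHom_rel k (Vanish.of hx), map_zero]

lemma rel_eq_zero_of_lift {B : Type*} [Ring B] [Algebra k B] {x : TensorAlgebra k V}
    (hx : x ∈ D.rel) : TensorAlgebra.lift k (0 : V →ₗ[k] B) x = 0 := by
  have h1 : gens k V ≤ LinearMap.ker (TensorAlgebra.lift k (0 : V →ₗ[k] B)).toLinearMap := by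
    rintro _ ⟨v, rfl⟩
    simp
  have h2 : gens k V * gens k V ≤
      LinearMap.ker (TensorAlgebra.lift k (0 : V →ₗ[k] B)).toLinearMap := by
    rw [Submodule.mul_le]
    intro m hm n _
    have := h1 hm
    rw [LinearMap.mem_ker, AlgHom.toLinearMap_apply] at this ⊢
    rw [map_mul, this, zero_mul]
  rw [← pow_two] at h2
  exact h2 (D.rel_le hx)

/-- The augmentation `A → k`. -/
noncomputable def aug : D.A →ₐ[k] k :=
  RingQuot.liftAlgHom k ⟨TensorAlgebra.lift k (0 : V →ₗ[k] k), by
    rintro _ _ ⟨hx⟩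
    exact (D.rel_eq_zero_of_lift hx).trans
      (map_zero (TensorAlgebra.lift k (0 : V →ₗ[k] k))).symm⟩

lemma aug_gen (v : V) : D.aug (D.gen v) = 0 := by
  rw [gen, aug]
  simp

lemma aug_mul_gen (a b : D.A) (h : a ∈ LinearMap.range D.gen) : D.aug (b * a) = 0 := by
  obtain ⟨v, rfl⟩ := h
  rw [map_mul, aug_gen, mul_zero]

lemma aug_of_mem_augIdeal {a : D.A} (h : a ∈ D.augIdeal) : D.aug a = 0 := by
  refine Submodule.span_induction (p := fun a _ => D.aug a = 0) ?_ (map_zero _) ?_ ?_ h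
  · rintro _ ⟨v, rfl⟩
    exact D.aug_gen v
  · intro x y _ _ hx hy
    rw [map_add, hx, hy, add_zero]
  · intro a x _ hx
    rw [smul_eq_mul, map_mul, hx, mul_zero]

/-- The two-sided ideal generated by `R`, as a left ideal. -/
noncomputable def relIdeal : Ideal (TensorAlgebra k V) where
  carrier := (⊤ * D.rel * ⊤ : Submodule k (TensorAlgebra k V))
  add_mem' := Submodule.add_mem _
  zero_mem' := Submodule.zero_mem _
  smul_mem' c x hx := by
    have h : c * x ∈ (⊤ : Submodule k (TensorAlgebra k V)) * (⊤ * D.rel * ⊤) :=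
      Submodule.mul_mem_mul Submodule.mem_top hx
    rw [← mul_assoc, ← mul_assoc] at h
    exact (mul_le_mul' (mul_le_mul' le_top le_rfl) le_rfl :
      ⊤ * ⊤ * D.rel * ⊤ ≤ (⊤ * D.rel * ⊤ : Submodule k (TensorAlgebra k V))) h

lemma mem_relIdeal {x : TensorAlgebra k V} :
    x ∈ D.relIdeal ↔ x ∈ (⊤ * D.rel * ⊤ : Submodule k (TensorAlgebra k V)) := Iff.rfl

instance : D.relIdeal.IsTwoSided where
  mul_mem_of_left {x} c hx := by
    rw [mem_relIdeal] at hx ⊢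
    have h := Submodule.mul_mem_mul hx (Submodule.mem_top : c ∈ (⊤ : Submodule k (TensorAlgebra k V)))
    rw [mul_assoc] at h
    exact (mul_le_mul' le_rfl le_top :
      ⊤ * D.rel * (⊤ * ⊤) ≤ (⊤ * D.rel * ⊤ : Submodule k (TensorAlgebra k V))) h

lemma mem_of_proj_eq_zero {x : TensorAlgebra k V} (hx : D.proj x = 0) :
    x ∈ (⊤ * D.rel * ⊤ : Submodule k (TensorAlgebra k V)) := by
  let f : RingQuot D.Vanish →+* TensorAlgebra k V ⧸ D.relIdeal :=
    RingQuot.lift ⟨Ideal.Quotient.mk D.relIdeal, by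
      rintro y _ ⟨hy⟩
      rw [map_zero, Ideal.Quotient.eq_zero_iff_mem, mem_relIdeal]
      have := Submodule.mul_mem_mul (Submodule.mul_mem_mul
        (Submodule.mem_top : (1 : TensorAlgebra k V) ∈ (⊤ : Submodule k (TensorAlgebra k V))) hy)
        (Submodule.mem_top : (1 : TensorAlgebra k V) ∈ (⊤ : Submodule k (TensorAlgebra k V)))
      rwa [one_mul, mul_one] at this⟩
  have h1 : f (RingQuot.mkRingHom D.Vanish x) = Ideal.Quotient.mk D.relIdeal x :=
    RingQuot.lift_mkRingHom_apply _ _ _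
  rw [← RingQuot.mkAlgHom_coe k] at h1
  rw [← mem_relIdeal, ← Ideal.Quotient.eq_zero_iff_mem, ← h1]
  have : (RingQuot.mkAlgHom k D.Vanish : TensorAlgebra k V →+* D.A) x = 0 := hx
  rw [this, map_zero]

/-- The relations of degree `m`. -/
def rels (m : ℕ) : Submodule k (TensorAlgebra k V) := (Finset.range (m - 1)).sup (D.block m)

lemma rels_le (m : ℕ) : D.rels m ≤ gens k V ^ m := Finset.sup_le fun c hc => D.block_le (by
  rw [Finset.mem_range] at hc; omega)

lemma rels_one : D.rels 1 = ⊥ := by simp [rels]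

lemma rels_two : D.rels 2 = D.rel := by simp [rels, block]

lemma R_two : D.R 2 = D.rel := by simp [R]

lemma proj_rels {m : ℕ} {x : TensorAlgebra k V} (hx : x ∈ D.rels m) : D.proj x = 0 := by
  have : D.rels m ≤ LinearMap.ker D.proj.toLinearMap := by
    refine Finset.sup_le fun c _ => ?_
    rw [block, Submodule.mul_le]
    intro y hy z _
    have : D.proj y = 0 := by
      induction hy using Submodule.mul_induction_on' with
      | mem_mul_mem a _ b hb => rw [map_mul, D.proj_rel hb, mul_zero]
      | add x hx y hy h h' => rw [map_add, h, h', add_zero]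
    rw [LinearMap.mem_ker, AlgHom.toLinearMap_apply, map_mul, this, zero_mul]
  exact this hx

/-- The component of degree `n` of an element of `TV`. -/
noncomputable abbrev comp (n : ℕ) : TensorAlgebra k V →ₗ[k] TensorAlgebra k V :=
  GradedAlgebra.proj (fun i : ℕ => gens k V ^ i) n

lemma comp_mem (n : ℕ) (x : TensorAlgebra k V) : comp n x ∈ gens k V ^ n :=
  SetLike.coe_mem _

lemma comp_of_mem {n : ℕ} {x : TensorAlgebra k V} (hx : x ∈ gens k V ^ n) : comp n x = x :=
  DirectSum.decompose_of_mem_same (fun i : ℕ => gens k V ^ i) hx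

lemma comp_of_mem_ne {m n : ℕ} {x : TensorAlgebra k V} (hx : x ∈ gens k V ^ m) (h : m ≠ n) :
    comp n x = 0 :=
  DirectSum.decompose_of_mem_ne (fun i : ℕ => gens k V ^ i) hx h

lemma comp_mul (n : ℕ) (x : TensorAlgebra k V) {v : TensorAlgebra k V} (hv : v ∈ gens k V) :
    comp (n + 1) (x * v) = comp n x * v :=
  DirectSum.coe_decompose_mul_add_of_right_mem (fun i : ℕ => gens k V ^ i) (by simpa using hv)

/-- The kernel of `TV → A` is `TV · R · TV`, hence a sum of the homogeneous pieces `V^i R V^j`; each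
is fixed or killed by taking a component. -/
lemma comp_mem_rels (n : ℕ) {x : TensorAlgebra k V} (hx : D.proj x = 0) : comp n x ∈ D.rels n := by
  have h1 : (⊤ : Submodule k (TensorAlgebra k V)) = ⨆ i : ℕ, gens k V ^ i :=
    (DirectSum.Decomposition.isInternal (fun i : ℕ => gens k V ^ i)).submodule_iSup_eq_top.symm
  have h2 : (⊤ * D.rel * ⊤ : Submodule k (TensorAlgebra k V)) ≤ (D.rels n).comap (comp n) := by
    rw [h1, Submodule.iSup_mul, Submodule.iSup_mul]
    refine iSup_le fun i => ?_
    rw [Submodule.mul_iSup]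
    refine iSup_le fun j => fun y hy => ?_
    rw [Submodule.mem_comap]
    have hy' : y ∈ gens k V ^ (i + j + 2) := D.block_le' rfl hy
    by_cases hn : i + j + 2 = n
    · subst hn
      rw [comp_of_mem hy']
      refine Finset.le_sup (f := D.block (i + j + 2)) (b := i) (by rw [Finset.mem_range]; omega) ?_
      rw [block, show i + j + 2 - 2 - i = j by omega]
      exact hy
    · rw [comp_of_mem_ne hy' hn]
      exact Submodule.zero_mem _
  exact h2 (D.mem_of_proj_eq_zero hx)

lemma mem_rels {m : ℕ} {x : TensorAlgebra k V} (hx : x ∈ gens k V ^ m) (h : D.proj x = 0) :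
    x ∈ D.rels m := by
  rw [← comp_of_mem hx]
  exact D.comp_mem_rels m h

lemma gen_injective : Function.Injective D.gen := by
  rw [← LinearMap.ker_eq_bot, LinearMap.ker_eq_bot']
  intro v hv
  have := D.mem_rels (m := 1) (x := TensorAlgebra.ι k v) (by simp) hv
  rw [rels_one, Submodule.mem_bot] at this
  exact (TensorAlgebra.ι_eq_zero_iff k v).1 this

lemma R_zero : D.R 0 = 1 := rfl

lemma R_one : D.R 1 = gens k V := rfl

lemma R_add_le_of_nonneg (a b : ℕ) : D.R (a + b) ≤ D.R a * D.R b := by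
  rcases Nat.eq_zero_or_pos a with rfl | ha
  · rw [R_zero, one_mul, zero_add]
  rcases Nat.eq_zero_or_pos b with rfl | hb
  · rw [R_zero, mul_one, add_zero]
  exact D.R_add_le ha hb

lemma pow_mul_R (m : ℕ) {n : ℕ} (hn : 0 < n) :
    gens k V ^ m * D.R n =
      gens k V ^ (m + n) ⊓ (Finset.Ico m (m + n - 1)).inf (D.block (m + n)) := by
  rw [D.R_eq_inf hn, D.mul_inf_block m]
  · congr 2
    ext x
    simp only [Finset.mem_image, Finset.mem_range, Finset.mem_Ico]
    constructor
    · rintro ⟨y, hy, rfl⟩; omega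
    · rintro h; exact ⟨x - m, by omega, by omega⟩
  · intro i hi; rw [Finset.mem_range] at hi; omega

/-- Membership in `V R_{n+1}` supplies all block conditions except the one at position `0`, and `R ·
R_n` supplies that one. -/
lemma rel_mul_inf_gens_mul_le (n : ℕ) :
    D.rel * D.R n ⊓ gens k V * D.R (n + 1) ≤ D.R (n + 2) := by
  have h1 := D.pow_mul_R 1 (n := n + 1) (by omega)
  rw [pow_one] at h1
  rw [h1, D.R_eq_inf (n := n + 2) (by omega), show 1 + (n + 1) = n + 2 by omega]
  refine le_inf (inf_le_right.trans inf_le_left) (Finset.le_inf fun i hi => ?_)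
  rw [Finset.mem_range] at hi
  rcases Nat.eq_zero_or_pos i with rfl | h0
  · refine inf_le_left.trans ?_
    rw [block, pow_zero, one_mul]
    exact mul_le_mul' le_rfl (D.R_le n)
  · exact inf_le_right.trans (inf_le_right.trans (Finset.inf_le (by rw [Finset.mem_Ico]; omega)))

/-! ### Linear resolutions, bases of the `R_n`, and distributivity -/

/-- A linear free resolution of the trivial module. -/
structure LinearResolution where
  /-- The generators. -/
  Q : ℕ → Type u
  unique : Unique (Q 0)
  /-- The differentials. -/
  d : ∀ n, (Q (n + 1) →₀ D.A) →ₗ[D.A] (Q n →₀ D.A)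
  linear : ∀ n i j, d n (Finsupp.single i 1) j ∈ LinearMap.range D.gen
  exact_zero : ∀ x : Q 0 →₀ D.A, x ∈ LinearMap.range (d 0) ↔ x default ∈ D.augIdeal
  exact : ∀ n, Function.Exact (d (n + 1)) (d n)

variable {D}

/-- The term `A` in degree `0` becomes the free module on one generator, which shifts the given
index sets by one and makes all differentials uniform. -/
lemma IsKoszul.nonempty_linearResolution (h : D.IsKoszul) : Nonempty D.LinearResolution := by
  obtain ⟨I, δ₀, δ, h₀, h₁, h₂, h₃, h₄⟩ := h
  refine ⟨{
    Q := fun | 0 => PUnit | n + 1 => I n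
    unique := inferInstanceAs (Unique PUnit)
    d := fun | 0 => Finsupp.lsingle PUnit.unit ∘ₗ δ₀ | n + 1 => δ n
    linear := ?_
    exact_zero := ?_
    exact := ?_ }⟩
  · rintro (_ | n) i j
    · obtain ⟨⟩ := j
      simpa using h₀ i
    · exact h₁ n i j
  · intro x
    rw [← h₂]
    constructor
    · rintro ⟨y, rfl⟩
      exact ⟨y, by simp⟩
    · rintro ⟨y, hy⟩
      refine ⟨y, ?_⟩
      ext
      simp [hy]
  · rintro (_ | n)
    · intro y
      rw [← h₃ y]
      exact Finsupp.single_eq_zero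
    · exact h₄ n

namespace LinearResolution

attribute [instance] LinearResolution.unique

variable (P : D.LinearResolution)

lemma exists_coeff : ∃ v : ∀ n, P.Q (n + 1) → (P.Q n →₀ V), ∀ n i,
    (v n i).mapRange D.gen (map_zero _) = P.d n (Finsupp.single i 1) := by
  obtain ⟨s, hs⟩ := LinearMap.exists_leftInverse_of_injective D.gen
    (LinearMap.ker_eq_bot.2 D.gen_injective)
  refine ⟨fun n i => (P.d n (Finsupp.single i 1)).mapRange s (map_zero _), fun n i => ?_⟩
  ext j
  obtain ⟨w, hw⟩ := P.linear n i j
  rw [Finsupp.mapRange_apply, Finsupp.mapRange_apply, ← hw]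
  exact congrArg D.gen (LinearMap.congr_fun hs w)

/-- The coefficients of the differentials. -/
noncomputable def coeff (n : ℕ) : P.Q (n + 1) → (P.Q n →₀ V) := P.exists_coeff.choose n

lemma mapRange_coeff (n : ℕ) (i : P.Q (n + 1)) :
    (P.coeff n i).mapRange D.gen (map_zero _) = P.d n (Finsupp.single i 1) :=
  P.exists_coeff.choose_spec n i

/-- The lift of the differentials to `TV`. -/
noncomputable def dT (n : ℕ) :
    (P.Q (n + 1) →₀ TensorAlgebra k V) →ₗ[TensorAlgebra k V] (P.Q n →₀ TensorAlgebra k V) :=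
  Finsupp.linearCombination _ fun i => (P.coeff n i).mapRange (TensorAlgebra.ι k) (map_zero _)

/-- The projection to `A`, coefficientwise. -/
noncomputable def projF {ι : Type*} (x : ι →₀ TensorAlgebra k V) : ι →₀ D.A :=
  x.mapRange D.proj (map_zero _)

lemma projF_add {ι : Type*} (x y : ι →₀ TensorAlgebra k V) :
    projF (D := D) (x + y) = projF x + projF y :=
  Finsupp.mapRange_add (by simp) x y

lemma projF_surjective {ι : Type*} : Function.Surjective (projF (D := D) (ι := ι)) :=
  Finsupp.mapRange_surjective _ (map_zero _) D.proj_surjective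

lemma projF_dT (n : ℕ) (x : P.Q (n + 1) →₀ TensorAlgebra k V) :
    projF (P.dT n x) = P.d n (projF x) := by
  induction x using Finsupp.induction_linear with
  | zero => simp [projF]
  | add x y hx hy => rw [map_add, projF_add, projF_add, map_add, hx, hy]
  | single i a =>
    have h1 : projF (D := D) (Finsupp.single i a) = D.proj a • Finsupp.single i 1 := by
      rw [projF, Finsupp.mapRange_single, Finsupp.smul_single, smul_eq_mul, mul_one]
    rw [h1, map_smul, ← P.mapRange_coeff, dT, Finsupp.linearCombination_single]
    ext j
    simp [projF, proj_ι]

/-- The bases of the spaces `R_n`. -/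
noncomputable def base : ∀ n, P.Q n → TensorAlgebra k V
  | 0 => fun _ => 1
  | n + 1 => fun i => Finsupp.linearCombination (TensorAlgebra k V) (base n)
      ((P.coeff n i).mapRange (TensorAlgebra.ι k) (map_zero _))

/-- The linear combinations of the elements of `base` with coefficients in `TV`. -/
noncomputable def baseT (n : ℕ) :
    (P.Q n →₀ TensorAlgebra k V) →ₗ[TensorAlgebra k V] TensorAlgebra k V :=
  Finsupp.linearCombination (TensorAlgebra k V) (P.base n)

lemma baseT_succ (n : ℕ) (x : P.Q (n + 1) →₀ TensorAlgebra k V) :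
    P.baseT (n + 1) x = P.baseT n (P.dT n x) := by
  induction x using Finsupp.induction_linear with
  | zero => simp
  | add x y hx hy => rw [map_add, map_add, map_add, hx, hy]
  | single i a =>
    rw [baseT, dT, Finsupp.linearCombination_single, Finsupp.linearCombination_single, map_smul]
    rfl

lemma dT_apply_mem {n m : ℕ} {x : P.Q (n + 1) →₀ TensorAlgebra k V}
    (hx : ∀ i, x i ∈ gens k V ^ m) (j : P.Q n) : P.dT n x j ∈ gens k V ^ (m + 1) := by
  rw [dT, Finsupp.linearCombination_apply, Finsupp.sum_apply]
  refine Submodule.sum_mem _ fun i _ => ?_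
  beta_reduce
  rw [Finsupp.smul_apply, Finsupp.mapRange_apply, smul_eq_mul, pow_succ]
  exact Submodule.mul_mem_mul (hx i) ⟨_, rfl⟩

lemma dT_mapRange_comp (n m : ℕ) (x : P.Q (n + 1) →₀ TensorAlgebra k V) (j : P.Q n) :
    P.dT n (x.mapRange (comp m) (map_zero _)) j = comp (m + 1) (P.dT n x j) := by
  induction x using Finsupp.induction_linear with
  | zero => simp
  | add x y hx hy =>
    rw [Finsupp.mapRange_add (by simp), map_add, map_add, Finsupp.add_apply, Finsupp.add_apply,
      map_add, hx, hy]
  | single i a =>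
    rw [Finsupp.mapRange_single, dT, Finsupp.linearCombination_single,
      Finsupp.linearCombination_single, Finsupp.smul_apply, Finsupp.smul_apply,
      Finsupp.mapRange_apply, smul_eq_mul, smul_eq_mul, comp_mul _ _ ⟨_, rfl⟩]

/-- The lifted differential raises degree by one, so the degree `m` component of any preimage serves
as `z`. The error vanishes in `A` and is homogeneous of degree `m + 1`. -/
lemma exists_homogeneous_lift {n m : ℕ} {t : P.Q n →₀ TensorAlgebra k V}
    (ht : ∀ j, t j ∈ gens k V ^ (m + 1)) (h : projF t ∈ LinearMap.range (P.d n)) :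
    ∃ z : P.Q (n + 1) →₀ TensorAlgebra k V, (∀ i, z i ∈ gens k V ^ m) ∧
      ∀ j, (t - P.dT n z) j ∈ D.rels (m + 1) := by
  obtain ⟨Z, hZ⟩ := h
  obtain ⟨z, rfl⟩ := projF_surjective Z
  refine ⟨z.mapRange (comp m) (map_zero _), fun i => ?_, fun j => ?_⟩
  · rw [Finsupp.mapRange_apply]; exact comp_mem _ _
  · rw [Finsupp.sub_apply, P.dT_mapRange_comp, ← comp_of_mem (ht j), ← map_sub]
    refine D.comp_mem_rels _ ?_
    rw [← projF_dT] at hZ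
    have := DFunLike.congr_fun hZ j
    rw [projF, projF, Finsupp.mapRange_apply, Finsupp.mapRange_apply] at this
    rw [map_sub, this, sub_self]

/-- Minimality of the resolution: the matrix entries lie in `V`, so everything in the image of a
differential has augmentation `0`. -/
lemma aug_of_mem_range (n : ℕ) {x : P.Q n →₀ D.A} (hx : x ∈ LinearMap.range (P.d n))
    (j : P.Q n) : D.aug (x j) = 0 := by
  obtain ⟨y, rfl⟩ := hx
  induction y using Finsupp.induction_linear with
  | zero => simp
  | add x y hx hy => rw [map_add, Finsupp.add_apply, map_add, hx, hy, add_zero]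
  | single i a =>
    have : Finsupp.single i a = a • Finsupp.single i (1 : D.A) := by simp
    rw [this, map_smul, Finsupp.smul_apply, smul_eq_mul]
    exact D.aug_mul_gen _ _ (P.linear n i j)

/-- The elements of `base` form a basis of `R_n`. -/
def IsBase (n : ℕ) : Prop :=
  LinearIndependent k (P.base n) ∧ Submodule.span k (Set.range (P.base n)) = D.R n

variable {P}

lemma IsBase.exists_of_mem_mul {n : ℕ} (hb : P.IsBase n) {W : Submodule k (TensorAlgebra k V)}
    {x : TensorAlgebra k V} (hx : x ∈ W * D.R n) :
    ∃ t : P.Q n →₀ TensorAlgebra k V, (∀ j, t j ∈ W) ∧ P.baseT n t = x := by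
  rw [← hb.2] at hx
  induction hx using Submodule.mul_induction_on' with
  | mem_mul_mem w hw y hy =>
    obtain ⟨c, rfl⟩ := (Finsupp.mem_span_range_iff_exists_finsupp).1 hy
    refine ⟨c.mapRange (fun a => a • w) (zero_smul _ _), fun j => ?_, ?_⟩
    · rw [Finsupp.mapRange_apply]; exact Submodule.smul_mem _ _ hw
    · rw [baseT, Finsupp.linearCombination_apply, Finsupp.sum_mapRange_index (by simp),
        Finsupp.mul_sum]
      refine Finsupp.sum_congr fun i _ => ?_
      rw [smul_eq_mul, smul_mul_assoc, mul_smul_comm]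
  | add x _ y _ hx hy =>
    obtain ⟨t, ht, rfl⟩ := hx
    obtain ⟨t', ht', rfl⟩ := hy
    exact ⟨t + t', fun j => Submodule.add_mem _ (ht j) (ht' j), map_add _ _ _⟩

lemma baseT_mem {n : ℕ} (hb : P.IsBase n) {W : Submodule k (TensorAlgebra k V)}
    {t : P.Q n →₀ TensorAlgebra k V} (ht : ∀ j, t j ∈ W) : P.baseT n t ∈ W * D.R n := by
  rw [baseT, Finsupp.linearCombination_apply]
  refine Submodule.sum_mem _ fun i _ => ?_
  beta_reduce
  rw [smul_eq_mul, ← hb.2]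
  exact Submodule.mul_mem_mul (ht i) (Submodule.subset_span ⟨i, rfl⟩)

/-- Linear disjointness of `V^m` and `R_n`: coefficients in `V^m` with respect to a basis of `R_n`
are unique. Homogeneity of the coefficients is what lets this be used. -/
lemma IsBase.eq_zero {n m : ℕ} (hb : P.IsBase n) {t : P.Q n →₀ TensorAlgebra k V}
    (ht : ∀ j, t j ∈ gens k V ^ m) (h : P.baseT n t = 0) : t = 0 := by
  classical
  have hd : (gens k V ^ m).LinearDisjoint (D.R n) :=
    (linearDisjoint_pow m n).of_le_of_flat_right le_rfl (D.R_le n)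
  have hmem : ∀ i, P.base n i ∈ D.R n := fun i => hb.2 ▸ Submodule.subset_span ⟨i, rfl⟩
  let b : P.Q n → D.R n := fun i => ⟨P.base n i, hmem i⟩
  have hbi : LinearIndependent k b := LinearIndependent.of_comp (D.R n).subtype hb.1
  have hker := hd.linearIndependent_right_of_flat hbi
  let t' : P.Q n →₀ ↥(gens k V ^ m) :=
    Finsupp.onFinset t.support (fun j => ⟨t j, ht j⟩) fun j hj => by
      rw [Finsupp.mem_support_iff]; exact fun e => hj (Subtype.ext e)
  have h1 : t' ∈ LinearMap.ker (Submodule.mulRightMap (gens k V ^ m) b) := by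
    rw [LinearMap.mem_ker, Submodule.mulRightMap_apply, ← h, baseT,
      Finsupp.linearCombination_apply, Finsupp.sum, Finsupp.sum]
    refine Finset.sum_subset_zero_on_sdiff (Finsupp.support_onFinset_subset) ?_ ?_
    · intro x hx
      rw [Finset.mem_sdiff, Finsupp.notMem_support_iff] at hx
      have := congrArg Subtype.val hx.2
      simp only [t', Finsupp.onFinset_apply] at this
      simp [this]
    · intro x _; rfl
  rw [hker, Submodule.mem_bot] at h1
  ext j
  exact congrArg Subtype.val (DFunLike.congr_fun h1 j)

lemma IsBase.apply_mem {n m : ℕ} (hb : P.IsBase n) {t : P.Q n →₀ TensorAlgebra k V}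
    (ht : ∀ j, t j ∈ gens k V ^ m) {W : Submodule k (TensorAlgebra k V)} (hW : W ≤ gens k V ^ m)
    (h : P.baseT n t ∈ W * D.R n) (j : P.Q n) : t j ∈ W := by
  obtain ⟨s, hs, hst⟩ := hb.exists_of_mem_mul h
  have : t - s = 0 := hb.eq_zero (m := m)
    (fun j => Submodule.sub_mem _ (ht j) (hW (hs j))) (by rw [map_sub, hst, sub_self])
  rw [sub_eq_zero.1 this]
  exact hs j

/-- A linear relation is a cycle with scalar entries, hence a boundary by exactness; by minimality
boundaries have augmentation `0`, and scalars are determined by their augmentation. -/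
lemma IsBase.linearIndependent_succ {n : ℕ} (hb : P.IsBase n) :
    LinearIndependent k (P.base (n + 1)) := by
  rw [linearIndependent_iff]
  intro c hc
  set t : P.Q (n + 1) →₀ TensorAlgebra k V := c.mapRange (algebraMap k _) (map_zero _)
  have h1 : P.baseT (n + 1) t = 0 := by
    rw [← hc, baseT, Finsupp.linearCombination_apply, Finsupp.linearCombination_apply,
      Finsupp.sum_mapRange_index (by simp)]
    exact Finsupp.sum_congr fun i _ => by rw [smul_eq_mul, Algebra.smul_def]
  have ht : ∀ i, t i ∈ gens k V ^ 0 := fun i => by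
    rw [pow_zero, Finsupp.mapRange_apply]
    exact Submodule.algebraMap_mem _
  rw [baseT_succ] at h1
  have h2 := hb.eq_zero (P.dT_apply_mem ht) h1
  have h3 : projF t ∈ LinearMap.range (P.d (n + 1)) := by
    refine (P.exact n _).1 ?_
    rw [← projF_dT, h2]
    simp [projF]
  ext i
  have h4 := P.aug_of_mem_range _ h3 i
  simpa [projF, t] using h4

/-- There are no relations of degree one, so in this degree a lift of a boundary is exactly `dT` of
an element with scalar coefficients. Hypothesis `h` isolates the use of exactness, which differs in
degree `0`. -/
lemma IsBase.span_succ_ge {n : ℕ} (hb : P.IsBase n)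
    (h : ∀ t : P.Q n →₀ TensorAlgebra k V, (∀ j, t j ∈ gens k V) → P.baseT n t ∈ D.R (n + 1) →
      projF t ∈ LinearMap.range (P.d n)) :
    D.R (n + 1) ≤ Submodule.span k (Set.range (P.base (n + 1))) := by
  intro y hy
  have hy' := D.R_add_le_of_nonneg 1 n (by rwa [add_comm])
  rw [R_one] at hy'
  obtain ⟨t, ht, rfl⟩ := hb.exists_of_mem_mul hy'
  obtain ⟨z, hz, hz'⟩ := P.exists_homogeneous_lift (m := 0) (by simpa using ht) (h t ht hy)
  have : t = P.dT n z := by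
    rw [← sub_eq_zero]
    ext j
    have := hz' j
    rwa [zero_add, rels_one, Submodule.mem_bot] at this
  rw [this, ← baseT_succ, baseT, Finsupp.linearCombination_apply]
  refine Submodule.sum_mem _ fun i _ => ?_
  have h1 := hz i
  rw [pow_zero] at h1
  obtain ⟨c, hc⟩ := Submodule.mem_one.1 h1
  beta_reduce
  rw [← hc, smul_eq_mul, ← Algebra.smul_def]
  exact Submodule.smul_mem _ _ (Submodule.subset_span ⟨i, rfl⟩)

lemma coeff_mem (n : ℕ) (i : P.Q (n + 1)) (j : P.Q n) :
    (P.coeff n i).mapRange (TensorAlgebra.ι k) (map_zero _) j ∈ gens k V := by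
  rw [Finsupp.mapRange_apply]; exact ⟨_, rfl⟩

lemma dT_single_one (n : ℕ) (i : P.Q (n + 1)) :
    P.dT n (Finsupp.single i 1) = (P.coeff n i).mapRange (TensorAlgebra.ι k) (map_zero _) := by
  rw [dT, Finsupp.linearCombination_single, one_smul]

variable (P)

/-- The linear resolution of `k` is the Koszul complex `A ⊗ R_n` in disguise: both its cycles and
`R_{n+2}` are described by the condition that two consecutive steps produce coefficients in `R`. The
induction goes two steps back for this reason. -/
lemma isBase : ∀ n, P.IsBase n := by
  have h0 : P.IsBase 0 := by
    constructor
    · exact LinearIndependent.of_subsingleton (i := default) (by simp [base])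
    · rw [R_zero, Submodule.one_eq_span]
      congr 1
      ext x
      simp only [Set.mem_range, base, Set.mem_singleton_iff]
      exact ⟨fun ⟨_, h⟩ => h.symm, fun h => ⟨default, h.symm⟩⟩
  have h1 : P.IsBase 1 := by
    refine ⟨h0.linearIndependent_succ, le_antisymm ?_ (h0.span_succ_ge ?_)⟩
    · rw [Submodule.span_le]
      rintro _ ⟨i, rfl⟩
      have : P.base 1 i = P.baseT 0 ((P.coeff 0 i).mapRange (TensorAlgebra.ι k) (map_zero _)) := rfl
      rw [this]
      have := baseT_mem h0 (coeff_mem 0 i)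
      rwa [R_zero, mul_one] at this
    · intro t ht _
      rw [P.exact_zero]
      obtain ⟨v, hv⟩ := ht default
      rw [projF, Finsupp.mapRange_apply, ← hv, proj_ι]
      exact Ideal.subset_span ⟨v, rfl⟩
  have hstep : ∀ n, P.IsBase n → P.IsBase (n + 1) → P.IsBase (n + 2) := by
    intro n hn hn1
    refine ⟨hn1.linearIndependent_succ, le_antisymm ?_ (hn1.span_succ_ge ?_)⟩
    · rw [Submodule.span_le]
      rintro _ ⟨i, rfl⟩
      have e1 : P.base (n + 2) i = P.baseT (n + 1) (P.dT (n + 1) (Finsupp.single i 1)) := by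
        rw [dT_single_one]; rfl
      have hc : ∀ j, P.dT (n + 1) (Finsupp.single i 1) j ∈ gens k V := fun j => by
        rw [dT_single_one]; exact coeff_mem _ _ _
      -- The composite of two differentials is zero in `A`, so its degree two coefficients in `TV`
      -- lie in `R`.
      refine D.rel_mul_inf_gens_mul_le n ⟨?_, ?_⟩
      · rw [e1, baseT_succ]
        refine baseT_mem hn fun j => ?_
        rw [← D.rels_two]
        refine D.mem_rels ?_ ?_
        · exact P.dT_apply_mem (m := 1) (by simpa using hc) j
        · have : projF (D := D) (P.dT n (P.dT (n + 1) (Finsupp.single i 1))) = 0 := by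
            rw [projF_dT, projF_dT]
            exact (P.exact n _).2 ⟨_, rfl⟩
          have := DFunLike.congr_fun this j
          rwa [projF, Finsupp.mapRange_apply] at this
      · rw [e1]
        exact baseT_mem hn1 hc
    -- Conversely, as `R_{n+2} ⊆ R · R_n`, the coefficients of `dT t` lie in `R`; so `t` becomes a
    -- cycle over `A`, hence a boundary.
    · intro t ht hy
      refine (P.exact n _).1 ?_
      rw [← projF_dT]
      have hy' := D.R_add_le_of_nonneg 2 n (by rwa [add_comm])
      rw [R_two, baseT_succ] at hy'
      ext j
      rw [projF, Finsupp.mapRange_apply]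
      exact D.proj_rel (hn.apply_mem (P.dT_apply_mem (m := 1) (by simpa using ht)) D.rel_le hy' j)
  intro n
  have : P.IsBase n ∧ P.IsBase (n + 1) := by
    induction n with
    | zero => exact ⟨h0, h1⟩
    | succ n ih => exact ⟨ih.2, hstep n ih.1 ih.2⟩
  exact this.1

/-- Elements of `V^p R_{N-p}` are the degree `p` chains over the basis of `R_{N-p}`. Lying in the
sum of the first `p` blocks makes such a chain a cycle modulo relations, and exactness rewrites it
as a boundary plus a chain with coefficients that are relations. -/
lemma distFor_initial (P : D.LinearResolution) (N p : ℕ) (hp : p ≤ N - 1) :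
    DistFor (gens k V ^ N) (D.block N) (Finset.range p) (Finset.Ico p (N - 1)) := by
  rcases Nat.eq_zero_or_pos p with rfl | hp0
  · simp [DistFor]
  rcases eq_or_lt_of_le hp with rfl | hlt
  · unfold DistFor
    rw [Finset.Ico_self, Finset.inf_empty, inf_top_eq]
    refine inf_le_left.trans (Finset.sup_mono_fun fun i hi => ?_)
    rw [Finset.mem_range] at hi
    exact le_inf le_rfl (D.block_le (by omega))
  obtain ⟨q, rfl⟩ : ∃ q, N = p + (q + 2) := ⟨N - p - 2, by omega⟩
  obtain ⟨p, rfl⟩ : ∃ p', p = p' + 1 := ⟨p - 1, by omega⟩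
  unfold DistFor
  rw [← D.pow_mul_R (p + 1) (n := q + 2) (by omega)]
  rintro x ⟨hx1, hx2⟩
  obtain ⟨t, ht, rfl⟩ := (P.isBase (q + 2)).exists_of_mem_mul hx2
  -- The first `p + 1` blocks are the relations among the first `p + 2` tensor factors, so the
  -- coefficients over `R_{q+1}` are relations of `A`.
  have h1 : P.baseT (q + 2) t ∈ D.rels (p + 1 + 1) * D.R (q + 1) := by
    have hd := linearDisjoint_pow (k := k) (V := V) (p + 1 + 1) (q + 1)
    rw [mul_eq_inf_of_linearDisjoint hd (D.rels_le _) (D.R_le _)]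
    constructor
    · rw [rels, D.sup_block_mul (q + 1) _ fun i hi => by rw [Finset.mem_range] at hi; omega]
      rw [show p + 1 + 1 + (q + 1) = p + 1 + (q + 2) by omega]
      exact hx1
    · rw [baseT_succ]
      exact baseT_mem (P.isBase (q + 1)) (P.dT_apply_mem ht)
  rw [baseT_succ] at h1
  have h2 := (P.isBase (q + 1)).apply_mem (P.dT_apply_mem ht) (D.rels_le _) h1
  have h3 : projF t ∈ LinearMap.range (P.d (q + 2)) := by
    refine (P.exact (q + 1) _).1 ?_
    rw [← projF_dT]
    ext j
    rw [projF, Finsupp.mapRange_apply]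
    exact D.proj_rels (h2 j)
  obtain ⟨z, hz, hz'⟩ := P.exists_homogeneous_lift ht h3
  -- The boundary part lies in `V^p R_{q+3}`, hence in block `p`; the remainder lies in the sum of
  -- the blocks below `p`, each intersected with `V^(p+1) R_{q+2}`.
  have h4 : P.baseT (q + 2) t = P.baseT (q + 3) z + P.baseT (q + 2) (t - P.dT (q + 2) z) := by
    rw [map_sub, ← baseT_succ]; abel
  have h5 := baseT_mem (P.isBase (q + 3)) hz
  have h6 := baseT_mem (P.isBase (q + 2)) hz'
  rw [h4]
  refine Submodule.add_mem _ ?_ ?_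
  · refine Finset.le_sup (f := fun i => D.block (p + 1 + (q + 2)) i ⊓
      gens k V ^ (p + 1) * D.R (q + 2)) (b := p) (by simp) ?_
    rw [D.pow_mul_R p (by omega)] at h5
    rw [D.pow_mul_R (p + 1) (by omega)]
    rw [show p + (q + 3) = p + 1 + (q + 2) by omega] at h5
    have h7 := fun i hi => (Submodule.mem_finsetInf.1 h5.2) i hi
    refine ⟨h7 p (by rw [Finset.mem_Ico]; omega), h5.1, ?_⟩
    rw [SetLike.mem_coe, Submodule.mem_finsetInf]
    intro i hi
    exact h7 i (by rw [Finset.mem_Ico] at hi ⊢; omega)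
  · rw [rels] at h6
    have : ∀ S : Finset ℕ, S ⊆ Finset.range (p + 1 - 1) → S.sup (D.block (p + 1)) * D.R (q + 2) ≤
        (Finset.range (p + 1)).sup fun i => D.block (p + 1 + (q + 2)) i ⊓
          gens k V ^ (p + 1) * D.R (q + 2) := by
      intro S
      induction S using Finset.induction_on with
      | empty => simp
      | insert i S hi ih =>
        intro hS
        rw [Finset.sup_insert, Submodule.sup_mul]
        refine sup_le ?_ (ih ((Finset.subset_insert _ _).trans hS))
        have hi' := Finset.mem_range.1 (hS (Finset.mem_insert_self _ _))
        refine le_trans ?_ (Finset.le_sup (b := i) (by rw [Finset.mem_range]; omega))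
        refine le_inf ?_ (mul_le_mul' (D.block_le (by omega)) le_rfl)
        rw [← D.block_mul (m := p + 1) (c := i) (by omega) (q + 2)]
        exact mul_le_mul' le_rfl (D.R_le _)
    exact this _ le_rfl h6

end LinearResolution

/-- One direction of Backelin's theorem. -/
lemma IsKoszul.distributive (h : D.IsKoszul) (N : ℕ) : D.Distributive N :=
  let ⟨P⟩ := h.nonempty_linearResolution
  D.distributive_of_initial P.distFor_initial N

end QuadraticData

/-! ### Ext by dimension shifting along a projective resolution -/

section Syzygies

open Abelian

universe w v u'

variable {C : Type u'} [Category.{v} C] [Abelian C] [HasExt.{w} C]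

/-- A projective resolution, cut into short exact sequences `Ω (n + 1) → P n → Ω n`. -/
structure Syzygies (C : Type u') [Category.{v} C] [Abelian C] where
  /-- The syzygies. -/
  Ω : ℕ → C
  /-- The projective objects. -/
  P : ℕ → C
  /-- The inclusions. -/
  i : ∀ n, Ω (n + 1) ⟶ P n
  /-- The projections. -/
  p : ∀ n, P n ⟶ Ω n
  w : ∀ n, i n ≫ p n = 0
  shortExact : ∀ n, (ShortComplex.mk (i n) (p n) (w n)).ShortExact
  projective : ∀ n, Projective (P n)

namespace Syzygies

attribute [instance] Syzygies.projective

variable (S : Syzygies C)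

/-- The Yoneda class of `Ω n → P (n - 1) → ⋯ → P 0 → Ω 0`. -/
noncomputable def yonedaClass : ∀ n, Ext.{w} (S.Ω 0) (S.Ω n) n
  | 0 => Ext.mk₀ (𝟙 _)
  | n + 1 => (yonedaClass n).comp (S.shortExact n).extClass rfl

/-- In the long exact sequence the obstruction lies in `Ext^{m+1}(P n, Y)`, which vanishes. The
degree of `x` must be positive: for maps, those that extend to `P n` are killed. -/
lemma eq_zero_of_extClass_comp {n m N : ℕ} {Y : C} (x : Ext.{w} (S.Ω (n + 1)) Y (m + 1))
    (h : 1 + (m + 1) = N) (hx : (S.shortExact n).extClass.comp x h = 0) : x = 0 := by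
  obtain ⟨y, rfl⟩ := Ext.contravariant_sequence_exact₁ (S.shortExact n) Y x h hx
  rw [Ext.eq_zero_of_projective (P := S.P n) y, Ext.comp_zero]

lemma exists_extClass_comp_eq {n m N : ℕ} {Y : C} (x : Ext.{w} (S.Ω n) Y N)
    (h : 1 + m = N) : ∃ y : Ext.{w} (S.Ω (n + 1)) Y m, (S.shortExact n).extClass.comp y h = x := by
  obtain ⟨N, rfl⟩ : ∃ N', N = N' + 1 := ⟨N - 1, by omega⟩
  exact Ext.contravariant_sequence_exact₃ (S.shortExact n) Y x
      (Ext.eq_zero_of_projective (P := S.P n) _) _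

lemma eq_zero_of_yonedaClass_comp {n m N : ℕ} {Y : C} (x : Ext.{w} (S.Ω n) Y (m + 1))
    (h : n + (m + 1) = N) (hx : (S.yonedaClass n).comp x h = 0) : x = 0 := by
  induction n generalizing m N with
  | zero =>
    obtain rfl : N = m + 1 := by omega
    rwa [yonedaClass, Ext.mk₀_id_comp] at hx
  | succ n ih =>
    rw [yonedaClass, Ext.comp_assoc (h₂₃ := (by omega : 1 + (m + 1) = (m + 1) + 1)) (h := by omega)]
      at hx
    exact S.eq_zero_of_extClass_comp x _ (ih _ (by omega) hx)

lemma exists_yonedaClass_comp_eq {n m N : ℕ} {Y : C} (x : Ext.{w} (S.Ω 0) Y N)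
    (h : n + m = N) : ∃ y : Ext.{w} (S.Ω n) Y m, (S.yonedaClass n).comp y h = x := by
  induction n generalizing m N with
  | zero =>
    obtain rfl : N = m := by omega
    exact ⟨x, by rw [yonedaClass, Ext.mk₀_id_comp]⟩
  | succ n ih =>
    obtain ⟨y, rfl⟩ := ih x (by omega : n + (1 + m) = N)
    obtain ⟨z, rfl⟩ := S.exists_extClass_comp_eq y rfl
    exact ⟨z, by rw [yonedaClass, Ext.comp_assoc]; omega⟩

/-- The class of a morphism `Ω n ⟶ Y`. -/
noncomputable def extOfHom (n : ℕ) {Y : C} (f : S.Ω n ⟶ Y) : Ext.{w} (S.Ω 0) Y n :=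
  (S.yonedaClass n).comp (Ext.mk₀ f) (add_zero n)

lemma extOfHom_surjective (n : ℕ) (Y : C) :
    Function.Surjective (S.extOfHom n : (S.Ω n ⟶ Y) → Ext.{w} (S.Ω 0) Y n) := by
  intro x
  obtain ⟨y, rfl⟩ := S.exists_yonedaClass_comp_eq x (add_zero n)
  obtain ⟨f, rfl⟩ := Ext.homEquiv₀.symm.surjective y
  exact ⟨f, by rw [extOfHom, Ext.homEquiv₀_symm_apply]⟩

/-- All connecting maps but the innermost are injective, and the kernel of that one consists of the
maps extending to `P n`: this says that a cocycle with trivial class is a coboundary. -/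
lemma exists_of_extOfHom_eq_zero {n : ℕ} {Y : C} {f : S.Ω (n + 1) ⟶ Y}
    (hf : (S.extOfHom (n + 1) f : Ext.{w} (S.Ω 0) Y (n + 1)) = 0) :
    ∃ g : S.P n ⟶ Y, S.i n ≫ g = f := by
  rw [extOfHom, yonedaClass, Ext.comp_assoc (h₂₃ := rfl) (h := by omega)] at hf
  have h1 := S.eq_zero_of_yonedaClass_comp (m := 0) _ _ hf
  obtain ⟨y, hy⟩ := Ext.contravariant_sequence_exact₁ (S.shortExact n) Y _ _ h1
  obtain ⟨g, rfl⟩ := Ext.homEquiv₀.symm.surjective y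
  refine ⟨g, Ext.homEquiv₀.symm.injective ?_⟩
  rw [Ext.homEquiv₀_symm_apply, Ext.homEquiv₀_symm_apply, ← hy, Ext.homEquiv₀_symm_apply,
    Ext.mk₀_comp_mk₀]

lemma extOfHom_comp_eq_zero (n : ℕ) {Y : C} (g : S.P n ⟶ Y) :
    (S.extOfHom (n + 1) (S.i n ≫ g) : Ext.{w} (S.Ω 0) Y (n + 1)) = 0 := by
  rw [extOfHom, yonedaClass, Ext.comp_assoc (h₂₃ := rfl) (h := by omega), ← Ext.mk₀_comp_mk₀]
  have := (S.shortExact n).extClass_comp_assoc (Ext.mk₀ g : Ext.{w} (S.P n) Y 0) (h := rfl)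
  exact (congrArg (fun x => (S.yonedaClass n).comp x rfl) this).trans (Ext.comp_zero _ _ _ _ _)

lemma extOfHom_add (n : ℕ) {Y : C} (f g : S.Ω n ⟶ Y) :
    (S.extOfHom n (f + g) : Ext.{w} (S.Ω 0) Y n) = S.extOfHom n f + S.extOfHom n g := by
  rw [extOfHom, Ext.mk₀_add, Ext.comp_add]; rfl

lemma extOfHom_smul {k : Type*} [CommRing k] [Linear k C] (n : ℕ) {Y : C} (c : k) (f : S.Ω n ⟶ Y) :
    (S.extOfHom n (c • f) : Ext.{w} (S.Ω 0) Y n) = c • S.extOfHom n f := by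
  rw [extOfHom, Ext.mk₀_smul, Ext.comp_smul]; rfl

end Syzygies

end Syzygies

/-! ### Cocycles and coboundaries of a free resolution -/

section Ring

open Abelian

variable {k : Type u} [Field k] {B : Type u} [Ring B]

lemma shortExact_of_exact {M N L : Type u} [AddCommGroup M] [AddCommGroup N] [AddCommGroup L]
    [Module B M] [Module B N] [Module B L] {f : M →ₗ[B] N} {g : N →ₗ[B] L}
    (h : Function.Exact f g) (hg : Function.Surjective g)
    (w : ModuleCat.ofHom (LinearMap.range f).subtype ≫ ModuleCat.ofHom g = 0) :
    (ShortComplex.mk (ModuleCat.ofHom (LinearMap.range f).subtype) (ModuleCat.ofHom g)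
      (zero := w)).ShortExact := by
  refine ModuleCat.shortComplex_shortExact _ ?_ (Submodule.subtype_injective _) hg
  intro x
  refine (h x).trans ⟨fun hx => ⟨⟨x, hx⟩, rfl⟩, ?_⟩
  rintro ⟨y, rfl⟩
  exact y.2

/-- A free resolution of the module `N`. -/
structure FreeResolution (B : Type u) [Ring B] where
  /-- The resolved module. -/
  N : Type u
  [addCommGroup : AddCommGroup N]
  [module : Module B N]
  /-- The generators. -/
  Q : ℕ → Type u
  /-- The differentials. -/
  d : ∀ n, (Q (n + 1) →₀ B) →ₗ[B] (Q n →₀ B)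
  /-- The augmentation. -/
  ε : (Q 0 →₀ B) →ₗ[B] N
  ε_surjective : Function.Surjective ε
  exact_zero : Function.Exact (d 0) ε
  exact : ∀ n, Function.Exact (d (n + 1)) (d n)

namespace FreeResolution

attribute [instance] FreeResolution.addCommGroup FreeResolution.module

variable (P : FreeResolution B)

/-- The syzygies of the resolution. -/
noncomputable def syzygies : Syzygies (ModuleCat.{u} B) where
  Ω
    | 0 => (ModuleCat.of B P.N)
    | n + 1 => ModuleCat.of B (LinearMap.range (P.d n))
  P n := ModuleCat.of B (P.Q n →₀ B)
  i n := ModuleCat.ofHom (LinearMap.range (P.d n)).subtype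
  p
    | 0 => ModuleCat.ofHom P.ε
    | n + 1 => ModuleCat.ofHom (P.d n).rangeRestrict
  w
    | 0 => by
      ext x
      exact (P.exact_zero _).2 x.2
    | n + 1 => ModuleCat.hom_ext (LinearMap.ext fun x => Subtype.ext ((P.exact n _).2 x.2))
  shortExact
    | 0 => shortExact_of_exact P.exact_zero P.ε_surjective _
    | n + 1 => shortExact_of_exact (fun x => by
        rw [← P.exact n x]
        exact Subtype.ext_iff) (P.d n).surjective_rangeRestrict _
  projective n := ModuleCat.projective_of_free (Finsupp.basisSingleOne (R := B))

/-- A cocycle, as a map on the syzygy. -/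
lemma exists_of_cocycle {n : ℕ} {Y : Type u} [AddCommGroup Y] [Module B Y]
    {f : (P.Q (n + 1) →₀ B) →ₗ[B] Y} (hf : f ∘ₗ P.d (n + 1) = 0) :
    ∃ g : LinearMap.range (P.d n) →ₗ[B] Y, g ∘ₗ (P.d n).rangeRestrict = f := by
  have h1 : LinearMap.ker (P.d n) ≤ LinearMap.ker f := by
    intro x hx
    obtain ⟨y, rfl⟩ := (P.exact n x).1 hx
    exact LinearMap.congr_fun hf y
  refine ⟨(LinearMap.ker (P.d n)).liftQ f h1 ∘ₗ (P.d n).quotKerEquivRange.symm.toLinearMap, ?_⟩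
  ext1 x
  ext1
  have : (P.d n).rangeRestrict (Finsupp.single x 1) =
    (P.d n).quotKerEquivRange (Submodule.Quotient.mk (Finsupp.single x 1)) := rfl
  simp only [LinearMap.comp_apply, Finsupp.lsingle_apply]
  rw [this, LinearEquiv.coe_coe, LinearEquiv.symm_apply_apply, Submodule.liftQ_apply]

/-- A cocycle descends to the syzygy; its class vanishes, so the descended map extends to the free
module, which exhibits a coboundary. -/
lemma exists_of_subsingleton_ext {n : ℕ} {Y : Type u} [AddCommGroup Y] [Module B Y]
    (h : Subsingleton (Ext.{u} (ModuleCat.of B P.N) (ModuleCat.of B Y) (n + 1)))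
    {f : (P.Q (n + 1) →₀ B) →ₗ[B] Y} (hf : f ∘ₗ P.d (n + 1) = 0) :
    ∃ g : (P.Q n →₀ B) →ₗ[B] Y, g ∘ₗ P.d n = f := by
  obtain ⟨f', rfl⟩ := P.exists_of_cocycle hf
  have h0 : (P.syzygies.extOfHom (n + 1) (Y := ModuleCat.of B Y) (ModuleCat.ofHom f') :
    Ext.{u} (ModuleCat.of B P.N) (ModuleCat.of B Y) (n + 1)) = 0 := h.elim _ _
  obtain ⟨g, hg⟩ := P.syzygies.exists_of_extOfHom_eq_zero h0
  refine ⟨g.hom, ?_⟩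
  have := congrArg ModuleCat.Hom.hom hg
  change g.hom ∘ₗ (LinearMap.range (P.d n)).subtype = f' at this
  rw [← this]
  rfl

open scoped ModuleCat in
-- The classes of two cocycles in a one-dimensional space satisfy a nontrivial linear relation, and
-- the corresponding combination of cocycles is a coboundary.
lemma exists_of_finrank_ext {n : ℕ} {Y : Type u} [AddCommGroup Y] [Module B Y]
    [Algebra k B]
    (h : Module.finrank k (Ext.{u} (ModuleCat.of B P.N) (ModuleCat.of B Y) (n + 1)) = 1)
    {f₁ f₂ : (P.Q (n + 1) →₀ B) →ₗ[B] Y} (hf₁ : f₁ ∘ₗ P.d (n + 1) = 0)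
    (hf₂ : f₂ ∘ₗ P.d (n + 1) = 0) :
    ∃ (c₁ c₂ : k) (g : (P.Q n →₀ B) →ₗ[B] Y), (c₁ ≠ 0 ∨ c₂ ≠ 0) ∧
      ∀ x, g (P.d n x) = algebraMap k B c₁ • f₁ x + algebraMap k B c₂ • f₂ x := by
  obtain ⟨f₁, rfl⟩ := P.exists_of_cocycle hf₁
  obtain ⟨f₂, rfl⟩ := P.exists_of_cocycle hf₂
  let F₁ : P.syzygies.Ω (n + 1) ⟶ ModuleCat.of B Y := ModuleCat.ofHom f₁
  let F₂ : P.syzygies.Ω (n + 1) ⟶ ModuleCat.of B Y := ModuleCat.ofHom f₂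
  obtain ⟨e, he, hspan⟩ := finrank_eq_one_iff'.1 h
  obtain ⟨a₁, h₁⟩ := hspan (P.syzygies.extOfHom (n + 1) F₁)
  obtain ⟨a₂, h₂⟩ := hspan (P.syzygies.extOfHom (n + 1) F₂)
  -- With `a₁`, `a₂` the coordinates of the two classes, the relation is `(a₂, -a₁)`, unless `a₁ =
  -- 0`, when `(1, 0)` works.
  obtain ⟨c₁, c₂, hc, hc'⟩ : ∃ c₁ c₂ : k, (c₁ ≠ 0 ∨ c₂ ≠ 0) ∧ c₁ * a₁ + c₂ * a₂ = 0 := by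
    by_cases ha : a₁ = 0
    · exact ⟨1, 0, Or.inl one_ne_zero, by rw [ha]; ring⟩
    · exact ⟨a₂, -a₁, Or.inr (neg_ne_zero.2 ha), by ring⟩
  have h0 : (P.syzygies.extOfHom (n + 1) (c₁ • F₁ + c₂ • F₂) :
      Ext.{u} (ModuleCat.of B P.N) (ModuleCat.of B Y) (n + 1)) = 0 := by
    rw [Syzygies.extOfHom_add, Syzygies.extOfHom_smul, Syzygies.extOfHom_smul]
    have h3 : c₁ • a₁ • e + c₂ • a₂ • e = 0 := by
      rw [smul_smul, smul_smul, ← add_smul, hc', zero_smul]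
    rw [h₁, h₂] at h3
    exact h3
  obtain ⟨g, hg⟩ := P.syzygies.exists_of_extOfHom_eq_zero h0
  refine ⟨c₁, c₂, g.hom, hc, fun x => ?_⟩
  have := congrArg ModuleCat.Hom.hom hg
  exact LinearMap.congr_fun this ((P.d n).rangeRestrict x)

/-- With no generators in degree `n + 1` the syzygy is zero, so every class, being the class of a
map from the syzygy, would vanish. -/
lemma exists_not_of_finrank_ext {n : ℕ} {Y : Type u} [AddCommGroup Y] [Module B Y]
    [Algebra k B]
    (h : Module.finrank k (Ext.{u} (ModuleCat.of B P.N) (ModuleCat.of B Y) (n + 1)) = 1) :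
    Nonempty (P.Q (n + 1)) := by
  by_contra hne
  rw [not_nonempty_iff] at hne
  obtain ⟨e, he, hspan⟩ := finrank_eq_one_iff'.1 h
  obtain ⟨f, rfl⟩ := P.syzygies.extOfHom_surjective (n + 1) _ e
  apply he
  have : f = P.syzygies.i n ≫ 0 := by
    ext x
    obtain ⟨x, y, rfl⟩ := x
    have hy : y = 0 := Subsingleton.elim _ _
    subst hy
    rw [Limits.comp_zero]
    have h2 : (⟨P.d n 0, ⟨0, rfl⟩⟩ : LinearMap.range (P.d n)) = 0 := Subtype.ext (map_zero _)
    exact (congrArg f.hom h2).trans (map_zero f.hom)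
  rw [this]
  exact P.syzygies.extOfHom_comp_eq_zero n _

end FreeResolution

end Ring

/-! ### Consequences of regularity for the spaces `R_n` -/

namespace QuadraticData

variable {k : Type u} [Field k] {V : Type u} [AddCommGroup V] [Module k V] (D : QuadraticData k V)

/-- The inclusion `R_{a+b} ⊆ R_a ⊗ R_b`, for all `a`, `b`. -/
noncomputable def split (a b : ℕ) : D.R (a + b) →ₗ[k] D.R a ⊗[k] D.R b :=
  (D.linearDisjoint_R a b).mulMap.symm.toLinearMap ∘ₗ
    Submodule.inclusion (D.R_add_le_of_nonneg a b)

lemma mulMap_split (a b : ℕ) (x : D.R (a + b)) :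
    Submodule.mulMap (D.R a) (D.R b) (D.split a b x) = x := by
  have := (D.linearDisjoint_R a b).mulMap.apply_symm_apply
    (Submodule.inclusion (D.R_add_le_of_nonneg a b) x)
  exact congrArg Subtype.val this

lemma mulMap_injective (a b : ℕ) : Function.Injective (Submodule.mulMap (D.R a) (D.R b)) :=
  (D.linearDisjoint_R a b).injective

lemma split_eq_incl {a b : ℕ} (ha : 0 < a) (hb : 0 < b) : D.split a b = D.incl ha hb := rfl

lemma split_eq_iff {a b : ℕ} {x : D.R (a + b)} {t : D.R a ⊗[k] D.R b} :
    D.split a b x = t ↔ Submodule.mulMap (D.R a) (D.R b) t = x := by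
  rw [← (D.mulMap_injective a b).eq_iff, mulMap_split, eq_comm]

/-- The left ideal generated by `V` is the kernel of an algebra homomorphism, hence two-sided;
therefore `V` acts by zero on the trivial module. -/
lemma mem_augIdeal_iff {a : D.A} : a ∈ D.augIdeal ↔ D.aug a = 0 := by
  refine ⟨D.aug_of_mem_augIdeal, fun h => ?_⟩
  have key : ∀ a : D.A, a - algebraMap k D.A (D.aug a) ∈ D.augIdeal := by
    intro a
    obtain ⟨t, rfl⟩ := D.proj_surjective a
    induction t using TensorAlgebra.induction with
    | algebraMap c => simp
    | ι v =>
      rw [proj_ι, aug_gen, map_zero, sub_zero]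
      exact Ideal.subset_span ⟨v, rfl⟩
    | add x y hx hy =>
      have := D.augIdeal.add_mem hx hy
      convert this using 1
      rw [map_add, map_add, map_add, add_sub_add_comm]
    | mul x y hx hy =>
      have := D.augIdeal.add_mem (D.augIdeal.mul_mem_left (D.proj x) hy)
        (D.augIdeal.mul_mem_left (algebraMap k D.A (D.aug (D.proj y))) hx)
      convert this using 1
      rw [map_mul D.proj, map_mul D.aug, mul_comm (D.aug _), map_mul (algebraMap k D.A), mul_sub,
        mul_sub, Algebra.commutes (D.aug (D.proj y)) (D.proj x), sub_add_sub_cancel]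
  simpa [h] using key a

lemma gen_mul_mem_augIdeal (v : V) (a : D.A) : D.gen v * a ∈ D.augIdeal := by
  rw [mem_augIdeal_iff, map_mul, aug_gen, zero_mul]

variable {D}

namespace LinearResolution

variable (P : D.LinearResolution)

/-- A linear resolution as a free resolution. -/
noncomputable def toFreeResolution : FreeResolution D.A where
  N := D.A ⧸ D.augIdeal
  Q := P.Q
  d := P.d
  ε := D.augIdeal.mkQ ∘ₗ Finsupp.lapply P.unique.default
  ε_surjective := by
    intro x
    obtain ⟨a, rfl⟩ := D.augIdeal.mkQ_surjective x
    exact ⟨Finsupp.single P.unique.default a, by simp⟩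
  exact_zero x := by
    refine Iff.trans ?_ (P.exact_zero x).symm
    exact Submodule.Quotient.mk_eq_zero _
  exact := P.exact

lemma map_d_single (n : ℕ) (i : P.Q (n + 1)) {Y : Type*} [AddCommGroup Y] [Module D.A Y]
    (f : (P.Q n →₀ D.A) →ₗ[D.A] Y) : f (P.d n (Finsupp.single i 1)) =
      (P.coeff n i).sum fun j v => D.gen v • f (Finsupp.single j 1) := by
  have h : ∀ y : P.Q n →₀ D.A, f y = y.sum fun j a => a • f (Finsupp.single j 1) := by
    intro y
    conv_lhs => rw [← Finsupp.sum_single y, map_finsuppSum]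
    refine Finsupp.sum_congr fun j _ => ?_
    rw [← map_smul, Finsupp.smul_single, smul_eq_mul, mul_one]
  rw [h, ← P.mapRange_coeff, Finsupp.sum_mapRange_index]
  intro j
  rw [zero_smul]

/-- The basis of `R_n` that a linear resolution provides. -/
noncomputable def basisR (n : ℕ) : Module.Basis (P.Q n) k (D.R n) :=
  (Module.Basis.span (P.isBase n).1).map (LinearEquiv.ofEq _ _ (P.isBase n).2)

lemma coe_basisR (n : ℕ) (i : P.Q n) : (P.basisR n i : TensorAlgebra k V) = P.base n i := by
  rw [basisR, Module.Basis.map_apply, LinearEquiv.coe_ofEq_apply, Module.Basis.span_apply]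

lemma base_add_one_mem (n : ℕ) (i : P.Q (n + 1)) : P.base (n + 1) i ∈ D.R (1 + n) := by
  rw [add_comm, ← P.coe_basisR]
  exact Subtype.property _

/-- The matrix of the differential is the comultiplication `R_{n+1} → V ⊗ R_n` in the chosen bases.
This translates statements about cocycles into statements about contractions. -/
lemma split_base (n : ℕ) (i : P.Q (n + 1)) :
    D.split 1 n ⟨P.base (n + 1) i, P.base_add_one_mem n i⟩ =
      (P.coeff n i).sum fun j v =>
        (⟨TensorAlgebra.ι k v, LinearMap.mem_range_self _ _⟩ : D.R 1) ⊗ₜ P.basisR n j := by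
  rw [split_eq_iff, map_finsuppSum]
  change _ = Finsupp.linearCombination _ _ _
  rw [Finsupp.linearCombination_apply,
    Finsupp.sum_mapRange_index (by simp)]
  refine Finsupp.sum_congr fun j _ => ?_
  rw [Submodule.mulMap_tmul, coe_basisR, smul_eq_mul]

end LinearResolution

lemma rank_of_isEmpty (P : D.LinearResolution) {n : ℕ} (h : IsEmpty (P.Q n)) : D.R n = ⊥ := by
  have := (P.basisR n).repr.toEquiv.subsingleton
  exact (Submodule.subsingleton_iff_eq_bot).1 this

lemma R_eq_bot_of_le {m n : ℕ} (h : D.R m = ⊥) (hmn : m ≤ n) : D.R n = ⊥ := by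
  obtain ⟨c, rfl⟩ := Nat.exists_eq_add_of_le hmn
  have := D.R_add_le_of_nonneg m c
  rwa [h, Submodule.bot_mul, le_bot_iff] at this

namespace LinearResolution

variable (P : D.LinearResolution)

lemma aug_comp_d (n : ℕ) (i : P.Q (n + 1)) (g : (P.Q n →₀ D.A) →ₗ[D.A] D.A) :
    D.aug (g (P.d n (Finsupp.single i 1))) = 0 := by
  rw [P.map_d_single, map_finsuppSum]
  refine Finset.sum_eq_zero fun j _ => ?_
  exact (map_mul D.aug (D.gen _) _).trans ((congrArg (· * _) (D.aug_gen _)).trans (zero_mul _))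

lemma comp_d_triv (n : ℕ) (i : P.Q (n + 1)) (g : (P.Q n →₀ D.A) →ₗ[D.A] D.A ⧸ D.augIdeal) :
    g (P.d n (Finsupp.single i 1)) = 0 := by
  rw [P.map_d_single]
  refine Finset.sum_eq_zero fun j _ => ?_
  obtain ⟨a, ha⟩ := D.augIdeal.mkQ_surjective (g (Finsupp.single j 1))
  change D.gen _ • g (Finsupp.single j 1) = 0
  rw [← ha, ← map_smul]
  exact (Submodule.Quotient.mk_eq_zero _).2 (D.gen_mul_mem_augIdeal _ a)

end LinearResolution

variable {d : ℕ}

/-- Maps from the resolution to `k` have zero differential by minimality, so each generator in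
degree `d + 1` yields a nonzero class in `Ext^{d+1}(k, k)`; this group vanishes as the global
dimension is `d`. -/
lemma isEmpty_of_isASRegular (P : D.LinearResolution) (h : D.IsASRegular d) :
    IsEmpty (P.Q (d + 1)) := by
  by_contra hne
  rw [not_isEmpty_iff] at hne
  obtain ⟨i⟩ := hne
  have hpd := h.1.1 D.triv
  have hs : Subsingleton (Abelian.Ext.{u} (ModuleCat.of D.A P.toFreeResolution.N)
      (ModuleCat.of D.A (D.A ⧸ D.augIdeal)) (d + 1)) :=
    HasProjectiveDimensionLT.subsingleton D.triv (d + 1) (d + 1) le_rfl D.triv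
  let f : (P.Q (d + 1) →₀ D.A) →ₗ[D.A] D.A ⧸ D.augIdeal := D.augIdeal.mkQ ∘ₗ Finsupp.lapply i
  have hf : f ∘ₗ P.d (d + 1) = 0 := by
    ext j
    exact P.comp_d_triv (d + 1) j f
  obtain ⟨g, hg⟩ := P.toFreeResolution.exists_of_subsingleton_ext hs hf
  have h1 := LinearMap.congr_fun hg (Finsupp.single i 1)
  have h2 : g (P.d d (Finsupp.single i 1)) = 0 := P.comp_d_triv d i g
  have h3 : f (Finsupp.single i 1) = 0 := h1.symm.trans h2
  have h4 : D.augIdeal.mkQ (1 : D.A) = 0 := by simpa [f] using h3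
  have h5 := D.aug_of_mem_augIdeal ((Submodule.Quotient.mk_eq_zero _).1 h4)
  rw [map_one] at h5
  exact one_ne_zero h5

/-- Nothing follows degree `d`, so all coordinate functions there are cocycles with values in `A`.
Coboundaries take values of augmentation `0` on the generators, so two distinct coordinates would be
independent in `Ext^d(k, A)`, a line. -/
lemma finrank_of_isASRegular (P : D.LinearResolution) (hd : 0 < d) (h : D.IsASRegular d) :
    Module.finrank k (D.R d) = 1 := by
  have hempty := isEmpty_of_isASRegular P h
  obtain ⟨d, rfl⟩ : ∃ d', d = d' + 1 := ⟨d - 1, by omega⟩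
  have hE : Module.finrank k (Abelian.Ext.{u} (ModuleCat.of D.A P.toFreeResolution.N)
      (ModuleCat.of D.A D.A) (d + 1)) = 1 := h.2.2
  have hne : Nonempty (P.Q (d + 1)) := P.toFreeResolution.exists_not_of_finrank_ext hE
  have hsub : Subsingleton (P.Q (d + 1)) := by
    refine ⟨fun i j => by_contra fun hij => ?_⟩
    have hf : ∀ f : (P.Q (d + 1) →₀ D.A) →ₗ[D.A] D.A, f ∘ₗ P.d (d + 1) = 0 := by
      intro f
      ext j
      exact hempty.elim j
    obtain ⟨c₁, c₂, g, hc, hg⟩ := P.toFreeResolution.exists_of_finrank_ext hE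
      (hf (Finsupp.lapply i)) (hf (Finsupp.lapply j))
    have h1 := (congrArg D.aug (hg (Finsupp.single i 1))).symm.trans (P.aug_comp_d d i g)
    have h2 := (congrArg D.aug (hg (Finsupp.single j 1))).symm.trans (P.aug_comp_d d j g)
    have e1 : ∀ i : P.Q (d + 1), (Finsupp.single i (1 : D.A)) i = 1 := fun i => by simp
    have e2 : (Finsupp.single i (1 : D.A)) j = 0 := by simp [hij]
    have e3 : (Finsupp.single j (1 : D.A)) i = 0 := by simp [Ne.symm hij]
    have h3 : D.aug (algebraMap k D.A c₁ * (Finsupp.single i (1 : D.A)) i +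
      algebraMap k D.A c₂ * (Finsupp.single i (1 : D.A)) j) = 0 := h1
    have h4 : D.aug (algebraMap k D.A c₁ * (Finsupp.single j (1 : D.A)) i +
      algebraMap k D.A c₂ * (Finsupp.single j (1 : D.A)) j) = 0 := h2
    rw [e1, e2, mul_one, mul_zero, add_zero, AlgHom.commutes] at h3
    rw [e1, e3, mul_one, mul_zero, zero_add, AlgHom.commutes] at h4
    rcases hc with hc | hc
    · exact hc h3
    · exact hc h4
  have : Unique (P.Q (d + 1)) := @Unique.mk' _ ⟨hne.some⟩ hsub
  rw [Module.finrank_eq_card_basis (P.basisR (d + 1)), Fintype.card_unique]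

/-- The hypothesis says that the scalar-valued function `f` defined by `ξ` on the basis is a
cocycle. As `Ext^i(k, A) = 0`, it is a coboundary; so its values have augmentation `0`, and being
scalars they vanish. -/
lemma eq_zero_of_contract_split (P : D.LinearResolution) (h : D.IsASRegular d) {i : ℕ}
    (hi : 0 < i) (hid : i < d) {ξ : Module.Dual k (D.R i)}
    (hξ : ∀ x, TensorProduct.rid k (D.R 1) (LinearMap.lTensor (D.R 1) ξ (D.split 1 i x)) = 0) :
    ξ = 0 := by
  obtain ⟨i, rfl⟩ : ∃ i', i = i' + 1 := ⟨i - 1, by omega⟩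
  have hE : Subsingleton (Abelian.Ext.{u} (ModuleCat.of D.A P.toFreeResolution.N)
      (ModuleCat.of D.A D.A) (i + 1)) := h.2.1 (i + 1) (by omega)
  let f : (P.Q (i + 1) →₀ D.A) →ₗ[D.A] D.A :=
    Finsupp.linearCombination D.A fun j => algebraMap k D.A (ξ (P.basisR (i + 1) j))
  have hfs : ∀ j, f (Finsupp.single j 1) = algebraMap k D.A (ξ (P.basisR (i + 1) j)) := by
    intro j
    rw [Finsupp.linearCombination_single, one_smul]
  have hf : f ∘ₗ P.d (i + 1) = 0 := by
    ext j
    change f (P.d (i + 1) (Finsupp.single j 1)) = 0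
    rw [P.map_d_single]
    have h1 := hξ ⟨P.base (i + 1 + 1) j, P.base_add_one_mem (i + 1) j⟩
    rw [P.split_base, map_finsuppSum, map_finsuppSum] at h1
    have h2 : ((P.coeff (i + 1) j).sum fun l v => ξ (P.basisR (i + 1) l) • v) = 0 := by
      apply (TensorAlgebra.ι_leftInverse (R := k) (M := V)).injective
      rw [map_finsuppSum, map_zero]
      have h3 := congrArg Subtype.val h1
      rw [Submodule.coe_zero, Finsupp.sum, AddSubmonoidClass.coe_finsetSum] at h3
      rw [← h3]
      refine Finset.sum_congr rfl fun l _ => ?_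
      simp
    have h4 := congrArg D.gen h2
    rw [map_finsuppSum, map_zero] at h4
    rw [← h4]
    refine Finset.sum_congr rfl fun l _ => ?_
    refine (congrArg (D.gen _ * ·) (hfs l)).trans ?_
    change _ = D.gen (_ • _)
    rw [map_smul, Algebra.smul_def, Algebra.commutes]
  obtain ⟨g, hg⟩ := P.toFreeResolution.exists_of_subsingleton_ext hE hf
  refine (P.basisR (i + 1)).ext fun j => ?_
  have h1 := congrArg D.aug (LinearMap.congr_fun hg (Finsupp.single j 1))
  have h2 := h1.symm.trans (P.aug_comp_d i j g)
  exact ((D.aug.commutes _).symm.trans (congrArg D.aug (hfs j)).symm).trans h2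

end QuadraticData

/-! ### Contractions on `TV` by functionals on the `R_a` -/

section Tensor

variable {k : Type u} [Field k] {V : Type u} [AddCommGroup V] [Module k V]

/-- A relation with coefficients in `TV` splits into its homogeneous components, each of which is a
relation between `V^a` and some `V^n`. -/
lemma linearDisjoint_pow_top (a : ℕ) :
    (gens k V ^ a).LinearDisjoint (⊤ : Submodule k (TensorAlgebra k V)) := by
  let b := Module.Basis.ofVectorSpace k ↥(gens k V ^ a)
  refine Submodule.LinearDisjoint.of_basis_left _ _ b ?_
  rw [LinearMap.ker_eq_bot']
  intro f hf
  ext i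
  rw [Submodule.mulLeftMap_apply] at hf
  rw [Finsupp.zero_apply, Submodule.coe_zero]
  have key : ∀ n, (QuadraticData.comp n (f i : TensorAlgebra k V)) = 0 := by
    intro n
    let g : _ →₀ ↥(gens k V ^ n) := f.mapRange
      (fun x : ↥(⊤ : Submodule k (TensorAlgebra k V)) =>
        ⟨QuadraticData.comp n (x : TensorAlgebra k V), QuadraticData.comp_mem n _⟩)
      (Subtype.ext (map_zero _))
    have h1 := (linearDisjoint_pow (k := k) (V := V) a n).linearIndependent_left_of_flat
      b.linearIndependent
    rw [LinearMap.ker_eq_bot'] at h1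
    have h2 : g = 0 := by
      apply h1
      rw [Submodule.mulLeftMap_apply, Finsupp.sum_mapRange_index (by simp)]
      have h3 := congrArg (QuadraticData.comp (a + n)) hf
      rw [map_zero, map_finsuppSum] at h3
      rw [← h3]
      refine Finsupp.sum_congr fun j _ => ?_
      exact (DirectSum.coe_decompose_mul_add_of_left_mem (fun i : ℕ => gens k V ^ i)
        (b j).2).symm
    exact congrArg Subtype.val (DFunLike.congr_fun h2 i)
  classical
  rw [← DirectSum.sum_support_decompose (fun i : ℕ => gens k V ^ i) (f i : TensorAlgebra k V)]
  exact Finset.sum_eq_zero fun n _ => key n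

lemma linearDisjoint_top_pow (a : ℕ) :
    (⊤ : Submodule k (TensorAlgebra k V)).LinearDisjoint (gens k V ^ a) := by
  let b := Module.Basis.ofVectorSpace k ↥(gens k V ^ a)
  refine Submodule.LinearDisjoint.of_basis_right _ _ b ?_
  rw [LinearMap.ker_eq_bot']
  intro f hf
  ext i
  rw [Submodule.mulRightMap_apply] at hf
  rw [Finsupp.zero_apply, Submodule.coe_zero]
  have key : ∀ n, (QuadraticData.comp n (f i : TensorAlgebra k V)) = 0 := by
    intro n
    let g : _ →₀ ↥(gens k V ^ n) := f.mapRange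
      (fun x : ↥(⊤ : Submodule k (TensorAlgebra k V)) =>
        ⟨QuadraticData.comp n (x : TensorAlgebra k V), QuadraticData.comp_mem n _⟩)
      (Subtype.ext (map_zero _))
    have h1 := (linearDisjoint_pow (k := k) (V := V) n a).linearIndependent_right_of_flat
      b.linearIndependent
    rw [LinearMap.ker_eq_bot'] at h1
    have h2 : g = 0 := by
      apply h1
      rw [Submodule.mulRightMap_apply, Finsupp.sum_mapRange_index (by simp)]
      have h3 := congrArg (QuadraticData.comp (n + a)) hf
      rw [map_zero, map_finsuppSum] at h3
      rw [← h3]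
      refine Finsupp.sum_congr fun j _ => ?_
      exact (DirectSum.coe_decompose_mul_add_of_right_mem (fun i : ℕ => gens k V ^ i)
        (b j).2).symm
    exact congrArg Subtype.val (DFunLike.congr_fun h2 i)
  classical
  rw [← DirectSum.sum_support_decompose (fun i : ℕ => gens k V ^ i) (f i : TensorAlgebra k V)]
  exact Finset.sum_eq_zero fun n _ => key n

namespace QuadraticData

variable (D : QuadraticData k V)

lemma linearDisjoint_R_top (a : ℕ) :
    (D.R a).LinearDisjoint (⊤ : Submodule k (TensorAlgebra k V)) :=
  (linearDisjoint_pow_top a).of_le_left_of_flat (D.R_le a)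

lemma linearDisjoint_top_R (a : ℕ) :
    (⊤ : Submodule k (TensorAlgebra k V)).LinearDisjoint (D.R a) :=
  (linearDisjoint_top_pow a).of_le_right_of_flat (D.R_le a)

variable {D}

/-- On `R_a · TV`, which is `R_a ⊗ TV`, the contraction is prescribed. Elsewhere it depends on the
projection `π`, so every later rule about `lcon` needs membership in this subspace. Having one map
on all of `TV` avoids transport between tensor products. -/
lemma exists_leftContract (D : QuadraticData k V) (a : ℕ) :
    ∃ L : Module.Dual k (D.R a) →ₗ[k] TensorAlgebra k V →ₗ[k] TensorAlgebra k V,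
      ∀ ξ (p : D.R a) (w : TensorAlgebra k V), L ξ (p * w) = ξ p • w := by
  let e := (D.linearDisjoint_R_top a).mulMap
  obtain ⟨π, hπ⟩ := LinearMap.exists_extend
    (LinearMap.id : ↥(D.R a * (⊤ : Submodule k (TensorAlgebra k V))) →ₗ[k] _)
  refine ⟨LinearMap.mk₂ k (fun ξ x => ((TensorProduct.lid k _ (LinearMap.rTensor
    ↥(⊤ : Submodule k (TensorAlgebra k V)) ξ (e.symm (π x))) : ↥(⊤ : Submodule k _)) :
      TensorAlgebra k V)) ?_ ?_ ?_ ?_, fun ξ p w => ?_⟩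
  · intro ξ η x
    rw [LinearMap.rTensor_add, LinearMap.add_apply, map_add, Submodule.coe_add]
  · intro c ξ x
    rw [LinearMap.rTensor_smul, LinearMap.smul_apply, map_smul, Submodule.coe_smul]
  · intro ξ x y
    rw [map_add, map_add, map_add, map_add, Submodule.coe_add]
  · intro c ξ x
    rw [map_smul, map_smul, map_smul, map_smul, Submodule.coe_smul]
  · have h : π (p * w) = e (p ⊗ₜ ⟨w, trivial⟩) :=
      LinearMap.congr_fun hπ (e (p ⊗ₜ ⟨w, trivial⟩))
    rw [LinearMap.mk₂_apply, h, e.symm_apply_apply]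
    simp

lemma exists_rightContract (D : QuadraticData k V) (a : ℕ) :
    ∃ L : Module.Dual k (D.R a) →ₗ[k] TensorAlgebra k V →ₗ[k] TensorAlgebra k V,
      ∀ ξ (p : D.R a) (w : TensorAlgebra k V), L ξ (w * p) = ξ p • w := by
  let e := (D.linearDisjoint_top_R a).mulMap
  obtain ⟨π, hπ⟩ := LinearMap.exists_extend
    (LinearMap.id : ↥((⊤ : Submodule k (TensorAlgebra k V)) * D.R a) →ₗ[k] _)
  refine ⟨LinearMap.mk₂ k (fun ξ x => ((TensorProduct.rid k _ (LinearMap.lTensor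
    ↥(⊤ : Submodule k (TensorAlgebra k V)) ξ (e.symm (π x))) : ↥(⊤ : Submodule k _)) :
      TensorAlgebra k V)) ?_ ?_ ?_ ?_, fun ξ p w => ?_⟩
  · intro ξ η x
    rw [LinearMap.lTensor_add, LinearMap.add_apply, map_add, Submodule.coe_add]
  · intro c ξ x
    rw [LinearMap.lTensor_smul, LinearMap.smul_apply, map_smul, Submodule.coe_smul]
  · intro ξ x y
    rw [map_add, map_add, map_add, map_add, Submodule.coe_add]
  · intro c ξ x
    rw [map_smul, map_smul, map_smul, map_smul, Submodule.coe_smul]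
  · have h : π (w * p) = e (⟨w, trivial⟩ ⊗ₜ p) :=
      LinearMap.congr_fun hπ (e (⟨w, trivial⟩ ⊗ₜ p))
    rw [LinearMap.mk₂_apply, h, e.symm_apply_apply]
    simp

/-- The left contraction `pw ↦ ξ(p)w`, `p ∈ R_a`, extended to a linear map `TV → TV`. -/
noncomputable def lcon {a : ℕ} :
    Module.Dual k (D.R a) →ₗ[k] TensorAlgebra k V →ₗ[k] TensorAlgebra k V :=
  (exists_leftContract D a).choose

/-- The right contraction `wp ↦ ξ(p)w`, `p ∈ R_a`, extended to a linear map `TV → TV`. -/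
noncomputable def rcon {a : ℕ} :
    Module.Dual k (D.R a) →ₗ[k] TensorAlgebra k V →ₗ[k] TensorAlgebra k V :=
  (exists_rightContract D a).choose

lemma lcon_mul {a : ℕ} (ξ : Module.Dual k (D.R a)) (p : D.R a) (w : TensorAlgebra k V) :
    lcon ξ (p * w) = ξ p • w := (exists_leftContract D a).choose_spec ξ p w

lemma rcon_mul {a : ℕ} (ξ : Module.Dual k (D.R a)) (p : D.R a) (w : TensorAlgebra k V) :
    rcon ξ (w * p) = ξ p • w := (exists_rightContract D a).choose_spec ξ p w

lemma lcon_coe {a : ℕ} (ξ : Module.Dual k (D.R a)) (p : D.R a) :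
    lcon ξ (p : TensorAlgebra k V) = algebraMap k _ (ξ p) := by
  rw [← mul_one (p : TensorAlgebra k V), lcon_mul, Algebra.algebraMap_eq_smul_one]

lemma rcon_coe {a : ℕ} (ξ : Module.Dual k (D.R a)) (p : D.R a) :
    rcon ξ (p : TensorAlgebra k V) = algebraMap k _ (ξ p) := by
  rw [← one_mul (p : TensorAlgebra k V), rcon_mul, Algebra.algebraMap_eq_smul_one]

lemma lcon_mulMap {a b : ℕ} (ξ : Module.Dual k (D.R a)) (t : D.R a ⊗[k] D.R b) :
    lcon ξ (Submodule.mulMap (D.R a) (D.R b) t) =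
      (TensorProduct.lid k (D.R b) (LinearMap.rTensor (D.R b) ξ t) : D.R b) := by
  induction t with
  | zero => simp
  | tmul x y => simp [lcon_mul]
  | add x y hx hy => simp only [map_add, hx, hy, Submodule.coe_add]

lemma rcon_mulMap {a b : ℕ} (ξ : Module.Dual k (D.R b)) (t : D.R a ⊗[k] D.R b) :
    rcon ξ (Submodule.mulMap (D.R a) (D.R b) t) =
      (TensorProduct.rid k (D.R a) (LinearMap.lTensor (D.R a) ξ t) : D.R a) := by
  induction t with
  | zero => simp
  | tmul x y => simp [rcon_mul]
  | add x y hx hy => simp only [map_add, hx, hy, Submodule.coe_add]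

lemma lcon_mem_of_mem_mul {a : ℕ} (ξ : Module.Dual k (D.R a)) {W : Submodule k (TensorAlgebra k V)}
    {x : TensorAlgebra k V} (hx : x ∈ D.R a * W) : lcon ξ x ∈ W := by
  induction hx using Submodule.mul_induction_on' with
  | mem_mul_mem p hp w hw =>
    rw [lcon_mul ξ ⟨p, hp⟩]
    exact W.smul_mem _ hw
  | add x _ y _ hx hy => rw [map_add]; exact W.add_mem hx hy

lemma rcon_mem_of_mem_mul {a : ℕ} (ξ : Module.Dual k (D.R a)) {W : Submodule k (TensorAlgebra k V)}
    {x : TensorAlgebra k V} (hx : x ∈ W * D.R a) : rcon ξ x ∈ W := by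
  induction hx using Submodule.mul_induction_on' with
  | mem_mul_mem w hw p hp =>
    rw [rcon_mul ξ ⟨p, hp⟩]
    exact W.smul_mem _ hw
  | add x _ y _ hx hy => rw [map_add]; exact W.add_mem hx hy

lemma lcon_mem {a b n : ℕ} (ξ : Module.Dual k (D.R a)) (h : a + b = n) {x : TensorAlgebra k V}
    (hx : x ∈ D.R n) : lcon ξ x ∈ D.R b :=
  lcon_mem_of_mem_mul ξ (D.R_add_le_of_nonneg a b (by rwa [h]))

lemma rcon_mem {a b n : ℕ} (ξ : Module.Dual k (D.R b)) (h : a + b = n) {x : TensorAlgebra k V}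
    (hx : x ∈ D.R n) : rcon ξ x ∈ D.R a :=
  rcon_mem_of_mem_mul ξ (D.R_add_le_of_nonneg a b (by rwa [h]))

lemma mem_R_mul_top {a n : ℕ} (h : a ≤ n) {x : TensorAlgebra k V} (hx : x ∈ D.R n) :
    x ∈ D.R a * (⊤ : Submodule k (TensorAlgebra k V)) := by
  obtain ⟨b, rfl⟩ := Nat.exists_eq_add_of_le h
  exact (mul_le_mul' le_rfl le_top : D.R a * D.R b ≤ _) (D.R_add_le_of_nonneg a b hx)

lemma mem_top_mul_R {a n : ℕ} (h : a ≤ n) {x : TensorAlgebra k V} (hx : x ∈ D.R n) :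
    x ∈ (⊤ : Submodule k (TensorAlgebra k V)) * D.R a := by
  obtain ⟨b, rfl⟩ := Nat.exists_eq_add_of_le' h
  exact (mul_le_mul' le_top le_rfl : D.R b * D.R a ≤ _) (D.R_add_le_of_nonneg b a hx)

lemma lcon_mul_of_mem {a : ℕ} (ξ : Module.Dual k (D.R a)) {x : TensorAlgebra k V}
    (hx : x ∈ D.R a * (⊤ : Submodule k (TensorAlgebra k V))) (w : TensorAlgebra k V) :
    lcon ξ (x * w) = lcon ξ x * w := by
  induction hx using Submodule.mul_induction_on' with
  | mem_mul_mem p hp y hy =>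
    rw [mul_assoc, lcon_mul ξ ⟨p, hp⟩, lcon_mul ξ ⟨p, hp⟩, smul_mul_assoc]
  | add x _ y _ hx hy => rw [add_mul, map_add, map_add, add_mul, hx, hy]

lemma rcon_mul_of_mem {a : ℕ} (ξ : Module.Dual k (D.R a)) {x : TensorAlgebra k V}
    (hx : x ∈ (⊤ : Submodule k (TensorAlgebra k V)) * D.R a) (w : TensorAlgebra k V) :
    rcon ξ (w * x) = w * rcon ξ x := by
  induction hx using Submodule.mul_induction_on' with
  | mem_mul_mem y hy p hp =>
    rw [← mul_assoc, rcon_mul ξ ⟨p, hp⟩, rcon_mul ξ ⟨p, hp⟩, mul_smul_comm]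
  | add x _ y _ hx hy => rw [mul_add, map_add, map_add, mul_add, hx, hy]

/-- The contractions act on disjoint ends of the tensor, which is where `a + b ≤ n` enters. -/
lemma rcon_lcon {a b n : ℕ} (ξ : Module.Dual k (D.R a)) (η : Module.Dual k (D.R b)) (h : a + b ≤ n)
    {x : TensorAlgebra k V} (hx : x ∈ D.R n) : rcon η (lcon ξ x) = lcon ξ (rcon η x) := by
  obtain ⟨c, rfl⟩ := Nat.exists_eq_add_of_le h
  rw [add_assoc] at hx
  replace hx := D.R_add_le_of_nonneg _ _ hx
  induction hx using Submodule.mul_induction_on' with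
  | mem_mul_mem p hp y hy =>
    rw [lcon_mul ξ ⟨p, hp⟩, map_smul, rcon_mul_of_mem η (mem_top_mul_R (by omega) hy),
      lcon_mul ξ ⟨p, hp⟩]
  | add x _ y _ ihx ihy => rw [map_add, map_add, map_add, map_add, ihx, ihy]

variable [FiniteDimensional k V]

instance finiteDimensional_R (n : ℕ) : FiniteDimensional k (D.R n) := by
  have h1 : (gens k V ^ n).FG := Submodule.FG.pow (Module.Finite.iff_fg.1 inferInstance) n
  have : Module.Finite k ↥(gens k V ^ n) := Module.Finite.iff_fg.2 h1
  exact Submodule.finiteDimensional_of_le (D.R_le n)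

end QuadraticData

end Tensor

/-! ### Nondegeneracy of `ω` and the resulting pairings -/

namespace QuadraticData

variable {k : Type u} [Field k] {V : Type u} [AddCommGroup V] [Module k V] {D : QuadraticData k V}
  {d : ℕ}

/-- The properties of `ω ∈ R_d` on which the definition of the functor `M` depends. -/
structure IsFrobenius (ω : D.R d) : Prop where
  ne_zero : ω ≠ 0
  finrank : Module.finrank k (D.R d) = 1
  eq_bot : ∀ n, d < n → D.R n = ⊥
  eq_zero : ∀ {a b : ℕ} (_ : a + b = d) (ξ : Module.Dual k (D.R b)),
    rcon ξ (ω : TensorAlgebra k V) = 0 → ξ = 0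

lemma eq_zero_of_rcon_eq_zero (P : D.LinearResolution) (h : D.IsASRegular d) {i : ℕ}
    (hi : 0 < i) (hid : i < d) {ξ : Module.Dual k (D.R i)}
    (hξ : ∀ x ∈ D.R (1 + i), rcon ξ x = 0) : ξ = 0 := by
  refine eq_zero_of_contract_split P h hi hid fun x => Subtype.ext ?_
  rw [← rcon_mulMap, mulMap_split, hξ _ x.2, Submodule.coe_zero]

/-- On `R_{1+n} ⊆ V ⊗ R_n` the contraction by `ξ` concerns the second factor only, as `b ≤ n`. It
vanishes there as a map to `V ⊗ TV`, so it still vanishes after any functional `η` is applied. -/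
lemma rcon_functional {b n : ℕ} {ξ : Module.Dual k (D.R b)}
    (hb : b ≤ n) (hξ : ∀ x ∈ D.R (1 + n), rcon ξ x = 0) (η : Module.Dual k (TensorAlgebra k V)) :
    ∀ x ∈ D.R (1 + n), rcon (a := n) (η ∘ₗ rcon ξ ∘ₗ (D.R n).subtype) x = 0 := by
  intro x hx
  obtain ⟨x, rfl⟩ : ∃ x' : D.R (1 + n), (x' : TensorAlgebra k V) = x := ⟨⟨x, hx⟩, rfl⟩
  rw [← mulMap_split, rcon_mulMap]
  have h1 : LinearMap.lTensor (D.R 1) ((LinearMap.codRestrict ⊤ (rcon ξ) fun _ => trivial) ∘ₗ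
      (D.R n).subtype) (D.split 1 n x) = 0 := by
    apply (D.linearDisjoint_R_top 1).injective
    rw [map_zero, ← hξ x hx]
    conv_rhs => rw [← mulMap_split]
    generalize D.split 1 n x = s
    induction s with
    | zero => simp
    | tmul x y =>
      have : ((LinearMap.codRestrict ⊤ (rcon ξ) fun _ => trivial) (y : TensorAlgebra k V) :
        TensorAlgebra k V) = rcon ξ y := rfl
      simp [rcon_mul_of_mem ξ (mem_top_mul_R hb y.2), this]
    | add x y hx hy => simp only [map_add, hx, hy]
  have h2 := congrArg (fun z => TensorProduct.rid k (D.R 1)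
    (LinearMap.lTensor (D.R 1) (η ∘ₗ (⊤ : Submodule k (TensorAlgebra k V)).subtype) z)) h1
  rw [← LinearMap.comp_apply, ← LinearMap.lTensor_comp, map_zero, map_zero] at h2
  exact congrArg Subtype.val h2

lemma exists_smul_eq {ω : D.R d} (hω : ω ≠ 0) (hf : Module.finrank k (D.R d) = 1)
    {x : TensorAlgebra k V} (hx : x ∈ D.R d) : ∃ c : k, c • (ω : TensorAlgebra k V) = x := by
  obtain ⟨c, hc⟩ := exists_smul_eq_of_finrank_eq_one hf hω ⟨x, hx⟩
  exact ⟨c, congrArg Subtype.val hc⟩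

/-- If contraction by `ξ` kills `ω`, it kills `R_{a+b} = kω`, and regularity propagates this
downwards from `R_{m+1+b}` to `R_{m+b}`. At `m = 0` it says `ξ = 0`. -/
lemma isFrobenius (hK : D.IsKoszul) (hd : 0 < d) (h : D.IsASRegular d) {ω : D.R d} (hω : ω ≠ 0) :
    D.IsFrobenius ω := by
  obtain ⟨P⟩ := hK.nonempty_linearResolution
  have hf := finrank_of_isASRegular P hd h
  refine ⟨hω, hf, fun n hn => ?_, ?_⟩
  · exact R_eq_bot_of_le (rank_of_isEmpty P (isEmpty_of_isASRegular P h)) hn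
  intro a b hab ξ hξ
  have hinj := (algebraMap k (TensorAlgebra k V)).injective
  -- For `b = 0` contraction multiplies `ω` by the scalar `ξ(1)`; the vanishing of Ext is only
  -- available in positive degrees.
  rcases Nat.eq_zero_or_pos b with rfl | hb
  · ext ⟨x, hx⟩
    obtain ⟨c, rfl⟩ := Submodule.mem_one.1 hx
    have h1 := rcon_mul ξ ⟨1, Submodule.one_le.1 le_rfl⟩ (ω : TensorAlgebra k V)
    rw [mul_one, hξ] at h1
    have h2 : ξ ⟨1, Submodule.one_le.1 le_rfl⟩ = 0 :=
      (smul_eq_zero.1 h1.symm).resolve_right (by simpa using hω)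
    have h3 : (⟨algebraMap k _ c, hx⟩ : D.R 0) = c • ⟨1, Submodule.one_le.1 le_rfl⟩ :=
      Subtype.ext (Algebra.algebraMap_eq_smul_one c)
    rw [h3, map_smul, h2, smul_zero, LinearMap.zero_apply]
  have key : ∀ m ≤ a, ∀ x ∈ D.R (m + b), rcon ξ x = 0 := by
    intro m hm
    induction hm using Nat.decreasingInduction with
    | self =>
      intro x hx
      rw [hab] at hx
      obtain ⟨c, rfl⟩ := exists_smul_eq hω hf hx
      rw [map_smul, hξ, smul_zero]
    | of_succ m hm ih =>
      intro x hx
      rw [← Module.forall_dual_apply_eq_zero_iff k]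
      intro η
      -- It is enough that each functional `η` of the contraction vanishes on `R_{m+b}`; this
      -- composite is a functional whose contractions on `R_{1+m+b}` all vanish.
      have h1 := eq_zero_of_rcon_eq_zero P h (i := m + b) (by omega) (by omega)
        (rcon_functional (ξ := ξ) (n := m + b) (by omega)
          (by rwa [show 1 + (m + b) = m + 1 + b by omega]) η)
      exact LinearMap.congr_fun h1 ⟨x, hx⟩
  ext x
  have := key 0 (Nat.zero_le _) x (by rw [zero_add]; exact x.2)
  rw [rcon_coe] at this
  exact hinj (by rw [this, LinearMap.zero_apply, map_zero])

/-- The map `R_a^* → R_b`, `a + b = d`, given by the contraction of `ω`. -/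
noncomputable def dm (ω : D.R d) {a b : ℕ} (h : a + b = d) : Module.Dual k (D.R a) →ₗ[k] D.R b where
  toFun ξ := TensorProduct.lid k (D.R b)
    (LinearMap.rTensor (D.R b) ξ (D.split a b (D.castR h.symm ω)))
  map_add' ξ η := by rw [LinearMap.rTensor_add, LinearMap.add_apply, map_add]
  map_smul' c ξ := by rw [LinearMap.rTensor_smul, LinearMap.smul_apply, map_smul]; rfl

lemma coe_dm (ω : D.R d) {a b : ℕ} (h : a + b = d) (ξ : Module.Dual k (D.R a)) :
    (D.dm ω h ξ : TensorAlgebra k V) = lcon ξ (ω : TensorAlgebra k V) := by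
  change _ = lcon ξ (D.castR h.symm ω : TensorAlgebra k V)
  rw [← mulMap_split, lcon_mulMap]
  rfl

/-- The inverse of the map `R_b^* → R_a`. -/
noncomputable def fn (ω : D.R d) {a b : ℕ} (h : a + b = d) :
    D.R a →ₗ[k] Module.Dual k (D.R b) := linv (D.dm ω (show b + a = d by omega))

/-- The functional `⟨·, y⟩`. -/
noncomputable def fnR (ω : D.R d) {a b : ℕ} (h : a + b = d) :
    D.R b →ₗ[k] Module.Dual k (D.R a) := (D.fn ω h).flip

lemma fnR_apply (ω : D.R d) {a b : ℕ} (h : a + b = d) (x : D.R a) (y : D.R b) :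
    D.fnR ω h y x = D.fn ω h x y := rfl

variable {ω : D.R d}

namespace IsFrobenius

/-- The contraction of `ω` with functionals on the right. -/
noncomputable def rdm (ω : D.R d) {a b : ℕ} (h : a + b = d) :
    Module.Dual k (D.R b) →ₗ[k] D.R a :=
  ((rcon (a := b)).flip (ω : TensorAlgebra k V)).codRestrict (D.R a)
    fun ξ => rcon_mem ξ h ω.2

lemma coe_rdm {a b : ℕ} (h : a + b = d) (ξ : Module.Dual k (D.R b)) :
    (rdm ω h ξ : TensorAlgebra k V) = rcon ξ (ω : TensorAlgebra k V) := rfl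

lemma rdm_injective (hF : D.IsFrobenius ω) {a b : ℕ} (h : a + b = d) :
    Function.Injective (rdm ω h) := by
  rw [injective_iff_map_eq_zero]
  intro ξ hξ
  exact hF.eq_zero h ξ (congrArg Subtype.val hξ)

/-- Left and right contractions of `ω` are transposes of each other, so nondegeneracy on one side
gives it on the other. -/
lemma apply_dm {a b : ℕ} (h : a + b = d) (ξ : Module.Dual k (D.R a)) (η : Module.Dual k (D.R b)) :
    η (D.dm ω h ξ) = ξ (rdm ω h η) := by
  apply (algebraMap k (TensorAlgebra k V)).injective
  rw [← rcon_coe, ← lcon_coe, coe_dm, coe_rdm, rcon_lcon ξ η h.le ω.2]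

variable [FiniteDimensional k V]

/-- Contraction embeds `R_b^*` in `R_a` and, with the roles exchanged, `R_a^*` in `R_b`. -/
lemma finrank_eq (hF : D.IsFrobenius ω) {a b : ℕ} (h : a + b = d) :
    Module.finrank k (D.R a) = Module.finrank k (D.R b) := by
  have h1 := LinearMap.finrank_le_finrank_of_injective (hF.rdm_injective h)
  have h2 := LinearMap.finrank_le_finrank_of_injective (hF.rdm_injective (a := b) (b := a) (by omega))
  rw [Subspace.dual_finrank_eq] at h1 h2
  omega

lemma rdm_bijective (hF : D.IsFrobenius ω) {a b : ℕ} (h : a + b = d) :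
    Function.Bijective (rdm ω h) := by
  refine ⟨hF.rdm_injective h, ?_⟩
  refine (LinearMap.injective_iff_surjective_of_finrank_eq_finrank ?_).1 (hF.rdm_injective h)
  rw [Subspace.dual_finrank_eq, hF.finrank_eq h]

lemma dm_bijective (hF : D.IsFrobenius ω) {a b : ℕ} (h : a + b = d) :
    Function.Bijective (D.dm ω h) := by
  have h1 : Function.Injective (D.dm ω h) := by
    rw [injective_iff_map_eq_zero]
    intro ξ hξ
    ext x
    obtain ⟨η, rfl⟩ := (hF.rdm_bijective h).2 x
    rw [← apply_dm, hξ, map_zero, LinearMap.zero_apply]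
  refine ⟨h1, (LinearMap.injective_iff_surjective_of_finrank_eq_finrank ?_).1 h1⟩
  rw [Subspace.dual_finrank_eq, hF.finrank_eq h]

lemma fn_dm (hF : D.IsFrobenius ω) {a b : ℕ} (h : a + b = d) (ξ : Module.Dual k (D.R b)) :
    D.fn ω h (D.dm ω (by omega) ξ) = ξ := by
  rw [fn, linv, dif_pos (hF.dm_bijective _)]
  exact LinearEquiv.ofBijective_symm_apply_apply _ ξ

lemma dm_fn (hF : D.IsFrobenius ω) {a b : ℕ} (h : a + b = d) (x : D.R a) :
    D.dm ω (by omega) (D.fn ω h x) = x := by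
  obtain ⟨ξ, rfl⟩ := (hF.dm_bijective (show b + a = d by omega)).2 x
  rw [hF.fn_dm]

lemma lcon_fn (hF : D.IsFrobenius ω) {a b : ℕ} (h : a + b = d) (x : D.R a) :
    lcon (D.fn ω h x) (ω : TensorAlgebra k V) = x := by
  rw [← coe_dm ω (show b + a = d by omega), hF.dm_fn]

lemma fn_eq (hF : D.IsFrobenius ω) {a b : ℕ} (h : a + b = d) {x : D.R a} {ξ : Module.Dual k (D.R b)}
    (hx : lcon ξ (ω : TensorAlgebra k V) = x) : D.fn ω h x = ξ := by
  have : D.dm ω (by omega) ξ = x := Subtype.ext (by rw [coe_dm, hx])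
  rw [← this, hF.fn_dm]

lemma rcon_fnR (hF : D.IsFrobenius ω) {a b : ℕ} (h : a + b = d) (y : D.R b) :
    rcon (D.fnR ω h y) (ω : TensorAlgebra k V) = y := by
  rw [← coe_rdm (show b + a = d by omega)]
  congr 1
  rw [← sub_eq_zero, ← Module.forall_dual_apply_eq_zero_iff k]
  intro ξ
  rw [map_sub, ← apply_dm, fnR_apply, hF.fn_dm, sub_self]

/-- Contraction with `x·y` is contraction with `y`, followed by contraction with `x`. -/
lemma lcon_fn_lcon_fn (hF : D.IsFrobenius ω) {a a' b b' c c' : ℕ} (ha : a + a' = d) (hb : b + b' = d)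
    (hc : c + c' = d) (hc' : b' + a' = c') (x : D.R a) (y : D.R b) {z : D.R c}
    (hz : (z : TensorAlgebra k V) = lcon (D.fn ω ha x) (y : TensorAlgebra k V))
    {w : TensorAlgebra k V} (hw : w ∈ D.R c' * (⊤ : Submodule k (TensorAlgebra k V))) :
    lcon (D.fn ω ha x) (lcon (D.fn ω hb y) w) = lcon (D.fn ω hc z) w := by
  -- The composite of the two contractions is itself contraction with a functional `ξ` on `R_{c'}`.
  -- It is identified by its value at `ω`, where the inner contraction returns `y`.
  let ξ : Module.Dual k (D.R c') := (D.fn ω ha x) ∘ₗ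
    ((lcon (D.fn ω hb y) ∘ₗ (D.R c').subtype).codRestrict (D.R a')
      fun t => lcon_mem _ hc' t.2)
  have key : ∀ w ∈ D.R c' * (⊤ : Submodule k (TensorAlgebra k V)),
      lcon (D.fn ω ha x) (lcon (D.fn ω hb y) w) = lcon ξ w := by
    intro w hw
    induction hw using Submodule.mul_induction_on' with
    | mem_mul_mem p hp w _ =>
      rw [lcon_mul_of_mem _ (mem_R_mul_top (by omega) hp), lcon_mul ξ ⟨p, hp⟩]
      exact lcon_mul (D.fn ω ha x) ⟨_, lcon_mem _ hc' hp⟩ w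
    | add x _ y _ hx hy => simp only [map_add, hx, hy]
  rw [key w hw, hF.fn_eq hc (ξ := ξ)]
  rw [← key _ (mem_R_mul_top (by omega) ω.2), hF.lcon_fn, hz]

lemma fn_fn (hF : D.IsFrobenius ω) {a a' b b' c c' : ℕ} (ha : a + a' = d) (hb : b + b' = d)
    (hc : c + c' = d) (hc' : b' + a' = c') (x : D.R a) (y : D.R b) {z : D.R c}
    (hz : (z : TensorAlgebra k V) = lcon (D.fn ω ha x) (y : TensorAlgebra k V)) (t : D.R c') :
    algebraMap k (TensorAlgebra k V) (D.fn ω hc z t) =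
      lcon (D.fn ω ha x) (lcon (D.fn ω hb y) (t : TensorAlgebra k V)) := by
  rw [hF.lcon_fn_lcon_fn ha hb hc hc' x y hz (by
    rw [← mul_one (t : TensorAlgebra k V)]; exact Submodule.mul_mem_mul t.2 trivial), lcon_coe]

/-- Write `x` as a left contraction of `ω` and move the right contraction inside; there it turns `ω`
into `t`. -/
lemma rcon_fnR_eq (hF : D.IsFrobenius ω) {a b c e : ℕ} (hc : c + e = d) (hb : b + (e + a) = d)
    (x : D.R c) (t : D.R (e + a)) :
    rcon (D.fnR ω hb t) (x : TensorAlgebra k V) = lcon (D.fn ω hc x) (t : TensorAlgebra k V) := by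
  rw [← hF.lcon_fn hc x, rcon_lcon _ _ (by omega) ω.2, hF.rcon_fnR]

end IsFrobenius

end QuadraticData

/-! ### The spaces `M(u)` inside `TV`, and maps as graphs -/

namespace QuadraticData

variable {k : Type u} [Field k] {V : Type u} [AddCommGroup V] [Module k V] (D : QuadraticData k V)
  {d : ℕ}

/-- The multiplication `R_{a_1} ⊗ R_{a_2} ⊗ ⋯ → TV`. -/
noncomputable def evL : ∀ l : List ℕ, D.tens l →ₗ[k] TensorAlgebra k V
  | [] => Algebra.linearMap k (TensorAlgebra k V)
  | a :: l => TensorProduct.lift ((LinearMap.mul k (TensorAlgebra k V)).compl₁₂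
      (D.R a).subtype (evL l))

lemma tens_cons_induction {a : ℕ} {l : List ℕ} {p : D.tens (a :: l) → Prop} (zero : p 0)
    (tmul : ∀ (x : D.R a) (y : D.tens l), p (x ⊗ₜ[k] y : D.R a ⊗[k] D.tens l))
    (add : ∀ s t, p s → p t → p (s + t)) (t : D.tens (a :: l)) : p t :=
  TensorProduct.induction_on (motive := p) t zero tmul fun s t => add s t

lemma evL_cons (a : ℕ) (l : List ℕ) (x : D.R a) (y : D.tens l) :
    D.evL (a :: l) (x ⊗ₜ[k] y : D.R a ⊗[k] D.tens l) = x * D.evL l y := rfl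

/-- `R_a` is linearly disjoint from all of `TV`, so an injective multiplication on the tail stays
injective after tensoring with `R_a`. -/
lemma evL_injective : ∀ l, Function.Injective (D.evL l)
  | [] => (algebraMap k (TensorAlgebra k V)).injective
  | a :: l => by
    have h1 : Function.Injective (LinearMap.lTensor (D.R a)
        ((D.evL l).codRestrict ⊤ fun _ => trivial)) :=
      Module.Flat.lTensor_preserves_injective_linearMap _
        (fun x y h => evL_injective l (congrArg Subtype.val h))
    have h2 := (D.linearDisjoint_R_top a).injective.comp h1
    have h3 : D.evL (a :: l) = Submodule.mulMap (D.R a) ⊤ ∘ₗ LinearMap.lTensor (D.R a)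
        ((D.evL l).codRestrict ⊤ fun _ => trivial) := TensorProduct.ext' fun _ _ => rfl
    rw [h3]
    exact h2

lemma range_evL : ∀ l, LinearMap.range (D.evL l) = (l.map D.R).prod
  | [] => (Submodule.one_eq_range).symm
  | a :: l => by
    rw [List.map_cons, List.prod_cons, ← range_evL l]
    apply le_antisymm
    · rintro _ ⟨t, rfl⟩
      induction t using D.tens_cons_induction with
      | zero => rw [map_zero]; exact Submodule.zero_mem _
      | tmul x y => exact Submodule.mul_mem_mul x.2 ⟨y, rfl⟩
      | add x y hx hy => rw [map_add]; exact Submodule.add_mem _ hx hy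
    · rw [Submodule.mul_le]
      rintro x hx _ ⟨y, rfl⟩
      exact ⟨(⟨x, hx⟩ : D.R a) ⊗ₜ[k] y, rfl⟩

lemma evL_tensCast_symm {l l' : List ℕ} (h : l = l') (x : D.tens l') :
    D.evL l ((D.tensCast h).symm x) = D.evL l' x := by
  subst h; rfl

lemma evL_tensAppend_symm : ∀ (l l' : List ℕ) (x : D.tens l) (y : D.tens l'),
    D.evL (l ++ l') ((D.tensAppend l l').symm (x ⊗ₜ y)) = D.evL l x * D.evL l' y
  | [], l', c, y => by
    have h : ∀ c : k, D.evL l' (TensorProduct.lid k _ (c ⊗ₜ y)) =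
        algebraMap k (TensorAlgebra k V) c * D.evL l' y := fun c => by
      rw [TensorProduct.lid_tmul, map_smul, Algebra.smul_def]
    exact h c
  | a :: l, l', t, y => by
    induction t using D.tens_cons_induction with
    | zero =>
      rw [TensorProduct.zero_tmul, map_zero, map_zero, map_zero, zero_mul]
    | tmul x z =>
      rw [D.evL_cons, mul_assoc, ← evL_tensAppend_symm l l']
      rfl
    | add s t hs ht =>
      rw [TensorProduct.add_tmul, map_add, map_add, hs, ht, map_add, ← add_mul]

/-- The multiplication `M(u) → TV`. -/
noncomputable abbrev ev (u : Lam d) : D.obj u →ₗ[k] TensorAlgebra k V := D.evL (word u)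

/-- The image of `M(u)` in `TV`. -/
noncomputable def Rw (u : Lam d) : Submodule k (TensorAlgebra k V) := ((word u).map D.R).prod

lemma range_ev (u : Lam d) : LinearMap.range (D.ev u) = D.Rw u := D.range_evL _

lemma ev_mem (u : Lam d) (x : D.obj u) : D.ev u x ∈ D.Rw u := D.range_ev u ▸ ⟨x, rfl⟩

lemma exists_ev_eq {u : Lam d} {A : TensorAlgebra k V} (h : A ∈ D.Rw u) : ∃ x, D.ev u x = A := by
  rwa [← D.range_ev] at h

lemma ev_injective (u : Lam d) : Function.Injective (D.ev u) := D.evL_injective _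

lemma Rw_mul (u v : Lam d) : D.Rw (u * v) = D.Rw u * D.Rw v := by
  rw [Rw, Rw, Rw, word_mul, List.map_append, List.prod_append]

lemma Rw_eq_one {u : Lam d} (h : word u = []) : D.Rw u = 1 := by rw [Rw, h]; rfl

lemma Rw_rd (n : ℤ) : D.Rw (rd d n) = 1 := D.Rw_eq_one (word_rd n)

lemma Rw_r {a : ℕ} (h : 0 < a ∧ a < d) : D.Rw (r d a) = D.R a := by
  rw [Rw, word_r h, List.map_singleton, List.prod_singleton]

lemma Rw_r_of_lt {a : ℕ} (h : a < d) : D.Rw (r d a) = D.R a := by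
  rcases Nat.eq_zero_or_pos a with rfl | ha
  · exact D.Rw_eq_one word_zero
  · exact D.Rw_r ⟨ha, h⟩

lemma Rw_r_self : D.Rw (r d d) = 1 := D.Rw_eq_one word_self

lemma ev_objMul_symm (u v : Lam d) (x : D.obj u) (y : D.obj v) :
    D.ev (u * v) ((D.objMul u v).symm (x ⊗ₜ y)) = D.ev u x * D.ev v y := by
  rw [objMul, LinearEquiv.trans_symm, LinearEquiv.trans_apply]
  exact (D.evL_tensCast_symm _ _).trans (D.evL_tensAppend_symm _ _ x y)

/-- The graph of a map `M(u) → M(v)`, in terms of the images in `TV`. -/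
noncomputable def Gr {u v : Lam d} (g : D.obj u →ₗ[k] D.obj v) :
    Submodule k (TensorAlgebra k V × TensorAlgebra k V) :=
  LinearMap.range ((D.ev u).prod (D.ev v ∘ₗ g))

variable {D}

lemma mem_Gr {u v : Lam d} {g : D.obj u →ₗ[k] D.obj v} {A B : TensorAlgebra k V} :
    (A, B) ∈ D.Gr g ↔ ∃ x, D.ev u x = A ∧ D.ev v (g x) = B := by
  simp [Gr, Prod.ext_iff]

lemma ev_apply_of_mem_Gr {u v : Lam d} {g : D.obj u →ₗ[k] D.obj v} {A B : TensorAlgebra k V}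
    (h : (A, B) ∈ D.Gr g) {x : D.obj u} (hx : D.ev u x = A) : D.ev v (g x) = B := by
  obtain ⟨y, rfl, rfl⟩ := mem_Gr.1 h
  rw [D.ev_injective u hx]

lemma mem_Gr_comp {u v w : Lam d} {g : D.obj u →ₗ[k] D.obj v} {g' : D.obj v →ₗ[k] D.obj w}
    {A B C : TensorAlgebra k V} (h : (A, B) ∈ D.Gr g) (h' : (B, C) ∈ D.Gr g') :
    (A, C) ∈ D.Gr (g' ∘ₗ g) := by
  obtain ⟨x, rfl, rfl⟩ := mem_Gr.1 h
  exact mem_Gr.2 ⟨x, rfl, ev_apply_of_mem_Gr h' rfl⟩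

/-- The elements of `TV` on which two maps are defined and agree. -/
noncomputable def agree {u v : Lam d} (g₁ g₂ : D.obj u →ₗ[k] D.obj v) :
    Submodule k (TensorAlgebra k V) :=
  (D.Gr g₁ ⊓ D.Gr g₂).map (LinearMap.fst k _ _)

lemma mem_agree {u v : Lam d} {g₁ g₂ : D.obj u →ₗ[k] D.obj v} {A : TensorAlgebra k V} :
    A ∈ agree g₁ g₂ ↔ ∃ B, (A, B) ∈ D.Gr g₁ ∧ (A, B) ∈ D.Gr g₂ := by
  simp [agree]

/-- Equality of two maps becomes an inclusion of subspaces of `TV`. Since `Rw` of a product is a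
product of subspaces, it need only be checked on products of elements of the factors. -/
lemma eq_of_le_agree {u v : Lam d} {g₁ g₂ : D.obj u →ₗ[k] D.obj v}
    (h : D.Rw u ≤ agree g₁ g₂) : g₁ = g₂ := by
  ext x
  obtain ⟨B, h₁, h₂⟩ := mem_agree.1 (h (D.ev_mem u x))
  exact D.ev_injective v ((ev_apply_of_mem_Gr h₁ rfl).trans (ev_apply_of_mem_Gr h₂ rfl).symm)

lemma mul_mul_le {A B C E : Submodule k (TensorAlgebra k V)}
    (h : ∀ P ∈ A, ∀ S ∈ B, ∀ Q ∈ C, P * S * Q ∈ E) : A * B * C ≤ E := by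
  rw [Submodule.mul_le]
  intro X hX Q hQ
  have : A * B ≤ E.comap (LinearMap.mulRight k Q) := Submodule.mul_le.2 fun P hP S hS => h P hP S hS Q hQ
  exact this hX

lemma mul_mem_of_mem_mul {B C E : Submodule k (TensorAlgebra k V)} {P Q S : TensorAlgebra k V}
    (hS : S ∈ B * C) (h : ∀ x ∈ B, ∀ y ∈ C, P * (x * y) * Q ∈ E) : P * S * Q ∈ E := by
  have : B * C ≤ E.comap (LinearMap.mulRight k Q ∘ₗ LinearMap.mulLeft k P) :=
    Submodule.mul_le.2 fun x hx y hy => h x hx y hy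
  exact this hS

variable (ω : D.R d)

lemma arrowMap_mem_Gr {x y : Lam d} (f : Arrow d x y) (p : D.obj f.left) (s : D.obj f.src)
    (q : D.obj f.right) :
    (D.ev _ p * D.ev _ s * D.ev _ q, D.ev _ p * D.ev _ (D.genMap ω f.gen s) * D.ev _ q) ∈
      D.Gr (D.arrowMap ω f) := by
  rw [mem_Gr]
  refine ⟨(D.tensCast (congrArg word f.hx)).symm ((D.objMul (f.left * f.src) f.right).symm
    ((D.objMul f.left f.src).symm (p ⊗ₜ s) ⊗ₜ q)), ?_, ?_⟩
  · rw [ev, evL_tensCast_symm]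
    exact (D.ev_objMul_symm _ _ _ _).trans (congrArg (· * _) (D.ev_objMul_symm _ _ _ _))
  · simp only [arrowMap, LinearMap.comp_apply, LinearEquiv.coe_coe, LinearEquiv.apply_symm_apply,
      LinearMap.rTensor_tmul, LinearMap.lTensor_tmul]
    rw [ev, evL_tensCast_symm]
    exact (D.ev_objMul_symm _ _ _ _).trans (congrArg (· * _) (D.ev_objMul_symm _ _ _ _))

end QuadraticData

/-! ### The generators of `𝒰` in terms of `TV` -/

namespace QuadraticData

variable {k : Type u} [Field k] {V : Type u} [AddCommGroup V] [Module k V] {D : QuadraticData k V}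
  {d : ℕ}

/-- The coordinate of the elements of `R_d` with respect to `ω`. -/
noncomputable def coord (ω : D.R d) : D.R d →ₗ[k] k := linv (LinearMap.toSpanSingleton k (D.R d) ω)

/-- The map `R_a → TV`, `a ≤ d`, through which `R_a ≅ M(r_a) → TV` factors: the inclusion for
`a < d`, and `cω ↦ c` for `a = d`. -/
noncomputable def jr (ω : D.R d) (a : ℕ) : D.R a →ₗ[k] TensorAlgebra k V :=
  if h : a = d then Algebra.linearMap k _ ∘ₗ coord ω ∘ₗ D.castR h else (D.R a).subtype

lemma jr_of_lt (ω : D.R d) {a : ℕ} (h : a < d) (x : D.R a) : jr ω a x = x := by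
  rw [jr, dif_neg h.ne]; rfl

lemma evL_one {l : List ℕ} {a : ℕ} (h : l = [a]) (m : D.tens l) :
    D.evL l m = (((D.tensCast h).trans (TensorProduct.rid k (D.R a))) m : D.R a) := by
  subst h
  have key : TensorProduct.lift ((LinearMap.mul k (TensorAlgebra k V)).compl₁₂
      (D.R a).subtype (Algebra.linearMap k (TensorAlgebra k V))) =
      (D.R a).subtype ∘ₗ (TensorProduct.rid k (D.R a)).toLinearMap := by
    refine TensorProduct.ext' fun x c => ?_
    simp [Algebra.smul_def, Algebra.commutes]
  exact LinearMap.congr_fun key m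

lemma evL_two {l : List ℕ} {a b : ℕ} (h : l = [a, b]) (m : D.tens l) :
    D.evL l m = Submodule.mulMap (D.R a) (D.R b) (((D.tensCast h).trans
      (TensorProduct.congr (LinearEquiv.refl k (D.R a)) (TensorProduct.rid k (D.R b)))) m) := by
  subst h
  have key : TensorProduct.lift ((LinearMap.mul k (TensorAlgebra k V)).compl₁₂
      (D.R a).subtype (TensorProduct.lift ((LinearMap.mul k (TensorAlgebra k V)).compl₁₂
      (D.R b).subtype (Algebra.linearMap k (TensorAlgebra k V))))) =
      Submodule.mulMap (D.R a) (D.R b) ∘ₗ (TensorProduct.congr (LinearEquiv.refl k (D.R a))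
        (TensorProduct.rid k (D.R b))).toLinearMap := by
    refine TensorProduct.ext' fun x y => ?_
    induction y with
    | zero => simp
    | tmul y c =>
      simp [Algebra.smul_def, Algebra.commutes]
      rw [mul_assoc]
    | add s t hs ht => rw [TensorProduct.tmul_add, map_add, map_add, hs, ht]
  exact LinearMap.congr_fun key m

lemma ev_objTwo {u : Lam d} {a b : ℕ} (h : word u = [a, b]) (m : D.obj u) :
    D.ev u m = Submodule.mulMap (D.R a) (D.R b) (D.objTwo h m) := evL_two h m

lemma ev_objOne {u : Lam d} {a : ℕ} (h : word u = [a]) (m : D.obj u) :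
    D.ev u m = D.objOne h m := evL_one h m

namespace IsFrobenius

variable {ω : D.R d}

lemma coord_smul (hF : D.IsFrobenius ω) (c : k) : coord ω (c • ω) = c := by
  have hb : Function.Bijective (LinearMap.toSpanSingleton k (D.R d) ω) := by
    constructor
    · intro c c' h
      exact smul_left_injective k hF.ne_zero h
    · intro x
      obtain ⟨c, hc⟩ := exists_smul_eq hF.ne_zero hF.finrank x.2
      exact ⟨c, Subtype.ext hc⟩
  rw [coord, linv, dif_pos hb]
  exact LinearEquiv.ofBijective_symm_apply_apply _ c

lemma jr_self (hF : D.IsFrobenius ω) (c : k) : jr ω d (c • ω) = algebraMap k _ c := by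
  rw [jr, dif_pos rfl]
  exact congrArg (algebraMap k (TensorAlgebra k V)) (hF.coord_smul c)

lemma exists_eq_smul (hF : D.IsFrobenius ω) (x : D.R d) : ∃ c : k, x = c • ω := by
  obtain ⟨c, hc⟩ := exists_smul_eq hF.ne_zero hF.finrank x.2
  exact ⟨c, Subtype.ext hc.symm⟩

lemma jr_fromObj (hF : D.IsFrobenius ω) {a : ℕ} (ha : 0 < a) (had : a ≤ d) (m : D.obj (r d a)) :
    jr ω a (D.fromObj ω a ha had m) = D.ev _ m := by
  rcases had.lt_or_eq with h | rfl
  · rw [jr_of_lt ω h, fromObj, dif_pos h]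
    exact (ev_objOne _ m).symm
  · rw [fromObj, dif_neg (lt_irrefl a)]
    obtain ⟨m, rfl⟩ := (D.objNil (u := r a a) word_self).symm.surjective m
    have h1 : D.castR (rfl : a = a) = LinearMap.id := rfl
    rw [h1, LinearMap.id_comp, LinearMap.comp_apply, LinearEquiv.coe_coe,
      LinearEquiv.apply_symm_apply, LinearMap.toSpanSingleton_apply, hF.jr_self, objNil]
    exact (D.evL_tensCast_symm word_self (l' := []) m).symm

/-- The image of `M(r_a)` in `TV`. -/
lemma mem_Rw_r (hF : D.IsFrobenius ω) {a : ℕ} (ha : 0 < a) (had : a ≤ d) {A : TensorAlgebra k V} :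
    A ∈ D.Rw (r d a) ↔ ∃ x : D.R a, jr ω a x = A := by
  constructor
  · intro h
    obtain ⟨m, rfl⟩ := D.exists_ev_eq h
    exact ⟨_, hF.jr_fromObj ha had m⟩
  · rintro ⟨x, rfl⟩
    rcases had.lt_or_eq with h | rfl
    · rw [jr_of_lt ω h, D.Rw_r_of_lt h]
      exact x.2
    · obtain ⟨c, rfl⟩ := hF.exists_eq_smul x
      rw [hF.jr_self, D.Rw_r_self]
      exact Submodule.algebraMap_mem c

lemma jr_injective (hF : D.IsFrobenius ω) {a : ℕ} (had : a ≤ d) : Function.Injective (jr ω a) := by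
  rcases had.lt_or_eq with h | rfl
  · intro x y hxy
    rw [jr_of_lt ω h, jr_of_lt ω h] at hxy
    exact Subtype.ext hxy
  · intro x y hxy
    obtain ⟨c, rfl⟩ := hF.exists_eq_smul x
    obtain ⟨c', rfl⟩ := hF.exists_eq_smul y
    rw [hF.jr_self, hF.jr_self] at hxy
    rw [(algebraMap k (TensorAlgebra k V)).injective hxy]

end IsFrobenius

lemma ev_objNil {u : Lam d} (h : word u = []) (m : D.obj u) :
    D.ev u m = algebraMap k _ (D.objNil h m) := by
  obtain ⟨m, rfl⟩ := (D.objNil h).symm.surjective m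
  rw [LinearEquiv.apply_symm_apply]
  exact D.evL_tensCast_symm h (l' := []) m

variable {ω : D.R d}

/-- In `TV`, `φ` is the inclusion of `R_{a+b}`, with the normalization that for `a + b = d` the
source is `k` and a scalar `c` is read as `cω`. -/
lemma genMap_phi {a b : ℕ} (ha : 0 < a) (hb : 0 < b) (hab : a + b ≤ d) (m : D.obj (r d (a + b))) :
    D.ev _ (D.genMap ω (.phi a b ha hb hab) m) = D.fromObj ω (a + b) (by omega) hab m := by
  rw [genMap, LinearMap.comp_apply, LinearMap.comp_apply, LinearEquiv.coe_coe,
    ev_objTwo (a := a) (b := b) (by rw [word_mul, word_r (by omega), word_r (by omega)]; rfl),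
    LinearEquiv.apply_symm_apply, mulMap_incl]

lemma contract_eq {a b : ℕ} (ha : a < d) (hb : b < d) (hab : d < a + b) (x : D.R a) (y : D.R b) :
    (D.contract ω a b ha hb hab (x ⊗ₜ y) : TensorAlgebra k V) =
      lcon (D.fn ω (show a + (d - a) = d by omega) x) (y : TensorAlgebra k V) := by
  have h1 : (y : TensorAlgebra k V) =
    (D.castR (show b = d - a + (a + b - d) by omega) y : TensorAlgebra k V) := rfl
  rw [h1, ← D.mulMap_split, lcon_mulMap, split_eq_incl D (by omega) (by omega)]
  simp only [contract, LinearMap.comp_apply, LinearEquiv.coe_coe, LinearMap.lTensor_tmul]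
  congr 2
  generalize (D.incl _ _) (D.castR _ y) = s
  induction s with
  | zero => simp
  | tmul p q => rfl
  | add s t hs ht => rw [TensorProduct.tmul_add, map_add, map_add, map_add, hs, ht]

/-- Both cases of `θ` are the same operation in `TV`: contract `y` on the left by the functional
attached to `x`. For `a + b = d` the result is a scalar. -/
lemma genMap_theta {a b : ℕ} (ha : a < d) (hb : b < d) (hab : d ≤ a + b) (x : D.R a) (y : D.R b)
    (m : D.obj (r d a * rd d (-1) * r d b)) (hm : D.ev _ m = x * y) :
    D.ev _ (D.genMap ω (.theta a b ha hb hab) m) =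
      lcon (D.fn ω (show a + (d - a) = d by omega) x) (y : TensorAlgebra k V) := by
  have hw : word (r d a * rd d (-1) * r d b) = [a, b] := by
    rw [word_mul, word_mul, word_rd, word_r (by omega), word_r (by omega)]; rfl
  have h2 : D.objTwo hw m = x ⊗ₜ y := by
    apply D.mulMap_injective
    rw [← ev_objTwo, hm]
    rfl
  rw [genMap, LinearMap.comp_apply, LinearEquiv.coe_coe, h2]
  split_ifs with h
  · rw [ev_objNil (by rw [show a + b - d = 0 by omega, word_zero]), LinearMap.comp_apply,
      LinearEquiv.coe_coe, LinearEquiv.apply_symm_apply]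
    obtain rfl : b = d - a := by omega
    rw [lcon_coe]
    rfl
  · rw [ev_objOne (word_r (by omega)), LinearMap.comp_apply,
      LinearEquiv.coe_coe, LinearEquiv.apply_symm_apply, contract_eq]

end QuadraticData

/-! ### Compatibility of `M` with the relations of `𝒰` -/

namespace QuadraticData

variable {k : Type u} [Field k] {V : Type u} [AddCommGroup V] [Module k V] {D : QuadraticData k V}
  {d : ℕ} {ω : D.R d}

/-- The graph of the map that a morphism of the path category induces. -/
noncomputable abbrev GrM (ω : D.R d) {x y : Pre d} (p : x ⟶ y) :
    Submodule k (TensorAlgebra k V × TensorAlgebra k V) := D.Gr ((D.preM ω).map p).hom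

lemma preM_map_arr {s t : Lam d} (u : Lam d) (g : Gen d s t) (v : Lam d) {x y : Lam d}
    (hx : x = u * s * v) (hy : y = u * t * v) :
    ((D.preM ω).map (arr u g v hx hy)).hom = D.arrowMap ω ⟨u, s, t, v, g, hx, hy⟩ := by
  have := Paths.lift_toPath (C := ModuleCat.{u} k)
    { obj := fun u => D.obj u, map := fun f => ModuleCat.ofHom (D.arrowMap ω f) }
    (⟨u, s, t, v, g, hx, hy⟩ : Arrow d x y)
  exact congrArg ModuleCat.Hom.hom this

lemma mem_GrM_comp {x y z : Pre d} {p : x ⟶ y} {q : y ⟶ z} {A B C : TensorAlgebra k V}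
    (h : (A, B) ∈ GrM ω p) (h' : (B, C) ∈ GrM ω q) : (A, C) ∈ GrM ω (p ≫ q) := by
  rw [GrM, Functor.map_comp]
  exact mem_Gr_comp h h'

lemma mem_GrM_eqToHom {x y : Pre d} (h : x = y) {A : TensorAlgebra k V} (hA : A ∈ D.Rw x) :
    (A, A) ∈ GrM ω (eqToHom h) := by
  subst h
  obtain ⟨m, rfl⟩ := D.exists_ev_eq hA
  refine mem_Gr.2 ⟨m, rfl, ?_⟩
  rw [eqToHom_refl, (D.preM ω).map_id]
  rfl

lemma arr_mem_GrM {s t : Lam d} (u : Lam d) (g : Gen d s t) (v : Lam d) {x y : Lam d}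
    (hx : x = u * s * v) (hy : y = u * t * v) {P Q : TensorAlgebra k V} (hP : P ∈ D.Rw u)
    (hQ : Q ∈ D.Rw v) (m : D.obj s) :
    (P * D.ev s m * Q, P * D.ev t (D.genMap ω g m) * Q) ∈ GrM ω (arr u g v hx hy) := by
  obtain ⟨p, rfl⟩ := D.exists_ev_eq hP
  obtain ⟨q, rfl⟩ := D.exists_ev_eq hQ
  rw [GrM, preM_map_arr]
  exact arrowMap_mem_Gr ω ⟨u, s, t, v, g, hx, hy⟩ p m q

lemma phi_mem_GrM (hF : D.IsFrobenius ω) {u v x y : Lam d} {a b : ℕ} (ha : 0 < a) (hb : 0 < b)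
    (hab : a + b ≤ d) (hx : x = u * r d (a + b) * v) (hy : y = u * (r d a * r d b) * v)
    {P Q : TensorAlgebra k V} (hP : P ∈ D.Rw u) (hQ : Q ∈ D.Rw v) (z : D.R (a + b)) :
    (P * jr ω _ z * Q, P * z * Q) ∈ GrM ω (phi u a b hab v hx hy) := by
  obtain ⟨m, hm⟩ := D.exists_ev_eq ((hF.mem_Rw_r (by omega) hab).2 ⟨z, rfl⟩)
  have h1 := arr_mem_GrM (ω := ω) u (.phi a b ha hb hab) v hx hy hP hQ m
  rw [genMap_phi, hm] at h1
  rw [phi, dif_pos ⟨ha, hb⟩]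
  convert h1
  apply hF.jr_injective hab
  rw [← hm, hF.jr_fromObj]

/-- For `a + b < d` no identification of `R_d` with `k` intervenes, so `φ`, including its identity
conventions, does not change the element of `TV`. -/
lemma phi_mem_GrM_of_lt (hF : D.IsFrobenius ω) {u v x y : Lam d} {a b : ℕ}
    (hab : a + b < d) (hx : x = u * r d (a + b) * v) (hy : y = u * (r d a * r d b) * v)
    {A : TensorAlgebra k V} (hA : A ∈ D.Rw x) :
    (A, A) ∈ GrM ω (phi u a b hab.le v hx hy) := by
  by_cases h : 0 < a ∧ 0 < b
  · have h1 : D.Rw x ≤ (GrM ω (phi u a b hab.le v hx hy)).comap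
        ((LinearMap.id : TensorAlgebra k V →ₗ[k] _).prod LinearMap.id) := by
      have hx' := hx
      subst hx'
      rw [Rw_mul, Rw_mul]
      refine mul_mul_le fun P hP S hS Q hQ => ?_
      rw [D.Rw_r_of_lt hab] at hS
      have := phi_mem_GrM hF h.1 h.2 hab.le hx hy hP hQ ⟨S, hS⟩
      rwa [jr_of_lt ω hab] at this
    exact h1 hA
  · rw [phi, dif_neg h]
    exact mem_GrM_eqToHom _ hA

lemma theta_mem_GrM {u v x y : Lam d} {a a' b : ℕ} (ha : a < d) (hb : b < d)
    (hd : 0 < d) (hab : d ≤ a + b) (ha' : a + a' = d)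
    (hx : x = u * (r d a * rd d (-1) * r d b) * v)
    (hy : y = u * r d (a + b - d) * v)
    {P Q : TensorAlgebra k V} (hP : P ∈ D.Rw u) (hQ : Q ∈ D.Rw v) (z : D.R a) (w : D.R b) :
    (P * (z * w) * Q, P * lcon (D.fn ω ha' z) (w : TensorAlgebra k V) * Q) ∈
      GrM ω (theta u a b ha.le hb.le hd hab v hx hy) := by
  obtain rfl : a' = d - a := by omega
  have hmem : (z * w : TensorAlgebra k V) ∈ D.Rw (r d a * rd d (-1) * r d b) := by
    rw [Rw_mul, Rw_mul, Rw_rd, D.Rw_r_of_lt ha, D.Rw_r_of_lt hb, mul_one]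
    exact Submodule.mul_mem_mul z.2 w.2
  obtain ⟨m, hm⟩ := D.exists_ev_eq hmem
  have h1 := arr_mem_GrM (ω := ω) u (.theta a b ha hb hab) v hx hy hP hQ m
  rw [genMap_theta ha hb hab z w m hm, hm] at h1
  rwa [theta, dif_pos ⟨ha, hb⟩]

lemma mem_Rw_theta (hF : D.IsFrobenius ω) {u v : Lam d} {a b : ℕ} (ha : 0 < a) (had : a ≤ d)
    (hb : 0 < b) (hbd : b ≤ d) {P Q : TensorAlgebra k V} (hP : P ∈ D.Rw u) (hQ : Q ∈ D.Rw v)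
    (z : D.R a) (w : D.R b) :
    P * (jr ω a z * jr ω b w) * Q ∈ D.Rw (u * (r d a * rd d (-1) * r d b) * v) := by
  rw [Rw_mul, Rw_mul, Rw_mul, Rw_mul, Rw_rd, mul_one]
  exact Submodule.mul_mem_mul (Submodule.mul_mem_mul hP (Submodule.mul_mem_mul
    ((hF.mem_Rw_r ha had).2 ⟨z, rfl⟩) ((hF.mem_Rw_r hb hbd).2 ⟨w, rfl⟩))) hQ

lemma preM_map_eq {x y : Pre d} {p q : x ⟶ y}
    (h : D.Rw x ≤ agree ((D.preM ω).map p).hom ((D.preM ω).map q).hom) :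
    (D.preM ω).map p = (D.preM ω).map q := ModuleCat.hom_ext (eq_of_le_agree h)

lemma mul_mem_Rw {u v : Lam d} {A B : TensorAlgebra k V} (hA : A ∈ D.Rw u) (hB : B ∈ D.Rw v) :
    A * B ∈ D.Rw (u * v) := by
  rw [Rw_mul]
  exact Submodule.mul_mem_mul hA hB

lemma snd_mem {x y : Pre d} {p : x ⟶ y} {A B : TensorAlgebra k V} (h : (A, B) ∈ GrM ω p) :
    B ∈ D.Rw y := by
  obtain ⟨m, _, rfl⟩ := mem_Gr.1 h
  exact D.ev_mem _ _

lemma mem_Rw_of_mem_R {a : ℕ} (h : a < d) {x : TensorAlgebra k V} (hx : x ∈ D.R a) :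
    x ∈ D.Rw (r d a) := by rwa [D.Rw_r_of_lt h]

lemma one_mem_Rw_rd (n : ℤ) : (1 : TensorAlgebra k V) ∈ D.Rw (rd d n) := by
  rw [Rw_rd]; exact Submodule.one_le.1 le_rfl

lemma phi_mem_GrM' (hF : D.IsFrobenius ω) {u v x y : Lam d} {a b n : ℕ} (ha : 0 < a) (hb : 0 < b)
    (hn : a + b = n) (hab : a + b ≤ d) (hx : x = u * r d (a + b) * v)
    (hy : y = u * (r d a * r d b) * v)
    {P Q : TensorAlgebra k V} (hP : P ∈ D.Rw u) (hQ : Q ∈ D.Rw v) (z : D.R n) :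
    (P * jr ω _ z * Q, P * z * Q) ∈ GrM ω (phi u a b hab v hx hy) := by
  subst hn
  exact phi_mem_GrM hF ha hb hab hx hy hP hQ z

lemma mul_mem_of_mem_mul_mul {A B C E : Submodule k (TensorAlgebra k V)} {X Y : TensorAlgebra k V}
    (hY : Y ∈ A * B * C) (h : ∀ P ∈ A, ∀ S ∈ B, ∀ Q ∈ C, P * S * Q * X ∈ E) : Y * X ∈ E := by
  have : A * B * C ≤ E.comap (LinearMap.mulRight k X) := mul_mul_le h
  exact this hY

variable [FiniteDimensional k V]

/-- The functional attached to `ω` is the one on `R_0 = k` that sends `1` to `1`. This is what makes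
the convention `θ_{d,b} = id` agree with the contraction formula. -/
lemma IsFrobenius.lcon_fn_self (hF : D.IsFrobenius ω) {e : ℕ} (he : d + e = d) (c : k)
    (w : TensorAlgebra k V) : lcon (D.fn ω he (c • ω)) w = c • w := by
  obtain rfl : e = 0 := by omega
  have h1 : (1 : TensorAlgebra k V) ∈ D.R 0 := Submodule.one_le.1 le_rfl
  have h2 : ∀ w : TensorAlgebra k V, lcon (D.fn ω he ω) w = D.fn ω he ω ⟨1, h1⟩ • w := by
    intro w
    have := lcon_mul (D.fn ω he ω) ⟨1, h1⟩ w
    rwa [one_mul] at this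
  have h3 := h2 ω
  rw [hF.lcon_fn] at h3
  have h4 : D.fn ω he ω ⟨1, h1⟩ = 1 := by
    have h5 : (ω : TensorAlgebra k V) ≠ 0 := by simpa using hF.ne_zero
    exact smul_left_injective k h5 (by simpa using h3.symm)
  rw [map_smul, map_smul, LinearMap.smul_apply, h2, h4, one_smul]

lemma theta_mem_GrM_left (hF : D.IsFrobenius ω) {u v x y : Lam d} {a a' b : ℕ} (ha : a ≤ d)
    (hb0 : 0 < b) (hb : b < d) (hd : 0 < d) (hab : d ≤ a + b) (ha' : a + a' = d)
    (hx : x = u * (r d a * rd d (-1) * r d b) * v) (hy : y = u * r d (a + b - d) * v)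
    {P Q : TensorAlgebra k V} (hP : P ∈ D.Rw u) (hQ : Q ∈ D.Rw v) (z : D.R a) (w : D.R b) :
    (P * (jr ω a z * w) * Q, P * lcon (D.fn ω ha' z) (w : TensorAlgebra k V) * Q) ∈
      GrM ω (theta u a b ha hb.le hd hab v hx hy) := by
  rcases ha.lt_or_eq with h | rfl
  · rw [jr_of_lt ω h]
    exact theta_mem_GrM h hb hd hab ha' hx hy hP hQ z w
  · obtain ⟨c, rfl⟩ := hF.exists_eq_smul z
    rw [hF.jr_self, hF.lcon_fn_self, ← Algebra.smul_def, theta, dif_neg (by simp)]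
    apply mem_GrM_eqToHom
    have := mem_Rw_theta hF hd le_rfl hb0 hb.le hP hQ (c • ω) w
    rw [hF.jr_self, jr_of_lt ω hb, ← Algebra.smul_def] at this
    rwa [hx]

lemma theta_mem_GrM_right (hF : D.IsFrobenius ω) {u v x y : Lam d} {a a' b : ℕ} (ha0 : 0 < a) (ha : a < d)
    (hb : b ≤ d) (hd : 0 < d) (hab : d ≤ a + b) (ha' : a + a' = d)
    (hx : x = u * (r d a * rd d (-1) * r d b) * v) (hy : y = u * r d (a + b - d) * v)
    {P Q : TensorAlgebra k V} (hP : P ∈ D.Rw u) (hQ : Q ∈ D.Rw v) (z : D.R a) (w : D.R b) :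
    (P * (z * jr ω b w) * Q, P * lcon (D.fn ω ha' z) (w : TensorAlgebra k V) * Q) ∈
      GrM ω (theta u a b ha.le hb hd hab v hx hy) := by
  rcases hb.lt_or_eq with h | rfl
  · rw [jr_of_lt ω h]
    exact theta_mem_GrM ha h hd hab ha' hx hy hP hQ z w
  · obtain ⟨c, rfl⟩ := hF.exists_eq_smul w
    rw [hF.jr_self, Submodule.coe_smul, map_smul, hF.lcon_fn, ← Algebra.commutes,
      ← Algebra.smul_def, theta, dif_neg (by simp)]
    apply mem_GrM_eqToHom
    have := mem_Rw_theta hF ha0 ha.le hd le_rfl hP hQ z (c • ω)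
    rw [hF.jr_self, jr_of_lt ω ha, ← Algebra.commutes, ← Algebra.smul_def] at this
    rwa [hx]

/-- `∑ x' (x''·w) = x·w` -/
lemma IsFrobenius.lcon_fn_mem (hF : D.IsFrobenius ω) {a b e b' : ℕ} (hb : b + b' = d)
    (hab : (a + b) + e = d) (x : D.R (a + b)) {w : TensorAlgebra k V}
    (hw : w ∈ D.R b' * (⊤ : Submodule k (TensorAlgebra k V))) :
    LinearMap.mul' k _ (TensorProduct.map (D.R a).subtype
      ((lcon (D := D)).flip w ∘ₗ D.fn ω hb) (D.split a b x)) =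
      lcon (D.fn ω hab x) w := by
  obtain rfl : b' = e + a := by omega
  induction hw using Submodule.mul_induction_on' with
  | mem_mul_mem t ht w _ =>
    -- All contractions only touch the first factor `t` of `w`; for it the claim is that contracting
    -- the right end of `x` by `⟨·, t⟩` equals contracting `t` by `x`.
    rw [lcon_mul_of_mem _ (mem_R_mul_top (by omega) ht), ← hF.rcon_fnR_eq hab hb x ⟨t, ht⟩]
    rw [← D.mulMap_split, D.mulMap_split a b x]
    conv_rhs => rw [← D.mulMap_split a b x]
    generalize D.split a b x = s
    induction s with
    | zero => simp
    | tmul p q =>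
      rw [Submodule.mulMap_tmul, rcon_mul, fnR_apply, TensorProduct.map_tmul,
        LinearMap.mul'_apply, LinearMap.comp_apply, LinearMap.flip_apply,
        lcon_mul (D.fn ω hb q) ⟨t, ht⟩, mul_smul_comm, smul_mul_assoc]
      rfl
    | add s t hs ht => simp only [map_add, add_mul, hs, ht]
  | add s _ t _ hs ht =>
    rw [map_add, LinearMap.add_comp, TensorProduct.map_add_right, LinearMap.add_apply, map_add, hs,
      ht, map_add]

/-- After evaluation in `TV` on a product of elements, each relation is an identity of contractions:
the `φφ` relation says nothing, the `θθ` relation is associativity of contraction, the `φθ` relation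
is the sum formula `lcon_fn_mem`, and the `θφ` relation is linearity of left contraction over right
multiplication. -/
theorem IsFrobenius.compatible (hF : D.IsFrobenius ω) : D.Compatible ω := by
  intro x y p q h
  cases h with
  | interchange u w v g g' =>
    rename_i s t s' t'
    apply preM_map_eq
    change D.Rw (u * s * w * s' * v) ≤ _
    rw [Rw_mul, Rw_mul]
    refine mul_mul_le fun X hX S' hS' Q hQ => ?_
    rw [Rw_mul, Rw_mul] at hX
    obtain ⟨m', rfl⟩ := D.exists_ev_eq hS'
    rw [mul_assoc X]
    refine mul_mem_of_mem_mul_mul hX fun P hP S hS W hW => ?_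
    obtain ⟨m, rfl⟩ := D.exists_ev_eq hS
    refine mem_agree.2 ⟨P * D.ev t (D.genMap ω g m) * W * D.ev t' (D.genMap ω g' m') * Q, ?_, ?_⟩
    · refine mem_GrM_comp (B := P * D.ev t (D.genMap ω g m) * W * D.ev s' m' * Q) ?_
        (arr_mem_GrM _ _ _ _ _ (mul_mem_Rw (mul_mem_Rw hP (D.ev_mem _ _)) hW) hQ m')
      have := arr_mem_GrM (ω := ω) u g (w * s' * v) (x := u * s * w * s' * v)
        (y := u * t * w * s' * v) (by simp only [mul_assoc]) (by simp only [mul_assoc])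
        hP (mul_mem_Rw (mul_mem_Rw hW hS') hQ) m
      simpa only [mul_assoc] using this
    · refine mem_GrM_comp (B := P * D.ev s m * W * D.ev t' (D.genMap ω g' m') * Q) ?_ ?_
      · have := arr_mem_GrM (ω := ω) (u * s * w) g' v (x := u * s * w * s' * v)
          (y := u * s * w * t' * v) (by simp only [mul_assoc]) (by simp only [mul_assoc])
          (mul_mem_Rw (mul_mem_Rw hP hS) hW) hQ m'
        simpa only [mul_assoc] using this
      · have := arr_mem_GrM (ω := ω) u g (w * t' * v) (x := u * s * w * t' * v)
          (y := u * t * w * t' * v) (by simp only [mul_assoc]) (by simp only [mul_assoc])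
          hP (mul_mem_Rw (mul_mem_Rw hW (D.ev_mem _ (D.genMap ω g' m'))) hQ) m
        simpa only [mul_assoc] using this
  | phi_phi u v a b c ha hb hc h =>
    apply preM_map_eq
    change D.Rw (u * r d (a + b + c) * v) ≤ _
    rw [Rw_mul, Rw_mul]
    refine mul_mul_le fun P hP S hS Q hQ => ?_
    obtain ⟨z, rfl⟩ := (hF.mem_Rw_r (by omega) h).1 hS
    have h1 := phi_mem_GrM' hF (x := u * r d (a + b + c) * v) (y := u * (r d a * r d (b + c)) * v)
      ha (show 0 < b + c by omega) (by omega) (by omega) (by rw [add_assoc]) rfl hP hQ z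
    have h2 := phi_mem_GrM' hF (x := u * r d (a + b + c) * v) (y := u * (r d (a + b) * r d c) * v)
      (show 0 < a + b by omega) hc rfl h rfl rfl hP hQ z
    exact mem_agree.2 ⟨P * z * Q,
      mem_GrM_comp h1 (phi_mem_GrM_of_lt hF (by omega) _ _ (snd_mem h1)),
      mem_GrM_comp h2 (phi_mem_GrM_of_lt hF (by omega) _ _ (snd_mem h2))⟩
  | theta_theta u v a b c ha hb hc h =>
    apply preM_map_eq
    change D.Rw (u * (r d a * rd d (-1) * r d b * rd d (-1) * r d c) * v) ≤ _
    rw [Rw_mul, Rw_mul]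
    refine mul_mul_le fun P hP S hS Q hQ => ?_
    rw [Rw_mul, Rw_mul, Rw_mul, Rw_mul, Rw_rd, mul_one, mul_one, D.Rw_r_of_lt ha, D.Rw_r_of_lt hb,
      D.Rw_r_of_lt hc, mul_assoc] at hS
    refine mul_mem_of_mem_mul hS fun x hx S hS => ?_
    rw [← mul_assoc P]
    refine mul_mem_of_mem_mul hS fun y hy z hz => ?_
    have ha' : a + (d - a) = d := by omega
    have hb' : b + (d - b) = d := by omega
    have hxy : lcon (D.fn ω ha' ⟨x, hx⟩) y ∈ D.R (a + b - d) := lcon_mem _ (by omega) hy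
    have hyz : lcon (D.fn ω hb' ⟨y, hy⟩) z ∈ D.R (b + c - d) := lcon_mem _ (by omega) hz
    have key := hF.lcon_fn_lcon_fn ha' hb' (c := a + b - d) (c' := 2 * d - a - b) (by omega)
      (by omega) ⟨x, hx⟩ ⟨y, hy⟩ (z := ⟨_, hxy⟩) rfl (mem_R_mul_top (by omega) hz)
    refine mem_agree.2 ⟨P * lcon (D.fn ω ha' ⟨x, hx⟩) (lcon (D.fn ω hb' ⟨y, hy⟩) z) * Q, ?_, ?_⟩
    · refine mem_GrM_comp (B := P * (lcon (D.fn ω ha' ⟨x, hx⟩) y * z) * Q) ?_ ?_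
      · have := theta_mem_GrM (ω := ω) ha hb (by omega) (by omega) ha'
          (u := u) (v := rd d (-1) * r d c * v)
          (x := u * (r d a * rd d (-1) * r d b * rd d (-1) * r d c) * v)
          (y := u * (r d (a + b - d) * rd d (-1) * r d c) * v) (by simp only [mul_assoc])
          (by simp only [mul_assoc]) hP
          (mul_mem_Rw (mul_mem_Rw (one_mem_Rw_rd (-1)) (mem_Rw_of_mem_R hc hz)) hQ) ⟨x, hx⟩ ⟨y, hy⟩
        simpa only [mul_assoc, one_mul] using this
      · rw [key]
        exact theta_mem_GrM (by omega) hc (by omega) (by omega) (by omega) _ _ hP hQ ⟨_, hxy⟩ ⟨z, hz⟩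
    · refine mem_GrM_comp (B := P * (x * lcon (D.fn ω hb' ⟨y, hy⟩) z) * Q) ?_ ?_
      · have := theta_mem_GrM (ω := ω) hb hc (by omega) (by omega) hb'
          (u := u * (r d a * rd d (-1))) (v := v)
          (x := u * (r d a * rd d (-1) * r d b * rd d (-1) * r d c) * v)
          (y := u * (r d a * rd d (-1) * r d (b + c - d)) * v) (by simp only [mul_assoc])
          (by simp only [mul_assoc])
          (mul_mem_Rw hP (mul_mem_Rw (mem_Rw_of_mem_R ha hx) (one_mem_Rw_rd (-1)))) hQ
          ⟨y, hy⟩ ⟨z, hz⟩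
        simpa only [mul_assoc, one_mul, mul_one] using this
      · exact theta_mem_GrM ha (by omega) (by omega) (by omega) ha' _ _ hP hQ ⟨x, hx⟩ ⟨_, hyz⟩
  | phi_theta u v a b c ha hb hab hc h =>
    apply preM_map_eq
    change D.Rw (u * (r d (a + b) * rd d (-1) * r d c) * v) ≤ _
    rw [Rw_mul, Rw_mul]
    refine mul_mul_le fun P hP S hS Q hQ => ?_
    rw [Rw_mul, Rw_mul, Rw_rd, mul_one, D.Rw_r_of_lt hc] at hS
    refine mul_mem_of_mem_mul hS fun x hx z hz => ?_
    obtain ⟨x, rfl⟩ := (hF.mem_Rw_r (by omega) hab).1 hx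
    have hab' : a + b + (d - a - b) = d := by omega
    have hb' : b + (d - b) = d := by omega
    have h2 := theta_mem_GrM_left hF hab (by omega) hc (by omega) (by omega) hab'
      (x := u * (r d (a + b) * rd d (-1) * r d c) * v) (y := u * r d (a + b + c - d) * v)
      rfl rfl hP hQ x ⟨z, hz⟩
    refine mem_agree.2 ⟨P * lcon (D.fn ω hab' x) z * Q, ?_,
      mem_GrM_comp h2 (phi_mem_GrM_of_lt hF (by omega) _ _ (snd_mem h2))⟩
    have h1 := phi_mem_GrM hF ha hb hab (u := u) (v := rd d (-1) * r d c * v)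
      (x := u * (r d (a + b) * rd d (-1) * r d c) * v)
      (y := u * (r d a * r d b * rd d (-1) * r d c) * v)
      (by simp only [mul_assoc]) (by simp only [mul_assoc]) hP
      (mul_mem_Rw (mul_mem_Rw (one_mem_Rw_rd (-1)) (mem_Rw_of_mem_R hc hz)) hQ) x
    refine mem_GrM_comp (B := P * ((x : TensorAlgebra k V) * z) * Q) (by simpa only [mul_assoc, one_mul] using h1) ?_
    -- With `x` expanded in `R_a ⊗ R_b`, the graph condition is additive in the tensor, so pure
    -- tensors suffice.
    rw [← hF.lcon_fn_mem hb' hab' x (mem_R_mul_top (by omega) hz), ← D.mulMap_split a b x]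
    generalize D.split a b x = s
    induction s with
    | zero => simp [← Prod.zero_eq_mk]
    | tmul p q =>
      have := theta_mem_GrM (ω := ω) (show b < d by omega) hc (by omega) h hb'
        (u := u * r d a) (v := v)
        (x := u * (r d a * r d b * rd d (-1) * r d c) * v)
        (y := u * (r d a * r d (b + c - d)) * v)
        (by simp only [mul_assoc]) (by simp only [mul_assoc])
        (mul_mem_Rw hP (mem_Rw_of_mem_R (by omega) p.2)) hQ q ⟨z, hz⟩
      simpa only [mul_assoc, Submodule.mulMap_tmul, TensorProduct.map_tmul,
        LinearMap.mul'_apply, LinearMap.comp_apply, LinearMap.flip_apply, Submodule.subtype_apply] using this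
    | add s t hs ht =>
      have := Submodule.add_mem _ hs ht
      simpa only [Prod.mk_add_mk, map_add, mul_add, add_mul] using this
  | theta_phi u v a b c ha hb hc hbc h =>
    apply preM_map_eq
    change D.Rw (u * (r d a * rd d (-1) * r d (b + c)) * v) ≤ _
    rw [Rw_mul, Rw_mul]
    refine mul_mul_le fun P hP S hS Q hQ => ?_
    rw [Rw_mul, Rw_mul, Rw_rd, mul_one, D.Rw_r_of_lt ha] at hS
    refine mul_mem_of_mem_mul hS fun x hx y hy => ?_
    obtain ⟨y, rfl⟩ := (hF.mem_Rw_r (by omega) hbc).1 hy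
    have ha' : a + (d - a) = d := by omega
    have h2 := theta_mem_GrM_right hF (by omega) ha hbc (by omega) (by omega) ha'
      (x := u * (r d a * rd d (-1) * r d (b + c)) * v) (y := u * r d (a + b + c - d) * v)
      rfl (by rw [show a + (b + c) - d = a + b + c - d by omega]) hP hQ ⟨x, hx⟩ y
    refine mem_agree.2 ⟨P * lcon (D.fn ω ha' ⟨x, hx⟩) y * Q, ?_,
      mem_GrM_comp h2 (phi_mem_GrM_of_lt hF (by omega) _ _ (snd_mem h2))⟩
    have h1 := phi_mem_GrM hF hb hc hbc (u := u * (r d a * rd d (-1))) (v := v)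
      (x := u * (r d a * rd d (-1) * r d (b + c)) * v)
      (y := u * (r d a * rd d (-1) * r d b * r d c) * v)
      (by simp only [mul_assoc]) (by simp only [mul_assoc])
      (mul_mem_Rw hP (mul_mem_Rw (mem_Rw_of_mem_R ha hx) (one_mem_Rw_rd (-1)))) hQ y
    refine mem_GrM_comp (B := P * (x * (y : TensorAlgebra k V)) * Q)
      (by simpa only [mul_assoc, one_mul, mul_one] using h1) ?_
    rw [← D.mulMap_split b c y]
    generalize D.split b c y = s
    induction s with
    | zero => simp [← Prod.zero_eq_mk]
    | tmul p q =>
      have := theta_mem_GrM (ω := ω) ha (show b < d by omega) (by omega) h ha'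
        (u := u) (v := r d c * v)
        (x := u * (r d a * rd d (-1) * r d b * r d c) * v)
        (y := u * (r d (a + b - d) * r d c) * v)
        (by simp only [mul_assoc]) (by simp only [mul_assoc])
        hP (mul_mem_Rw (mem_Rw_of_mem_R (by omega) q.2) hQ) ⟨x, hx⟩ p
      rw [Submodule.mulMap_tmul, lcon_mul_of_mem _ (mem_R_mul_top (by omega) p.2)]
      simpa only [mul_assoc] using this
    | add s t hs ht =>
      have := Submodule.add_mem _ hs ht
      simpa only [Prod.mk_add_mk, map_add, mul_add, add_mul] using this

end QuadraticData

/-! ### Normal forms in `Λ` and overlaps of subwords -/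

section NormalForm

variable {d : ℕ}

lemma Lam.induction_left {p : Lam d → Prop} (one : p 1)
    (letter_mul : ∀ (a : Letter d) u, p u → p (letter a * u))
    (rd_mul : ∀ (n : ℤ) u, p u → p (rd d n * u)) (u : Lam d) : p u := by
  let i : FreeMonoid (Letter d) →* Lam d := Monoid.Coprod.inl
  have hi : ∀ (m : FreeMonoid (Letter d)) (v : Lam d), p v → p (i m * v) := by
    intro m
    induction m using FreeMonoid.inductionOn' with
    | one => intro v hv; rwa [map_one, one_mul]
    | of_mul a m ih =>
      intro v hv
      rw [map_mul, mul_assoc]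
      exact letter_mul a _ (ih v hv)
  have key : ∀ u v : Lam d, p v → p (u * v) := by
    intro u
    refine Monoid.Coprod.induction_on (motive := fun w : Lam d => ∀ v : Lam d, p v → p (w * v))
      (u : Monoid.Coprod (FreeMonoid (Letter d)) (Multiplicative ℤ)) ?_ ?_ ?_
    · exact hi
    · intro n v hv
      exact rd_mul n.toAdd v hv
    · intro (x : Lam d) (y : Lam d) hx hy v hv
      change p (x * y * v)
      rw [mul_assoc]
      exact hx _ (hy v hv)
  simpa using key u 1 one

/-- Normal forms of the elements of `Λ`: the letters, each with the exponent sum of `r_d` in front of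
it, and the exponent sum of `r_d`. -/
@[ext] structure NF (d : ℕ) where
  /-- The letters. -/
  l : List (Letter d × ℤ)
  /-- The exponent sum. -/
  e : ℤ

namespace NF

/-- The translation of the exponent sums. -/
def shift (n : ℤ) (l : List (Letter d × ℤ)) : List (Letter d × ℤ) :=
  l.map fun p => (p.1, p.2 + n)

@[simp] lemma shift_nil (n : ℤ) : shift n ([] : List (Letter d × ℤ)) = [] := rfl

@[simp] lemma shift_cons (n : ℤ) (p : Letter d × ℤ) (l : List (Letter d × ℤ)) :
    shift n (p :: l) = (p.1, p.2 + n) :: shift n l := rfl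

@[simp] lemma shift_append (n : ℤ) (l l' : List (Letter d × ℤ)) :
    shift n (l ++ l') = shift n l ++ shift n l' := List.map_append

lemma shift_shift (m n : ℤ) (l : List (Letter d × ℤ)) : shift m (shift n l) = shift (n + m) l := by
  simp [shift, add_assoc]

@[simp] lemma shift_zero (l : List (Letter d × ℤ)) : shift 0 l = l := by simp [shift]

lemma shift_injective (n : ℤ) : Function.Injective (shift n : List (Letter d × ℤ) → _) := by
  intro l l' h
  have := congrArg (shift (-n)) h
  simpa [shift_shift] using this

instance : Monoid (NF d) where
  mul x y := ⟨x.l ++ shift x.e y.l, x.e + y.e⟩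
  one := ⟨[], 0⟩
  mul_assoc x y z := by
    refine NF.ext ?_ (add_assoc _ _ _)
    change (x.l ++ shift x.e y.l) ++ shift (x.e + y.e) z.l =
      x.l ++ shift x.e (y.l ++ shift y.e z.l)
    rw [shift_append, shift_shift, List.append_assoc, add_comm x.e]
  one_mul x := NF.ext (by change [] ++ shift 0 x.l = _; simp) (zero_add _)
  mul_one x := NF.ext (by change x.l ++ shift x.e [] = _; simp) (add_zero _)

@[simp] lemma mul_l (x y : NF d) : (x * y).l = x.l ++ shift x.e y.l := rfl
@[simp] lemma mul_e (x y : NF d) : (x * y).e = x.e + y.e := rfl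
@[simp] lemma one_l : (1 : NF d).l = [] := rfl
@[simp] lemma one_e : (1 : NF d).e = 0 := rfl

/-- The element of `Λ` with a given normal form, where the exponent sums start with `h`. -/
def toLamAux (e : ℤ) : ℤ → List (Letter d × ℤ) → Lam d
  | h, [] => rd d (e - h)
  | h, p :: l => rd d (p.2 - h) * letter p.1 * toLamAux e p.2 l

lemma toLamAux_shift (e n : ℤ) : ∀ (h : ℤ) (l : List (Letter d × ℤ)),
    toLamAux (e + n) (h + n) (shift n l) = toLamAux e h l
  | h, [] => by rw [shift_nil, toLamAux, toLamAux, add_sub_add_right_eq_sub]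
  | h, p :: l => by
    rw [shift_cons, toLamAux, toLamAux, toLamAux_shift, add_sub_add_right_eq_sub]

lemma rd_mul_toLamAux (e h n : ℤ) (l : List (Letter d × ℤ)) :
    rd d n * toLamAux e h l = toLamAux e (h - n) l := by
  cases l with
  | nil => rw [toLamAux, toLamAux, rd_mul]; congr 1; ring
  | cons p l =>
    rw [toLamAux, toLamAux, ← mul_assoc, ← mul_assoc, rd_mul]; congr 3; ring

/-- The element of `Λ` with a given normal form. -/
def toLam (x : NF d) : Lam d := toLamAux x.e 0 x.l

end NF

/-- The normal form of an element of `Λ`. -/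
def nf : Lam d →* NF d := Lam.lift (fun a => ⟨[(a, 0)], 0⟩)
  { toFun := fun n => ⟨[], n.toAdd⟩, map_one' := rfl, map_mul' := fun _ _ => rfl }

lemma nf_rd (n : ℤ) : nf (rd d n) = ⟨[], n⟩ := Lam.lift_rd _ _ n

lemma r_eq_letter (a : Letter d) : r d a.1 = letter a := by rw [r, dif_pos a.2]

lemma nf_letter (a : Letter d) : nf (letter a) = ⟨[(a, 0)], 0⟩ := by
  rw [← r_eq_letter, nf, Lam.lift_r _ _ a.2]

lemma toLam_nf (u : Lam d) : (nf u).toLam = u := by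
  induction u using Lam.induction_left with
  | one => rw [map_one]; exact rd_zero
  | letter_mul a u ih =>
    rw [map_mul, nf_letter, NF.toLam]
    simp only [NF.mul_l, NF.mul_e, List.cons_append, List.nil_append, zero_add, NF.shift_zero,
      NF.toLamAux, sub_self, rd_zero, one_mul]
    exact congrArg _ ih
  | rd_mul n u ih =>
    rw [map_mul, nf_rd, NF.toLam]
    simp only [NF.mul_l, NF.mul_e, List.nil_append]
    conv_rhs => rw [← ih, NF.toLam, NF.rd_mul_toLamAux, ← NF.toLamAux_shift _ n]
    rw [zero_sub, neg_add_cancel, add_comm n]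

lemma nf_injective : Function.Injective (nf : Lam d → NF d) :=
  Function.LeftInverse.injective toLam_nf

lemma nf_toLam (x : NF d) : ∃ u, nf u = x := by
  obtain ⟨l, e⟩ := x
  induction l using List.reverseRecOn generalizing e with
  | nil => exact ⟨rd d e, nf_rd e⟩
  | append_singleton l p ih =>
    obtain ⟨u, hu⟩ := ih p.2
    refine ⟨u * letter p.1 * rd d (e - p.2), ?_⟩
    rw [map_mul, map_mul, hu, nf_letter, nf_rd]
    ext1 <;> simp

/-- The number of letters. -/
def len (u : Lam d) : ℕ := (nf u).l.length

lemma len_mul (u v : Lam d) : len (u * v) = len u + len v := by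
  simp [len, NF.shift]

lemma len_rd (n : ℤ) : len (rd d n) = 0 := by simp [len, nf_rd]

lemma len_letter (a : Letter d) : len (letter a) = 1 := by simp [len, nf_letter]

/-- Cancellation in the free product: the normal form records each letter with the exponent of `r_d`
accumulated before it, so equal numbers of letters in front determine the same cut. -/
lemma levi_eq {u v u' v' : Lam d} {a b : Letter d} (h : u * letter a * v = u' * letter b * v')
    (hl : len u = len u') : u = u' ∧ a = b ∧ v = v' := by
  have h1 := congrArg nf h
  simp only [map_mul, nf_letter] at h1
  have hL := congrArg NF.l h1
  have hE := congrArg NF.e h1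
  simp only [NF.mul_l, NF.mul_e, NF.shift_cons, NF.shift_nil, List.append_assoc, zero_add, add_zero,
    List.cons_append, List.nil_append] at hL hE
  obtain ⟨h2, h3⟩ := List.append_inj hL hl
  rw [List.cons.injEq, Prod.mk.injEq] at h3
  obtain ⟨⟨h4, h5⟩, h6⟩ := h3
  rw [h5] at h6 hE
  exact ⟨nf_injective (NF.ext h2 h5), h4,
    nf_injective (NF.ext (NF.shift_injective _ h6) (add_left_cancel hE))⟩

/-- Levi's lemma: if the marked letters sit at different places, the longer prefix contains the
shorter one together with its letter. The segment `w` between them is rebuilt from the normal form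
by undoing the shift of exponents. -/
lemma levi_lt {u v u' v' : Lam d} {a b : Letter d} (h : u * letter a * v = u' * letter b * v')
    (hl : len u < len u') : ∃ w, u' = u * letter a * w ∧ v = w * letter b * v' := by
  have h1 := congrArg nf h
  simp only [map_mul, nf_letter] at h1
  have hL := congrArg NF.l h1
  have hE := congrArg NF.e h1
  simp only [NF.mul_l, NF.mul_e, NF.shift_cons, NF.shift_nil, List.append_assoc, zero_add, add_zero,
    List.cons_append, List.nil_append] at hL hE
  obtain ⟨W, hW, hW'⟩ : ∃ W, (nf u').l = (nf u).l ++ (a, (nf u).e) :: W ∧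
      NF.shift (nf u).e (nf v).l = W ++ (b, (nf u').e) :: NF.shift (nf u').e (nf v').l := by
    rcases List.append_eq_append_iff.1 hL with ⟨Z, hZ, hZ'⟩ | ⟨Z, hZ, hZ'⟩
    · cases Z with
      | nil =>
        have := congrArg List.length hZ
        simp only [List.append_nil] at this
        exact absurd this (by unfold len at hl; omega)
      | cons z Z =>
        rw [List.cons_append, List.cons.injEq] at hZ'
        exact ⟨Z, by rw [hZ, hZ'.1], hZ'.2⟩
    · have := congrArg List.length hZ
      rw [List.length_append] at this
      exact absurd this (by unfold len at hl; omega)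
  obtain ⟨w, hw⟩ := nf_toLam (d := d) ⟨NF.shift (-(nf u).e) W, (nf u').e - (nf u).e⟩
  refine ⟨w, nf_injective ?_, nf_injective ?_⟩
  · simp only [map_mul, nf_letter, hw]
    ext1
    · simp [hW, NF.shift_shift]
    · simp
  · simp only [map_mul, nf_letter, hw]
    ext1
    · apply NF.shift_injective (nf u).e
      simp [hW', NF.shift_shift]
    · simp
      linarith

lemma rd_injective : Function.Injective (rd d) := by
  intro m n h
  have := congrArg (fun x => (nf x).e) h
  simpa [nf_rd] using this

variable {u v u' v' : Lam d} {a b c e : Letter d} {m n : ℤ}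

/-- Two subwords of the form letter, power of `r_d`, letter coincide, share exactly one letter, or
are disjoint, according to the numbers of letters in front; this lemma and the next two are these
cases. -/
lemma pair_eq (h : u * (letter a * rd d m * letter b) * v = u' * (letter c * rd d n * letter e) * v')
    (hl : len u = len u') : u = u' ∧ a = c ∧ m = n ∧ b = e ∧ v = v' := by
  have h1 : u * letter a * (rd d m * letter b * v) = u' * letter c * (rd d n * letter e * v') := by
    simpa only [mul_assoc] using h
  obtain ⟨rfl, rfl, h2⟩ := levi_eq h1 hl
  obtain ⟨h3, rfl, rfl⟩ := levi_eq h2 (by rw [len_rd, len_rd])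
  exact ⟨rfl, rfl, rd_injective h3, rfl, rfl⟩

lemma pair_adjacent
    (h : u * (letter a * rd d m * letter b) * v = u' * (letter c * rd d n * letter e) * v')
    (hl : len u' = len u + 1) :
    u' = u * letter a * rd d m ∧ b = c ∧ v = rd d n * letter e * v' := by
  have h1 : u * letter a * (rd d m * letter b * v) = u' * letter c * (rd d n * letter e * v') := by
    simpa only [mul_assoc] using h
  obtain ⟨w, rfl, h2⟩ := levi_lt h1 (by omega)
  have : len w = 0 := by simp only [len_mul, len_letter] at hl; omega
  obtain ⟨rfl, rfl, rfl⟩ := levi_eq h2 (by rw [len_rd, this])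
  exact ⟨rfl, rfl, rfl⟩

lemma pair_disjoint
    (h : u * (letter a * rd d m * letter b) * v = u' * (letter c * rd d n * letter e) * v')
    (hl : len u + 1 < len u') : ∃ w, u' = u * (letter a * rd d m * letter b) * w ∧
      v = w * (letter c * rd d n * letter e) * v' := by
  have h1 : u * letter a * (rd d m * letter b * v) = u' * letter c * (rd d n * letter e * v') := by
    simpa only [mul_assoc] using h
  obtain ⟨w, rfl, h2⟩ := levi_lt h1 (by omega)
  obtain ⟨w', rfl, rfl⟩ := levi_lt h2 (by
    simp only [len_mul, len_letter, len_rd] at hl ⊢; omega)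
  exact ⟨w', by simp only [mul_assoc], by simp only [mul_assoc]⟩

end NormalForm

/-! ### Every morphism of `𝒰` descends and then ascends -/

section Factorization

variable {d : ℕ}

/-- A whiskered generator, as a morphism of `𝒰`. -/
def aM {x y : Lam d} (g : Arrow d x y) : U.of x ⟶ U.of y :=
  (CategoryTheory.Quotient.functor (Rel d)).map ((Paths.of (Lam d)).map g)

/-- The whiskered generator `u φ_{a,b} v`. -/
def phiA (u v : Lam d) {a b : ℕ} (ha : 0 < a) (hb : 0 < b) (hab : a + b ≤ d) {x y : Lam d}
    (hx : x = u * r d (a + b) * v) (hy : y = u * (r d a * r d b) * v) : Arrow d x y :=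
  ⟨u, _, _, v, .phi a b ha hb hab, hx, hy⟩

/-- The whiskered generator `u θ_{a,b} v`. -/
def thetaA (u v : Lam d) {a b : ℕ} (ha : a < d) (hb : b < d) (hab : d ≤ a + b) {x y : Lam d}
    (hx : x = u * (r d a * rd d (-1) * r d b) * v) (hy : y = u * r d (a + b - d) * v) :
    Arrow d x y :=
  ⟨u, _, _, v, .theta a b ha hb hab, hx, hy⟩

lemma arrow_cases {x y : Lam d} (g : Arrow d x y) :
    (∃ (u v : Lam d) (a b : ℕ) (ha : 0 < a) (hb : 0 < b) (hab : a + b ≤ d) (hx : _) (hy : _),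
      g = phiA u v ha hb hab hx hy) ∨
    ∃ (u v : Lam d) (a b : ℕ) (ha : a < d) (hb : b < d) (hab : d ≤ a + b) (hx : _) (hy : _),
      g = thetaA u v ha hb hab hx hy := by
  obtain ⟨u, s, t, v, g, hx, hy⟩ := g
  cases g with
  | phi a b ha hb hab => exact Or.inl ⟨u, v, a, b, ha, hb, hab, hx, hy, rfl⟩
  | theta a b ha hb hab => exact Or.inr ⟨u, v, a, b, ha, hb, hab, hx, hy, rfl⟩

lemma phiA_lt {x y u v : Lam d} {a b : ℕ} (ha : 0 < a) (hb : 0 < b) (hab : a + b ≤ d)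
    (hx : x = u * r d (a + b) * v) (hy : y = u * (r d a * r d b) * v) : x < y := by
  have h : Step d x y := by subst hx hy; exact .phi u v a b ha hb hab
  refine lt_of_le_of_ne (Relation.ReflTransGen.single h) ?_
  rintro rfl
  exact lt_irrefl _ h.weight_lt

lemma thetaA_lt {x y u v : Lam d} {a b : ℕ} (ha : a < d) (hb : b < d) (hab : d ≤ a + b)
    (hx : x = u * (r d a * rd d (-1) * r d b) * v) (hy : y = u * r d (a + b - d) * v) : y < x := by
  have h : Step d y x := by subst hx hy; exact .theta u v a b ha hb hab
  refine lt_of_le_of_ne (Relation.ReflTransGen.single h) ?_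
  rintro rfl
  exact lt_irrefl _ h.weight_lt

/-- The compositions of generators `φ`. -/
inductive Up : ∀ {x y : Lam d}, (U.of x ⟶ U.of y) → Prop
  | id (x : Lam d) : Up (𝟙 (U.of x))
  | snoc {x y z : Lam d} (m : U.of x ⟶ U.of y) (hm : Up m) (u v : Lam d) {a b : ℕ} (ha : 0 < a)
      (hb : 0 < b) (hab : a + b ≤ d) (hy : y = u * r d (a + b) * v)
      (hz : z = u * (r d a * r d b) * v) : Up (m ≫ aM (phiA u v ha hb hab hy hz))

/-- The compositions of generators `θ`. -/
inductive Down : ∀ {x y : Lam d}, (U.of x ⟶ U.of y) → Prop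
  | id (x : Lam d) : Down (𝟙 (U.of x))
  | cons {x y z : Lam d} (m : U.of y ⟶ U.of z) (hm : Down m) (u v : Lam d) {a b : ℕ} (ha : a < d)
      (hb : b < d) (hab : d ≤ a + b) (hx : x = u * (r d a * rd d (-1) * r d b) * v)
      (hy : y = u * r d (a + b - d) * v) : Down (aM (thetaA u v ha hb hab hx hy) ≫ m)

/-- The compositions of at most one generator `θ`. -/
inductive DownOne : ∀ {x y : Lam d}, (U.of x ⟶ U.of y) → Prop
  | id (x : Lam d) : DownOne (𝟙 (U.of x))
  | of {x y : Lam d} (u v : Lam d) {a b : ℕ} (ha : a < d)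
      (hb : b < d) (hab : d ≤ a + b) (hx : x = u * (r d a * rd d (-1) * r d b) * v)
      (hy : y = u * r d (a + b - d) * v) : DownOne (aM (thetaA u v ha hb hab hx hy))

lemma Up.comp {x y z : Lam d} {m : U.of x ⟶ U.of y} {m' : U.of y ⟶ U.of z} (h : Up m)
    (h' : Up m') : Up (m ≫ m') := by
  induction h' with
  | id => rwa [Category.comp_id]
  | snoc m'' _ u v ha hb hab hy hz ih =>
    rw [← Category.assoc]
    exact .snoc _ ih u v ha hb hab hy hz

lemma DownOne.comp {x y z : Lam d} {m : U.of x ⟶ U.of y} {m' : U.of y ⟶ U.of z} (h : DownOne m)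
    (h' : Down m') : Down (m ≫ m') := by
  cases h with
  | id => rwa [Category.id_comp]
  | of u v ha hb hab hx hy => exact .cons _ h' u v ha hb hab hx hy

lemma up_aM {x y u v : Lam d} {a b : ℕ} (ha : 0 < a) (hb : 0 < b) (hab : a + b ≤ d)
    (hx : x = u * r d (a + b) * v) (hy : y = u * (r d a * r d b) * v) :
    Up (aM (phiA u v ha hb hab hx hy)) := by
  have := Up.snoc _ (Up.id x) u v ha hb hab hx hy
  rwa [Category.id_comp] at this

/-- The functor from the path category to `𝒰`, on morphisms. -/
abbrev toU {x y : Lam d} (p : Pre.of x ⟶ Pre.of y) : U.of x ⟶ U.of y :=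
  (CategoryTheory.Quotient.functor (Rel d)).map p

lemma toU_eqToHom {x y : Lam d} (h : Pre.of x = Pre.of y) :
    ∃ h' : x = y, toU (eqToHom h) = eqToHom (congrArg U.of h') := by
  have h' : x = y := h
  subst h'
  exact ⟨rfl, CategoryTheory.Functor.map_id _ _⟩

lemma up_phi (u v : Lam d) (a b : ℕ) (hab : a + b ≤ d) {x y : Lam d}
    (hx : x = u * r d (a + b) * v) (hy : y = u * (r d a * r d b) * v) :
    Up (toU (phi u a b hab v hx hy)) := by
  rw [phi]
  split_ifs with h
  · exact up_aM h.1 h.2 hab hx hy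
  · have h0 : x = y := by
      rw [hx, hy]
      rcases (show a = 0 ∨ b = 0 by omega) with rfl | rfl <;> simp
    obtain ⟨rfl, h2⟩ := toU_eqToHom (congrArg Pre.of h0)
    rw [h2]
    exact .id _

lemma downOne_theta (u v : Lam d) (a b : ℕ) (ha : a ≤ d) (hb : b ≤ d) (hd : 0 < d) (hab : d ≤ a + b)
    {x y : Lam d} (hx : x = u * (r d a * rd d (-1) * r d b) * v) (hy : y = u * r d (a + b - d) * v) :
    DownOne (toU (theta u a b ha hb hd hab v hx hy)) := by
  rw [theta]
  split_ifs with h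
  · exact .of u v h.1 h.2 hab hx hy
  · have h0 : x = y := by
      rw [hx, hy]
      rcases (show a = d ∨ b = d by omega) with rfl | rfl
      · rw [r_self hd, rd_mul]; simp
      · rw [r_self hd, mul_assoc (r b a), rd_mul]; simp
    obtain ⟨rfl, h2⟩ := toU_eqToHom (congrArg Pre.of h0)
    rw [h2]
    exact .id _

lemma toU_eq_of_rel {x y : Lam d} {p q : Pre.of x ⟶ Pre.of y} (h : Rel d p q) : toU p = toU q :=
  CategoryTheory.Quotient.sound _ h

lemma toU_comp {x y z : Lam d} (p : Pre.of x ⟶ Pre.of y) (q : Pre.of y ⟶ Pre.of z) :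
    toU (p ≫ q) = toU p ≫ toU q := Functor.map_comp _ _ _

lemma toU_phi {u v : Lam d} {a b : ℕ} (ha : 0 < a) (hb : 0 < b) (hab : a + b ≤ d) {x y : Lam d}
    (hx : x = u * r d (a + b) * v) (hy : y = u * (r d a * r d b) * v) :
    toU (phi u a b hab v hx hy) = aM (phiA u v ha hb hab hx hy) := by
  rw [phi, dif_pos ⟨ha, hb⟩]; rfl

lemma toU_theta {u v : Lam d} {a b : ℕ} (ha : a < d) (hb : b < d) (hd : 0 < d) (hab : d ≤ a + b)
    {x y : Lam d} (hx : x = u * (r d a * rd d (-1) * r d b) * v) (hy : y = u * r d (a + b - d) * v) :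
    toU (theta u a b ha.le hb.le hd hab v hx hy) = aM (thetaA u v ha hb hab hx hy) := by
  rw [theta, dif_pos ⟨ha, hb⟩]; rfl

/-- The letters produced by `φ` and those consumed by `θ` share one letter or are disjoint. An
overlap is resolved by the mixed relations, a disjoint position by interchange. The new `θ` may be
an identity by convention, hence `DownOne`. -/
lemma exists_swap {x y z u v u' v' : Lam d} {a b c e : ℕ} (ha : 0 < a) (hb : 0 < b)
    (hab : a + b ≤ d) (hx : x = u * r d (a + b) * v) (hy : y = u * (r d a * r d b) * v)
    (hc : c < d) (he : e < d) (hce : d ≤ c + e)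
    (hy' : y = u' * (r d c * rd d (-1) * r d e) * v') (hz : z = u' * r d (c + e - d) * v') :
    ∃ (w : Lam d) (t : U.of x ⟶ U.of w) (p : U.of w ⟶ U.of z), DownOne t ∧ Up p ∧
      aM (phiA u v ha hb hab hx hy) ≫ aM (thetaA u' v' hc he hce hy' hz) = t ≫ p := by
  have hpos : ∀ {n : ℕ} (h : 0 < n ∧ n < d), r d n = letter ⟨n, h⟩ := fun h => by rw [r, dif_pos h]
  have h1 : u * (letter ⟨a, by omega⟩ * rd d 0 * letter ⟨b, by omega⟩) * v =
      u' * (letter ⟨c, by omega⟩ * rd d (-1) * letter ⟨e, by omega⟩) * v' := by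
    rw [← hpos, ← hpos, ← hpos, ← hpos, rd_zero, mul_one, ← hy, ← hy']
  rcases lt_trichotomy (len u) (len u') with hl | hl | hl
  · rcases (Nat.succ_le_of_lt hl).eq_or_lt with hl | hl
    · obtain ⟨h2, h3, h4⟩ := pair_adjacent h1 hl.symm
      rw [Subtype.mk.injEq] at h3
      subst h3
      rw [← hpos, rd_zero, mul_one] at h2
      rw [← hpos] at h4
      subst h2 h4
      obtain rfl : x = u * (r d (a + b) * rd d (-1) * r d e) * v' := by
        rw [hx]; simp only [mul_assoc]
      obtain rfl : y = u * (r d a * r d b * rd d (-1) * r d e) * v' := by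
        rw [hy]; simp only [mul_assoc]
      obtain rfl : z = u * (r d a * r d (b + e - d)) * v' := by
        rw [hz]; simp only [mul_assoc]
      have := toU_eq_of_rel (Rel.phi_theta u v' a b e ha hb hab he hce)
      rw [toU_comp, toU_comp, toU_phi ha hb, toU_theta hc he] at this
      exact ⟨_, _, _, downOne_theta _ _ _ _ _ _ _ _ _ _, up_phi _ _ _ _ _ _ _, this⟩
    · obtain ⟨w, h2, h3⟩ := pair_disjoint h1 hl
      rw [← hpos, ← hpos, rd_zero, mul_one] at h2
      rw [← hpos, ← hpos] at h3
      subst h2 h3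
      obtain rfl : x = u * r d (a + b) * w * (r d c * rd d (-1) * r d e) * v' := by
        rw [hx]; simp only [mul_assoc]
      obtain rfl : y = u * (r d a * r d b) * w * (r d c * rd d (-1) * r d e) * v' := by
        rw [hy]; simp only [mul_assoc]
      obtain rfl : z = u * (r d a * r d b) * w * r d (c + e - d) * v' := hz
      have := toU_eq_of_rel (Rel.interchange u w v' (.phi a b ha hb hab) (.theta c e hc he hce))
      rw [toU_comp, toU_comp] at this
      exact ⟨_, _, _, .of _ _ hc he hce _ _, up_aM ha hb hab _ _, this⟩
  -- The two pairs cannot coincide: `φ` produces `r_a r_b` with exponent `0` in between, `θ`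
  -- consumes a pair with exponent `-1`.
  · exact absurd (pair_eq h1 hl).2.2.1 (by norm_num)
  · rcases (Nat.succ_le_of_lt hl).eq_or_lt with hl | hl
    · obtain ⟨h2, h3, h4⟩ := pair_adjacent h1.symm hl.symm
      rw [Subtype.mk.injEq] at h3
      subst h3
      rw [← hpos, mul_assoc] at h2
      rw [← hpos, rd_zero, one_mul] at h4
      subst h2 h4
      obtain rfl : x = u' * (r d c * rd d (-1) * r d (e + b)) * v := by
        rw [hx]; simp only [mul_assoc]
      obtain rfl : y = u' * (r d c * rd d (-1) * r d e * r d b) * v := by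
        rw [hy]; simp only [mul_assoc]
      obtain rfl : z = u' * (r d (c + e - d) * r d b) * v := by
        rw [hz]; simp only [mul_assoc]
      have := toU_eq_of_rel (Rel.theta_phi u' v c e b hc ha hb hab hce)
      rw [toU_comp, toU_comp, toU_phi ha hb, toU_theta hc he] at this
      exact ⟨_, _, _, downOne_theta _ _ _ _ _ _ _ _ _ _, up_phi _ _ _ _ _ _ _, this⟩
    · obtain ⟨w, h2, h3⟩ := pair_disjoint h1.symm hl
      rw [← hpos, ← hpos, rd_zero, mul_one] at h3
      rw [← hpos, ← hpos] at h2
      subst h2 h3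
      obtain rfl : x = u' * (r d c * rd d (-1) * r d e) * w * r d (a + b) * v := hx
      obtain rfl : y = u' * (r d c * rd d (-1) * r d e) * w * (r d a * r d b) * v := hy
      obtain rfl : z = u' * r d (c + e - d) * w * (r d a * r d b) * v := by
        rw [hz]; simp only [mul_assoc]
      have := toU_eq_of_rel (Rel.interchange u' w v (.theta c e hc he hce) (.phi a b ha hb hab))
      rw [toU_comp, toU_comp] at this
      exact ⟨_, _, _, .of _ _ hc he hce _ _, up_aM ha hb hab _ _, this.symm⟩

/-- A swap never produces more than one `θ`, so a single `θ` can be carried past a whole chain of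
`φ`. -/
lemma Up.exists_swap {x y z : Lam d} {m : U.of x ⟶ U.of y} (hm : Up m) {t : U.of y ⟶ U.of z}
    (ht : DownOne t) : ∃ (w : Lam d) (t' : U.of x ⟶ U.of w) (p : U.of w ⟶ U.of z),
      DownOne t' ∧ Up p ∧ m ≫ t = t' ≫ p := by
  induction hm generalizing z with
  | id => exact ⟨_, t, 𝟙 _, ht, .id _, by simp⟩
  | snoc m hm u v ha hb hab hy hz ih =>
    cases ht with
    | id => exact ⟨_, 𝟙 _, _, .id _, .snoc m hm u v ha hb hab hy hz, by simp⟩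
    | of u' v' hc he hce hy' hz' =>
      obtain ⟨w, t, p, ht, hp, h⟩ := UAut.exists_swap ha hb hab hy hz hc he hce hy' hz'
      obtain ⟨w', t', p', ht', hp', h'⟩ := ih ht
      exact ⟨w', t', p' ≫ p, ht', hp'.comp hp, by
        rw [Category.assoc, h, ← Category.assoc, h', Category.assoc]⟩

lemma Down.snoc {x y z : Lam d} {m : U.of x ⟶ U.of y} (hm : Down m) {t : U.of y ⟶ U.of z}
    (ht : DownOne t) : Down (m ≫ t) := by
  induction hm with
  | id =>
    rw [Category.id_comp]
    simpa using ht.comp (.id _)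
  | cons m _ u v ha hb hab hx hy ih =>
    rw [Category.assoc]
    exact .cons _ (ih ht) u v ha hb hab hx hy

/-- Every morphism of `𝒰` is a composition of generators `θ`, followed by generators `φ`. -/
theorem exists_factorization {x y : Lam d} (m : U.of x ⟶ U.of y) :
    ∃ (w : Lam d) (t : U.of x ⟶ U.of w) (p : U.of w ⟶ U.of y), Down t ∧ Up p ∧ m = t ≫ p := by
  obtain ⟨p, rfl⟩ := (CategoryTheory.Quotient.functor (Rel d)).map_surjective m
  change Quiver.Path x y at p
  induction p with
  | nil => exact ⟨x, 𝟙 _, 𝟙 _, .id _, .id _, (CategoryTheory.Functor.map_id _ _).trans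
      (Category.id_comp (𝟙 (U.of x))).symm⟩
  | cons p g ih =>
    obtain ⟨w, t, q, ht, hq, h⟩ := ih
    have h2 : toU (Quiver.Path.cons p g) = t ≫ q ≫ aM g := by
      rw [← Category.assoc, ← h]
      exact toU_comp p ((Paths.of (Lam d)).map g)
    rcases arrow_cases g with ⟨u, v, a, b, ha, hb, hab, hx, hy, rfl⟩ |
      ⟨u, v, a, b, ha, hb, hab, hx, hy, rfl⟩
    · exact ⟨w, t, _, ht, .snoc q hq u v ha hb hab hx hy, h2⟩
    · obtain ⟨w', t', p', ht', hp', h3⟩ := hq.exists_swap (.of u v ha hb hab hx hy)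
      exact ⟨w', t ≫ t', p', ht.snoc ht', hp', h2.trans (by rw [h3, Category.assoc])⟩

end Factorization

/-! ### Natural endomorphisms of `M` over a saturated set -/

namespace QuadraticData

variable {k : Type u} [Field k] {V : Type u} [AddCommGroup V] [Module k V] {D : QuadraticData k V}
  {d : ℕ} {ω : D.R d}

/-- The functor `M` on morphisms. -/
noncomputable def mapU (hM : D.Compatible ω) {x y : Lam d} (m : U.of x ⟶ U.of y) :
    D.obj x →ₗ[k] D.obj y := ((D.M ω hM).map m).hom

section

variable (hM : D.Compatible ω)

lemma mapU_comp {x y z : Lam d} (m : U.of x ⟶ U.of y) (m' : U.of y ⟶ U.of z) :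
    mapU hM (m ≫ m') = mapU hM m' ∘ₗ mapU hM m := by
  exact congrArg ModuleCat.Hom.hom ((D.M ω hM).map_comp m m')

lemma mapU_id (x : Lam d) : mapU hM (𝟙 (U.of x)) = LinearMap.id := by
  exact congrArg ModuleCat.Hom.hom ((D.M ω hM).map_id (U.of x))

lemma mapU_aM {x y : Lam d} (g : Arrow d x y) : mapU hM (aM g) = D.arrowMap ω g :=
  preM_map_arr g.left g.gen g.right g.hx g.hy

variable {hM} {F : ∀ x : Lam d, D.obj x →ₗ[k] D.obj x} {S : Set (Lam d)}

lemma comm_up (hS : IsLowerSet S) (hF : ∀ ⦃x y⦄ (g : Arrow d x y), x ∈ S → y ∈ S →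
      D.arrowMap ω g ∘ₗ F x = F y ∘ₗ D.arrowMap ω g) {x y : Lam d} {m : U.of x ⟶ U.of y}
    (hm : Up m) (hy : y ∈ S) : mapU hM m ∘ₗ F x = F y ∘ₗ mapU hM m := by
  induction hm with
  | id => rw [mapU_id]; rfl
  | snoc m hm u v ha hb hab hy' hz ih =>
    have h1 := hS (phiA_lt ha hb hab hy' hz).le hy
    rw [mapU_comp, mapU_aM, LinearMap.comp_assoc, ih h1, ← LinearMap.comp_assoc, hF _ h1 hy]
    rfl

lemma comm_down (hS : IsLowerSet S) (hF : ∀ ⦃x y⦄ (g : Arrow d x y), x ∈ S → y ∈ S →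
      D.arrowMap ω g ∘ₗ F x = F y ∘ₗ D.arrowMap ω g) {x y : Lam d} {m : U.of x ⟶ U.of y}
    (hm : Down m) (hx : x ∈ S) : y ∈ S ∧ mapU hM m ∘ₗ F x = F y ∘ₗ mapU hM m := by
  induction hm with
  | id => rw [mapU_id]; exact ⟨hx, rfl⟩
  | cons m hm u v ha hb hab hx' hy ih =>
    have h1 := hS (thetaA_lt ha hb hab hx' hy).le hx
    obtain ⟨h2, h3⟩ := ih h1
    refine ⟨h2, ?_⟩
    rw [mapU_comp, mapU_aM, LinearMap.comp_assoc, hF _ hx h1, ← LinearMap.comp_assoc, h3]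
    rfl

/-- A path between objects of `S` may leave `S`. The factorization into descending and ascending
generators avoids this, since its objects lie below the source or below the target and `S` is a
lower set. -/
lemma comm_of_arrow (hS : IsLowerSet S) (hF : ∀ ⦃x y⦄ (g : Arrow d x y), x ∈ S → y ∈ S →
      D.arrowMap ω g ∘ₗ F x = F y ∘ₗ D.arrowMap ω g) {x y : Lam d} (m : U.of x ⟶ U.of y)
    (hx : x ∈ S) (hy : y ∈ S) : mapU hM m ∘ₗ F x = F y ∘ₗ mapU hM m := by
  obtain ⟨w, t, p, ht, hp, rfl⟩ := exists_factorization m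
  have h1 := comm_down (hM := hM) hS hF ht hx
  rw [mapU_comp, LinearMap.comp_assoc, h1.2, ← LinearMap.comp_assoc, comm_up hS hF hp hy]
  rfl

end

/-- A family of endomorphisms which commutes with the generators is a natural transformation. -/
noncomputable def mkEnd (hM : D.Compatible ω) (F : ∀ x : Lam d, D.obj x →ₗ[k] D.obj x)
    {S : Set (Lam d)} (hS : IsLowerSet S)
    (hF : ∀ ⦃x y⦄ (g : Arrow d x y), x ∈ S → y ∈ S →
      D.arrowMap ω g ∘ₗ F x = F y ∘ₗ D.arrowMap ω g) : EndOn (D.M ω hM) S where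
  app X := ModuleCat.ofHom (F X.obj.lam)
  naturality X Y m := ModuleCat.hom_ext (comm_of_arrow (hM := hM) hS hF
    (x := X.obj.lam) (y := Y.obj.lam) m.hom X.property Y.property).symm

/-- The components of a natural endomorphism. -/
noncomputable def endAt {hM : D.Compatible ω} {S : Set (Lam d)} (η : EndOn (D.M ω hM) S)
    {x : Lam d} (hx : x ∈ S) : D.obj x →ₗ[k] D.obj x := (η.app ⟨U.of x, hx⟩).hom

section

variable {hM : D.Compatible ω} {S : Set (Lam d)}

lemma endAt_mkEnd {F : ∀ x : Lam d, D.obj x →ₗ[k] D.obj x} {hS : IsLowerSet S} {hF} {x : Lam d}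
    (hx : x ∈ S) : endAt (mkEnd hM F hS hF) hx = F x := rfl

lemma endAt_ext {η η' : EndOn (D.M ω hM) S} (h : ∀ x (hx : x ∈ S), endAt η hx = endAt η' hx) :
    η = η' := by
  apply NatTrans.ext
  funext X
  exact ModuleCat.hom_ext (h X.obj.lam X.property)

lemma mapU_comp_endAt (η : EndOn (D.M ω hM) S) {x y : Lam d} (m : U.of x ⟶ U.of y) (hx : x ∈ S)
    (hy : y ∈ S) : mapU hM m ∘ₗ endAt η hx = endAt η hy ∘ₗ mapU hM m := by
  have := η.naturality (X := ⟨U.of x, hx⟩) (Y := ⟨U.of y, hy⟩) (ObjectProperty.homMk m)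
  exact (congrArg ModuleCat.Hom.hom this).symm

lemma endAt_restrict {T : Set (Lam d)} (h : S ⊆ T) (η : EndOn (D.M ω hM) T) {x : Lam d}
    (hx : x ∈ S) : endAt (restrict (D.M ω hM) h η) hx = endAt η (h hx) := rfl

lemma endAt_add (η η' : EndOn (D.M ω hM) S) {x : Lam d} (hx : x ∈ S) :
    endAt (η + η') hx = endAt η hx + endAt η' hx := rfl

lemma endAt_smul (c : k) (η : EndOn (D.M ω hM) S) {x : Lam d} (hx : x ∈ S) :
    endAt (c • η) hx = c • endAt η hx := rfl

end

end QuadraticData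

/-! ### Gluing linear maps on a distributive family -/

section Glue

variable {k : Type*} [Field k] {P E : Type*} [AddCommGroup P] [Module k P] [AddCommGroup E]
  [Module k E]

lemma exists_eqOn_eqOn {A B : Submodule k P} (f g : P →ₗ[k] E) (h : ∀ x ∈ A ⊓ B, f x = g x) :
    ∃ l : P →ₗ[k] E, (∀ x ∈ A, l x = f x) ∧ ∀ x ∈ B, l x = g x := by
  let F : P →ₗ.[k] E := ⟨A, f ∘ₗ A.subtype⟩
  let G : P →ₗ.[k] E := ⟨B, g ∘ₗ B.subtype⟩
  have hFG : ∀ (x : F.domain) (y : G.domain), (x : P) = y → F x = G y := by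
    rintro ⟨x, hx⟩ ⟨y, hy⟩ (rfl : x = y)
    exact h x ⟨hx, hy⟩
  obtain ⟨l, hl⟩ := (F.sup G hFG).toFun.exists_extend
  refine ⟨l, fun x hx => ?_, fun x hx => ?_⟩
  · have h1 := (LinearPMap.left_le_sup F G hFG).1 (x := x) hx
    have h2 := (LinearPMap.left_le_sup F G hFG).2 (x := ⟨x, hx⟩) (y := ⟨x, h1⟩) rfl
    exact (LinearMap.congr_fun hl ⟨x, h1⟩).trans h2.symm
  · have h1 := (LinearPMap.right_le_sup F G hFG).1 (x := x) hx
    have h2 := (LinearPMap.right_le_sup F G hFG).2 (x := ⟨x, hx⟩) (y := ⟨x, h1⟩) rfl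
    exact (LinearMap.congr_fun hl ⟨x, h1⟩).trans h2.symm

/-- Linear maps which agree on the pairwise intersections of a distributive family of subspaces can
be glued. -/
lemma exists_glue {ι : Type*} (S : Finset ι) (X : ι → Submodule k P) (f : ι → P →ₗ[k] E)
    (hd : ∀ S' ⊆ S, ∀ j ∈ S, j ∉ S' → S'.sup X ⊓ X j ≤ S'.sup fun i => X i ⊓ X j)
    (hf : ∀ i ∈ S, ∀ j ∈ S, ∀ x ∈ X i ⊓ X j, f i x = f j x) :
    ∃ l : P →ₗ[k] E, ∀ i ∈ S, ∀ x ∈ X i, l x = f i x := by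
  classical
  induction S using Finset.induction_on with
  | empty => exact ⟨0, by simp⟩
  | insert j S hj ih =>
    obtain ⟨l, hl⟩ := ih
      (fun S' hS' i hi => hd S' (hS'.trans (Finset.subset_insert _ _)) i (Finset.mem_insert_of_mem hi))
      (fun i hi i' hi' => hf i (Finset.mem_insert_of_mem hi) i' (Finset.mem_insert_of_mem hi'))
    -- Distributivity reduces agreement on the intersection of `X j` with the sum to agreement on
    -- the pairwise intersections.
    have h1 : S.sup X ⊓ X j ≤ LinearMap.eqLocus l (f j) := by
      refine (hd S (Finset.subset_insert _ _) j (Finset.mem_insert_self _ _) hj).trans ?_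
      refine Finset.sup_le fun i hi x hx => ?_
      exact (hl i hi x hx.1).trans
        (hf i (Finset.mem_insert_of_mem hi) j (Finset.mem_insert_self _ _) x hx)
    obtain ⟨l', h2, h3⟩ := exists_eqOn_eqOn l (f j) fun x hx => h1 hx
    refine ⟨l', fun i hi x hx => ?_⟩
    rcases Finset.mem_insert.1 hi with rfl | hi
    · exact h3 x hx
    · exact (h2 x ((Finset.le_sup (f := X) hi : X i ≤ S.sup X) hx)).trans (hl i hi x hx)

end Glue

/-! ### Positions in a word and block conditions -/

/-- The positions inside the letters of a word. -/
def inner : List ℕ → Finset ℕ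
  | [] => ∅
  | a :: l => Finset.range (a - 1) ∪ (inner l).image (a + ·)

lemma add_two_le_of_mem_inner : ∀ {l : List ℕ}, ∀ {c}, c ∈ inner l → c + 2 ≤ l.sum
  | [], c, h => by simp [inner] at h
  | a :: l, c, h => by
    rw [inner, Finset.mem_union, Finset.mem_range, Finset.mem_image] at h
    rw [List.sum_cons]
    rcases h with h | ⟨c, h, rfl⟩
    · omega
    · have := add_two_le_of_mem_inner h
      omega

lemma inner_append : ∀ l l' : List ℕ, inner (l ++ l') = inner l ∪ (inner l').image (l.sum + ·)
  | [], l' => by simp [inner]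
  | a :: l, l' => by
    rw [List.cons_append, inner, inner, inner_append l l', Finset.image_union, Finset.image_image,
      Finset.union_assoc]
    congr 3
    funext x
    simp [add_assoc]

lemma not_mem_inner_append {l l' : List ℕ} {c : ℕ} (h : c + 1 = l.sum) : c ∉ inner (l ++ l') := by
  rw [inner_append, Finset.mem_union, Finset.mem_image]
  rintro (h' | ⟨x, -, rfl⟩)
  · have := add_two_le_of_mem_inner h'; omega
  · omega

/-- Merging two adjacent letters `a`, `b` imposes one new block condition, at the position
straddling their boundary; this is `c`, one less than the number of tensor factors up to the end of
`a`. -/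
lemma inner_merge (l l' : List ℕ) {a b c : ℕ} (ha : 0 < a) (hb : 0 < b) (h : c + 1 = l.sum + a) :
    inner (l ++ (a + b) :: l') = insert c (inner (l ++ a :: b :: l')) := by
  rw [inner_append, inner_append, ← Finset.union_insert]
  congr 1
  obtain rfl : c = l.sum + (a - 1) := by omega
  rw [← Finset.image_insert (l.sum + ·)]
  congr 1
  simp only [inner, Finset.image_union, Finset.image_image]
  ext x
  simp only [Finset.mem_union, Finset.mem_insert, Finset.mem_range, Finset.mem_image,
    Function.comp_apply, add_assoc]
  constructor
  · rintro (h | h)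
    · rcases lt_trichotomy x (a - 1) with h' | h' | h'
      · exact Or.inr (Or.inl h')
      · exact Or.inl h'
      · exact Or.inr (Or.inr (Or.inl ⟨x - a, by omega, by omega⟩))
    · exact Or.inr (Or.inr (Or.inr h))
  · rintro (h | h | ⟨y, h, rfl⟩ | h)
    · left; omega
    · left; omega
    · left; omega
    · right; exact h

namespace QuadraticData

variable {k : Type u} [Field k] {V : Type u} [AddCommGroup V] [Module k V] {D : QuadraticData k V}
  {d : ℕ} {ω : D.R d}

/-- The degree of an element of `Λ`, i.e. the sum of the indices of its letters. -/
def deg (u : Lam d) : ℕ := (word u).sum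

lemma deg_mul (u v : Lam d) : deg (u * v) = deg u + deg v := by
  rw [deg, word_mul, List.sum_append]; rfl

lemma deg_r {a : ℕ} (h : a < d) : deg (r d a) = a := by
  rcases Nat.eq_zero_or_pos a with rfl | h'
  · rw [deg, word_zero]; rfl
  · rw [deg, word_r ⟨h', h⟩]; simp

lemma pos_of_mem_word {u : Lam d} : ∀ x ∈ word u, 0 < x := by
  induction u using Lam.induction_left with
  | one => rw [← rd_zero, word_rd]; simp
  | letter_mul a u ih =>
    rw [word_mul, ← r_eq_letter, word_r a.2]
    intro x hx
    rcases List.mem_cons.1 hx with rfl | hx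
    · exact a.2.1
    · exact ih x hx
  | rd_mul n u ih => rw [word_mul, word_rd]; exact ih

lemma prod_map_R : ∀ {l : List ℕ}, (∀ x ∈ l, 0 < x) →
    (l.map D.R).prod = gens k V ^ l.sum ⊓ (inner l).inf (D.block l.sum)
  | [], _ => by simp [inner]
  | a :: l, h => by
    rw [List.map_cons, List.prod_cons, prod_map_R fun x hx => h x (List.mem_cons_of_mem _ hx),
      D.R_eq_inf (h a List.mem_cons_self), D.inf_block_mul_inf_block, inner, List.sum_cons]
    · intro i hi
      rw [Finset.mem_range] at hi
      omega
    · intro i hi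
      exact add_two_le_of_mem_inner hi

/-- The image of a generator `φ`, in terms of the subspaces `V^i R V^j`. -/
lemma Rw_mul_R_mul_Rw {l u v : Lam d} {a b c : ℕ} (ha : 0 < a) (hb : 0 < b) (hab : a + b ≤ d)
    (hl : l = u * (r d a * r d b) * v) (hc : c + 1 = deg u + a) :
    D.Rw u * D.R (a + b) * D.Rw v =
      gens k V ^ deg l ⊓ (insert c (inner (word l))).inf (D.block (deg l)) := by
  have hw : word l = word u ++ a :: b :: word v := by
    rw [hl, word_mul, word_mul, word_mul, word_r (by omega), word_r (by omega)]
    simp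
  have h1 : deg l = (word u ++ (a + b) :: word v).sum := by
    rw [deg, hw]; simp [add_assoc]
  rw [hw, ← inner_merge _ _ ha hb hc, h1, ← prod_map_R]
  · simp [Rw, mul_assoc]
  · intro x hx
    rw [List.mem_append, List.mem_cons] at hx
    rcases hx with hx | rfl | hx
    · exact pos_of_mem_word x hx
    · omega
    · exact pos_of_mem_word x hx

end QuadraticData

/-! ### The generators `φ` with a given target -/

section

variable {d : ℕ}

/-- The whiskered generators `φ`. -/
inductive IsPhi : ∀ {x y : Lam d}, Arrow d x y → Prop
  | mk (u v : Lam d) {a b : ℕ} (ha : 0 < a) (hb : 0 < b) (hab : a + b ≤ d) {x y : Lam d}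
      (hx : x = u * r d (a + b) * v) (hy : y = u * (r d a * r d b) * v) :
      IsPhi (phiA u v ha hb hab hx hy)

/-- The whiskered generators `φ` with target `l`. -/
structure PhiInto (l : Lam d) where
  /-- The factor on the left. -/
  u : Lam d
  /-- The factor on the right. -/
  v : Lam d
  /-- The first index. -/
  a : ℕ
  /-- The second index. -/
  b : ℕ
  ha : 0 < a
  hb : 0 < b
  hab : a + b ≤ d
  hl : l = u * (r d a * r d b) * v

namespace PhiInto

variable {l : Lam d} (i j : PhiInto l)

/-- The source. -/
def src : Lam d := i.u * r d (i.a + i.b) * i.v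

/-- The arrow. -/
def arrow : Arrow d i.src l := phiA i.u i.v i.ha i.hb i.hab rfl i.hl

lemma isPhi : IsPhi i.arrow := .mk _ _ _ _ _ _ _

/-- The position. -/
def pos : ℕ := QuadraticData.deg i.u + i.a - 1

lemma pos_add_one : i.pos + 1 = QuadraticData.deg i.u + i.a := by
  have := i.ha
  rw [pos]; omega

lemma eq_letter : l = i.u * (letter ⟨i.a, i.ha, by have := i.hb; have := i.hab; omega⟩ * rd d 0 *
    letter ⟨i.b, i.hb, by have := i.ha; have := i.hab; omega⟩) * i.v := by
  rw [rd_zero, mul_one, ← r_eq_letter, ← r_eq_letter]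
  exact i.hl

lemma ext' (h : i.u = j.u ∧ i.a = j.a ∧ i.b = j.b ∧ i.v = j.v) : i = j := by
  obtain ⟨u, v, a, b, _, _, _, _⟩ := i
  obtain ⟨u', v', a', b', _, _, _, _⟩ := j
  obtain ⟨rfl, rfl, rfl, rfl⟩ := h
  rfl

/-- Two distinct generators merge pairs of adjacent letters that either share a letter or are
disjoint. -/
lemma cases_of_len_lt (h : len i.u < len j.u) :
    (j.u = i.u * r d i.a ∧ j.a = i.b ∧ i.v = r d j.b * j.v) ∨
    ∃ w, j.u = i.u * (r d i.a * r d i.b) * w ∧ i.v = w * (r d j.a * r d j.b) * j.v := by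
  have h1 := i.eq_letter.symm.trans j.eq_letter
  rcases (Nat.succ_le_of_lt h).eq_or_lt with h2 | h2
  · obtain ⟨h3, h4, h5⟩ := pair_adjacent h1 h2.symm
    rw [rd_zero, mul_one, ← r_eq_letter] at h3
    rw [rd_zero, one_mul, ← r_eq_letter] at h5
    exact Or.inl ⟨h3, (congrArg Subtype.val h4).symm, h5⟩
  · obtain ⟨w, h3, h4⟩ := pair_disjoint h1 h2
    simp only [rd_zero, mul_one, ← r_eq_letter] at h3 h4
    exact Or.inr ⟨w, h3, h4⟩

lemma pos_lt_of_len_lt (h : len i.u < len j.u) : i.pos < j.pos := by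
  have h1 := i.pos_add_one
  have h2 := j.pos_add_one
  have h3 := j.ha
  have h4 := i.hab
  have h5 := i.hb
  have h6 : QuadraticData.deg i.u + i.a ≤ QuadraticData.deg j.u := by
    rcases i.cases_of_len_lt j h with ⟨h, -⟩ | ⟨w, h, -⟩
    · rw [h, QuadraticData.deg_mul, QuadraticData.deg_r (by omega)]
    · rw [h, QuadraticData.deg_mul, QuadraticData.deg_mul, QuadraticData.deg_mul,
        QuadraticData.deg_r (a := i.a) (by omega)]
      omega
  omega

lemma eq_of_len_eq (h : len i.u = len j.u) : i = j := by
  obtain ⟨h1, h2, -, h3, h4⟩ := pair_eq (i.eq_letter.symm.trans j.eq_letter) h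
  exact i.ext' j ⟨h1, congrArg Subtype.val h2, congrArg Subtype.val h3, h4⟩

/-- A generator into `l` is determined by the boundary it removes, so generators can be indexed by
the natural numbers that index the blocks. -/
lemma pos_injective : Function.Injective (pos : PhiInto l → ℕ) := by
  intro i j h
  rcases lt_trichotomy (len i.u) (len j.u) with h' | h' | h'
  · exact absurd h (i.pos_lt_of_len_lt j h').ne
  · exact i.eq_of_len_eq j h'
  · exact absurd h (j.pos_lt_of_len_lt i h').ne'

end PhiInto

lemma IsPhi.exists_eq {x l : Lam d} {g : Arrow d x l} (h : IsPhi g) :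
    ∃ (i : PhiInto l) (hi : x = i.src), g = hi ▸ i.arrow := by
  cases h with
  | mk u v ha hb hab hx hy => subst hx; exact ⟨⟨u, v, _, _, ha, hb, hab, hy⟩, rfl, rfl⟩

end

/-! ### Extending endomorphisms along the generators `φ` -/

namespace QuadraticData

variable {k : Type u} [Field k] {V : Type u} [AddCommGroup V] [Module k V] {D : QuadraticData k V}
  {d : ℕ} {ω : D.R d}

lemma genMap_phi_injective (hF : D.IsFrobenius ω) {a b : ℕ} (ha : 0 < a) (hb : 0 < b)
    (hab : a + b ≤ d) : Function.Injective (D.genMap ω (.phi a b ha hb hab)) := by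
  intro m m' h
  have h1 := congrArg (D.ev _) h
  rw [genMap_phi, genMap_phi] at h1
  have h2 := congrArg (jr ω (a + b)) (Subtype.ext h1)
  rw [hF.jr_fromObj, hF.jr_fromObj] at h2
  exact D.ev_injective _ h2

lemma arrowMap_injective {x y : Lam d} (g : Arrow d x y)
    (h : Function.Injective (D.genMap ω g.gen)) : Function.Injective (D.arrowMap ω g) := by
  rw [arrowMap]
  simp only [LinearMap.coe_comp, LinearEquiv.coe_coe]
  refine (LinearEquiv.injective _).comp ((LinearEquiv.injective _).comp (Function.Injective.comp
    (Module.Flat.rTensor_preserves_injective_linearMap _ ?_)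
    ((LinearEquiv.injective _).comp (LinearEquiv.injective _))))
  simp only [LinearMap.coe_comp, LinearEquiv.coe_coe]
  exact (LinearEquiv.injective _).comp
    ((Module.Flat.lTensor_preserves_injective_linearMap _ h).comp (LinearEquiv.injective _))

lemma IsFrobenius.phi_injective (hF : D.IsFrobenius ω) {l : Lam d} (i : PhiInto l) :
    Function.Injective (D.arrowMap ω i.arrow) :=
  arrowMap_injective _ (genMap_phi_injective hF i.ha i.hb i.hab)

lemma phi_mem_Gr (hF : D.IsFrobenius ω) {u v x y : Lam d} {a b n : ℕ} (ha : 0 < a) (hb : 0 < b)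
    (hn : a + b = n) (hab : a + b ≤ d) (hx : x = u * r d (a + b) * v)
    (hy : y = u * (r d a * r d b) * v)
    {P Q : TensorAlgebra k V} (hP : P ∈ D.Rw u) (hQ : Q ∈ D.Rw v) (z : D.R n) :
    (P * jr ω n z * Q, P * z * Q) ∈ D.Gr (D.arrowMap ω (phiA u v ha hb hab hx hy)) := by
  subst hn
  have := phi_mem_GrM hF ha hb hab hx hy hP hQ z
  rw [phi, dif_pos ⟨ha, hb⟩, GrM, preM_map_arr] at this
  exact this

lemma arrowMap_mem_of_le {x y : Lam d} {g : D.obj x →ₗ[k] D.obj y}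
    {E : Submodule k (TensorAlgebra k V)}
    (h : D.Rw x ≤ (D.Gr g ⊓ Submodule.prod ⊤ E).map (LinearMap.fst k _ _)) (z : D.obj x) :
    D.ev y (g z) ∈ E := by
  obtain ⟨⟨A, B⟩, ⟨h1, h2⟩, h3⟩ := h (D.ev_mem x z)
  rw [ev_apply_of_mem_Gr h1 h3.symm]
  exact h2.2

lemma exists_of_le {x y : Lam d} {g : D.obj x →ₗ[k] D.obj y}
    {E : Submodule k (TensorAlgebra k V)}
    (h : E ≤ (D.Gr g).map (LinearMap.snd k _ _)) {A : TensorAlgebra k V} (hA : A ∈ E) :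
    ∃ z, D.ev y (g z) = A := by
  obtain ⟨⟨A', B⟩, h1, rfl⟩ := h hA
  obtain ⟨z, -, h2⟩ := mem_Gr.1 h1
  exact ⟨z, h2⟩

/-- The subspace of `TV` which corresponds to the image of a generator `φ`. -/
noncomputable def phiImage (D : QuadraticData k V) (l : Lam d) (c : ℕ) :
    Submodule k (TensorAlgebra k V) :=
  gens k V ^ deg l ⊓ (insert c (inner (word l))).inf (D.block (deg l))

lemma phiImage_pos {l : Lam d} (i : PhiInto l) :
    D.phiImage l i.pos = D.Rw i.u * D.R (i.a + i.b) * D.Rw i.v :=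
  (Rw_mul_R_mul_Rw i.ha i.hb i.hab i.hl i.pos_add_one).symm

lemma phi_mem_phiImage (hF : D.IsFrobenius ω) {l : Lam d} (i : PhiInto l) (z : D.obj i.src) :
    D.ev l (D.arrowMap ω i.arrow z) ∈ D.phiImage l i.pos := by
  rw [phiImage_pos]
  refine arrowMap_mem_of_le ?_ z
  change D.Rw (i.u * r d (i.a + i.b) * i.v) ≤ _
  rw [Rw_mul, Rw_mul]
  refine mul_mul_le fun P hP S hS Q hQ => ?_
  obtain ⟨s, rfl⟩ := (hF.mem_Rw_r (by have := i.ha; omega) i.hab).1 hS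
  exact ⟨_, ⟨phi_mem_Gr hF i.ha i.hb rfl i.hab rfl i.hl hP hQ s, trivial,
    Submodule.mul_mem_mul (Submodule.mul_mem_mul hP s.2) hQ⟩, rfl⟩

/-- Intersecting two images unites their block conditions, and these are the conditions of the word
with both merges performed. Overlapping merges give a single factor `R_{a+b+c}`, disjoint ones give
two merged factors. -/
lemma phiImage_inf_phiImage_le {l : Lam d} {i j : PhiInto l} (h : len i.u < len j.u) :
    (j.u = i.u * r d i.a ∧ j.a = i.b ∧ i.v = r d j.b * j.v ∧
      D.phiImage l i.pos ⊓ D.phiImage l j.pos ≤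
        D.Rw i.u * D.R (i.a + i.b + j.b) * D.Rw j.v) ∨
    ∃ w, j.u = i.u * (r d i.a * r d i.b) * w ∧ i.v = w * (r d j.a * r d j.b) * j.v ∧
      D.phiImage l i.pos ⊓ D.phiImage l j.pos ≤
        D.Rw i.u * D.R (i.a + i.b) * D.Rw w * D.R (j.a + j.b) * D.Rw j.v := by
  have key : ∀ (L : List ℕ), (∀ x ∈ L, 0 < x) → L.sum = deg l →
      inner L ⊆ insert i.pos (insert j.pos (inner (word l))) →
      D.phiImage l i.pos ⊓ D.phiImage l j.pos ≤ (L.map D.R).prod := by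
    intro L hL h1 h2
    rw [prod_map_R hL, h1]
    refine le_inf (inf_le_left.trans inf_le_left) (le_trans ?_ (Finset.inf_mono h2))
    rw [phiImage, phiImage, ← inf_inf_distrib_left, ← Finset.inf_union]
    refine inf_le_right.trans (Finset.inf_mono ?_)
    intro c
    simp only [Finset.mem_insert, Finset.mem_union]
    tauto
  have hi := i.pos_add_one
  have hj := j.pos_add_one
  have hia := i.ha
  have hib := i.hb
  have hiab := i.hab
  have hja := j.ha
  have hjb := j.hb
  have hjab := j.hab
  have hwl : word l = word i.u ++ i.a :: i.b :: word i.v := by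
    conv_lhs => rw [i.hl]
    rw [word_mul, word_mul, word_mul, word_r (by omega), word_r (by omega)]
    simp
  rcases i.cases_of_len_lt j h with ⟨h1, h2, h3⟩ | ⟨w, h1, h2⟩
  · refine Or.inl ⟨h1, h2, h3, ?_⟩
    have hw : word i.v = j.b :: word j.v := by
      rw [h3, word_mul, word_r (by omega)]; rfl
    rw [h1, deg_mul, deg_r (by omega), h2] at hj
    refine (key (word i.u ++ (i.a + i.b + j.b) :: word j.v) ?_ ?_ ?_).trans ?_
    · intro x hx
      rw [List.mem_append, List.mem_cons] at hx
      rcases hx with hx | rfl | hx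
      · exact pos_of_mem_word x hx
      · omega
      · exact pos_of_mem_word x hx
    · rw [deg, hwl, hw]; simp [add_assoc]
    · rw [inner_merge _ _ (by omega) hjb (c := j.pos) (by rw [hj, deg, add_assoc]),
        inner_merge _ _ hia hib hi, Finset.insert_comm, hwl, hw]
    · simp [Rw, mul_assoc]
  · refine Or.inr ⟨w, h1, h2, ?_⟩
    have hw : word i.v = word w ++ j.a :: j.b :: word j.v := by
      rw [h2, word_mul, word_mul, word_mul, word_r (by omega), word_r (by omega)]; simp
    rw [h1, deg_mul, deg_mul, deg_mul, deg_r (by omega), deg_r (by omega)] at hj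
    refine (key (word i.u ++ (i.a + i.b) :: (word w ++ (j.a + j.b) :: word j.v)) ?_ ?_ ?_).trans ?_
    · intro x hx
      simp only [List.mem_append, List.mem_cons] at hx
      rcases hx with hx | rfl | hx | rfl | hx
      · exact pos_of_mem_word x hx
      · omega
      · exact pos_of_mem_word x hx
      · omega
      · exact pos_of_mem_word x hx
    · rw [deg, hwl, hw]; simp [add_assoc]
    · rw [inner_merge _ _ hia hib hi, hwl, hw]
      apply Finset.insert_subset_insert
      have e : ∀ L : List ℕ, word i.u ++ i.a :: i.b :: (word w ++ L) =
        (word i.u ++ i.a :: i.b :: word w) ++ L := by intro L; simp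
      rw [e, e, inner_merge _ _ hja hjb (c := j.pos) (by rw [hj]; simp [deg, add_assoc])]
    · simp [Rw, mul_assoc]

lemma aM_phi_phi {x y y' l u v : Lam d} {a b c : ℕ} (ha : 0 < a) (hb : 0 < b) (hc : 0 < c)
    (h : a + b + c ≤ d) (hx : x = u * r d (a + b + c) * v) (hy : y = u * (r d (a + b) * r d c) * v)
    (hl : l = u * (r d a * r d b) * (r d c * v)) (hy₁ : y = u * r d (a + b) * (r d c * v))
    (hx' : x = u * r d (a + (b + c)) * v) (hy' : y' = u * (r d a * r d (b + c)) * v)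
    (hy₁' : y' = u * r d a * r d (b + c) * v) (hl' : l = u * r d a * (r d b * r d c) * v) :
    aM (phiA u v (by omega) hc h hx hy) ≫ aM (phiA u (r d c * v) ha hb (by omega) hy₁ hl) =
      aM (phiA u v ha (by omega) (by omega) hx' hy') ≫
        aM (phiA (u * r d a) v hb hc (by omega) hy₁' hl') := by
  obtain rfl : l = u * (r d a * r d b * r d c) * v := by rw [hl]; simp only [mul_assoc]
  subst hx hy hy'
  have := toU_eq_of_rel (Rel.phi_phi u v a b c ha hb hc h)
  rw [toU_comp, toU_comp, toU_phi (by omega) (by omega), toU_phi hb hc, toU_phi (by omega) hc,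
    toU_phi ha hb] at this
  exact this.symm

lemma aM_phi_interchange {x y y' l u v w : Lam d} {a b c e : ℕ} (ha : 0 < a) (hb : 0 < b)
    (hab : a + b ≤ d) (hc : 0 < c) (he : 0 < e) (hce : c + e ≤ d)
    (hx : x = u * r d (a + b) * w * r d (c + e) * v)
    (hy : y = u * r d (a + b) * w * (r d c * r d e) * v)
    (hy₁ : y = u * r d (a + b) * (w * (r d c * r d e) * v))
    (hl : l = u * (r d a * r d b) * (w * (r d c * r d e) * v))
    (hx' : x = u * r d (a + b) * (w * r d (c + e) * v))
    (hy' : y' = u * (r d a * r d b) * (w * r d (c + e) * v))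
    (hy₁' : y' = u * (r d a * r d b) * w * r d (c + e) * v)
    (hl' : l = u * (r d a * r d b) * w * (r d c * r d e) * v) :
    aM (phiA _ v hc he hce hx hy) ≫ aM (phiA u _ ha hb hab hy₁ hl) =
      aM (phiA u _ ha hb hab hx' hy') ≫ aM (phiA _ v hc he hce hy₁' hl') := by
  subst hx hy hl' hy₁'
  have := toU_eq_of_rel (Rel.interchange u w v (.phi a b ha hb hab) (.phi c e hc he hce))
  rw [toU_comp, toU_comp] at this
  exact this.symm

lemma mem_Gr_arrow_comp (hM : D.Compatible ω) {x y y' l : Lam d} {g : Arrow d x y} {h : Arrow d y l}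
    {g' : Arrow d x y'} {h' : Arrow d y' l} (e : aM g ≫ aM h = aM g' ≫ aM h') :
    D.arrowMap ω h ∘ₗ D.arrowMap ω g = D.arrowMap ω h' ∘ₗ D.arrowMap ω g' := by
  have := congrArg (mapU hM) e
  rwa [mapU_comp, mapU_comp, mapU_aM, mapU_aM, mapU_aM, mapU_aM] at this

variable [FiniteDimensional k V]

/-- The doubly merged word is an object of `𝒰` mapping to both sources, and the square commutes by
the `φφ` relation or by interchange. -/
lemma IsFrobenius.exists_common (hF : D.IsFrobenius ω) {l : Lam d} {i j : PhiInto l}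
    (h : len i.u < len j.u) {A : TensorAlgebra k V}
    (hA : A ∈ D.phiImage l i.pos ⊓ D.phiImage l j.pos) :
    A = 0 ∨ ∃ (x : Lam d) (g : Arrow d x i.src) (g' : Arrow d x j.src) (z : D.obj x),
      IsPhi g ∧ IsPhi g' ∧
      D.arrowMap ω i.arrow ∘ₗ D.arrowMap ω g = D.arrowMap ω j.arrow ∘ₗ D.arrowMap ω g' ∧
      D.ev l ((D.arrowMap ω i.arrow ∘ₗ D.arrowMap ω g) z) = A := by
  have hM := hF.compatible
  rcases phiImage_inf_phiImage_le (D := D) h with ⟨h1, h2, h3, h4⟩ | ⟨w, h1, h2, h4⟩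
  · by_cases hd : i.a + i.b + j.b ≤ d
    · right
      have h5 := h4 hA
      clear h hA h4
      obtain ⟨u, v, a, b, ha, hb, hab, hl⟩ := i
      obtain ⟨u', v', b', c, hb', hc, hbc, hl'⟩ := j
      dsimp only at h1 h2 h3 hd h5
      subst h1 h2 h3
      have e := aM_phi_phi (u := u) (v := v') ha hb hc hd rfl (y := u * r d (a + b') * (r d c * v'))
        (by simp only [mul_assoc]) hl rfl (by rw [add_assoc]) (y' := u * r d a * r d (b' + c) * v')
        (by simp only [mul_assoc]) rfl hl'
      have e' := mem_Gr_arrow_comp hM e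
      suffices hz : ∃ z, D.ev l ((D.arrowMap ω (phiA u (r d c * v') ha hb hab rfl hl) ∘ₗ
          D.arrowMap ω (phiA u v' (by omega : 0 < a + b') hc hd rfl
            (y := u * r d (a + b') * (r d c * v')) (by simp only [mul_assoc]))) z) = A by
        obtain ⟨z, hz⟩ := hz
        exact ⟨_, _, _, z, .mk _ _ _ _ _ _ _, .mk _ _ _ _ _ _ _, e', hz⟩
      refine exists_of_le (mul_mul_le fun P hP S hS Q hQ => ?_) h5
      refine ⟨(P * jr ω _ ⟨S, hS⟩ * Q, P * S * Q), mem_Gr_comp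
        (phi_mem_Gr hF _ hc rfl hd rfl _ hP hQ ⟨S, hS⟩) ?_, rfl⟩
      have h6 : (P * S * Q : TensorAlgebra k V) ∈ D.Rw (u * r d (a + b') * (r d c * v')) := by
        rw [Rw_mul, Rw_mul, Rw_mul, D.Rw_r_of_lt (a := a + b') (by omega),
          D.Rw_r_of_lt (a := c) (by omega), ← mul_assoc, mul_assoc (D.Rw u)]
        exact Submodule.mul_mem_mul (Submodule.mul_mem_mul hP
          (D.R_add_le (by omega) hc hS)) hQ
      have := phi_mem_GrM_of_lt hF (a := a) (b := b') (by omega) rfl hl h6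
      rw [phi, dif_pos ⟨ha, hb⟩, GrM, preM_map_arr] at this
      exact this
    -- The merged index may exceed `d`, so that no such object exists; then the factor `R_{a+b+c}`,
    -- and with it the intersection, is zero.
    · left
      rw [hF.eq_bot _ (not_le.1 hd), Submodule.mul_bot, Submodule.bot_mul] at h4
      simpa using h4 hA
  · right
    have h5 := h4 hA
    clear h hA h4
    obtain ⟨u, v, a, b, ha, hb, hab, hl⟩ := i
    obtain ⟨u', v', c, e, hc, he, hce, hl'⟩ := j
    dsimp only at h1 h2 h5
    subst h1 h2
    have e₀ := aM_phi_interchange (u := u) (v := v') (w := w) ha hb hab hc he hce rfl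
      (y := u * r d (a + b) * (w * (r d c * r d e) * v'))
      (by simp only [mul_assoc]) rfl hl (by simp only [mul_assoc])
      (y' := u * (r d a * r d b) * w * r d (c + e) * v')
      (by simp only [mul_assoc]) rfl hl'
    have e' := mem_Gr_arrow_comp hM e₀
    suffices hz : ∃ z, D.ev l ((D.arrowMap ω (phiA u _ ha hb hab rfl hl) ∘ₗ
        D.arrowMap ω (phiA (u * r d (a + b) * w) v' hc he hce rfl
          (y := u * r d (a + b) * (w * (r d c * r d e) * v')) (by simp only [mul_assoc]))) z) = A by
      obtain ⟨z, hz⟩ := hz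
      exact ⟨_, _, _, z, .mk _ _ _ _ _ _ _, .mk _ _ _ _ _ _ _, e', hz⟩
    refine exists_of_le (mul_mul_le fun X hX S' hS' Q hQ => ?_) h5
    rw [mul_assoc X]
    refine mul_mem_of_mem_mul_mul hX fun P hP S hS W hW => ?_
    refine ⟨(P * jr ω _ ⟨S, hS⟩ * (W * jr ω _ ⟨S', hS'⟩ * Q), P * S * (W * S' * Q)), mem_Gr_comp
        (B := P * jr ω _ ⟨S, hS⟩ * (W * S' * Q)) ?_
        (phi_mem_Gr hF ha hb rfl hab rfl hl hP ?_ ⟨S, hS⟩), ?_⟩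
    · have h6 := phi_mem_Gr hF hc he rfl hce (rfl : _ = u * r d (a + b) * w * _ * v')
        (show u * r d (a + b) * (w * (r d c * r d e) * v') = _ by simp only [mul_assoc])
        (mul_mem_Rw (mul_mem_Rw hP ((hF.mem_Rw_r (by omega) hab).2 ⟨⟨S, hS⟩, rfl⟩)) hW) hQ ⟨S', hS'⟩
      simpa only [mul_assoc] using h6
    · refine mul_mem_Rw (mul_mem_Rw hW ?_) hQ
      rw [Rw_mul, D.Rw_r_of_lt (a := c) (by omega), D.Rw_r_of_lt (a := e) (by omega)]
      exact D.R_add_le hc he hS'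
    · simp only [LinearMap.snd_apply, mul_assoc]

/-- Endomorphisms that commute with the generators `φ` strictly below `λ` extend to `λ`. -/
theorem IsFrobenius.exists_comm_phi (hF : D.IsFrobenius ω) (hK : D.IsKoszul) (l : Lam d)
    (η : ∀ x : Lam d, D.obj x →ₗ[k] D.obj x)
    (hη : ∀ ⦃x y⦄ (g : Arrow d x y) (h : Arrow d y l), IsPhi g → IsPhi h →
      D.arrowMap ω g ∘ₗ η x = η y ∘ₗ D.arrowMap ω g) :
    ∃ f : D.obj l →ₗ[k] D.obj l, ∀ ⦃x⦄ (g : Arrow d x l), IsPhi g →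
      f ∘ₗ D.arrowMap ω g = D.arrowMap ω g ∘ₗ η x := by
  classical
  -- Each `φ` is injective, so the required value on its image is well defined; extended to `TV`, it
  -- is one of the maps to be glued.
  have h1 : ∀ i : PhiInto l, ∃ f : TensorAlgebra k V →ₗ[k] D.obj l,
      f ∘ₗ (D.ev l ∘ₗ D.arrowMap ω i.arrow) = D.arrowMap ω i.arrow ∘ₗ η i.src := by
    intro i
    obtain ⟨f, hf⟩ := (D.ev l ∘ₗ D.arrowMap ω i.arrow).exists_leftInverse_of_injective
      (LinearMap.ker_eq_bot.2 ((D.ev_injective l).comp (hF.phi_injective i)))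
    exact ⟨(D.arrowMap ω i.arrow ∘ₗ η i.src) ∘ₗ f, by
      rw [LinearMap.comp_assoc, hf, LinearMap.comp_id]⟩
  choose f hf using h1
  have hlt : ∀ i j : PhiInto l, len i.u < len j.u → ∀ A ∈ D.phiImage l i.pos ⊓ D.phiImage l j.pos,
      f i A = f j A := by
    intro i j h A hA
    rcases hF.exists_common h hA with rfl | ⟨x, g, g', z, hg, hg', h2, rfl⟩
    · rw [map_zero, map_zero]
    · have h3 := LinearMap.congr_fun (hf i) (D.arrowMap ω g z)
      have h4 := LinearMap.congr_fun (hf j) (D.arrowMap ω g' z)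
      have h5 := LinearMap.congr_fun (hη g i.arrow hg i.isPhi) z
      have h6 := LinearMap.congr_fun (hη g' j.arrow hg' j.isPhi) z
      have h7 := LinearMap.congr_fun h2 z
      have h8 := LinearMap.congr_fun h2 (η x z)
      simp only [LinearMap.comp_apply] at h3 h4 h5 h6 h7 h8 ⊢
      rw [h3, ← h5, h7, h4, ← h6, h8]
  have hall : ∀ i j : PhiInto l, ∀ A ∈ D.phiImage l i.pos ⊓ D.phiImage l j.pos, f i A = f j A := by
    intro i j A hA
    rcases lt_trichotomy (len i.u) (len j.u) with h | h | h
    · exact hlt i j h A hA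
    · rw [i.eq_of_len_eq j h]
    · exact (hlt j i h A hA.symm).symm
  have hbound : ∀ i : PhiInto l, i.pos + 2 ≤ deg l ∧ i.pos ∉ inner (word l) := by
    intro i
    have h2 := i.pos_add_one
    have h3 := i.ha
    have h4 := i.hb
    have h5 := i.hab
    have hw : word l = (word i.u ++ [i.a]) ++ i.b :: word i.v := by
      conv_lhs => rw [i.hl]
      rw [word_mul, word_mul, word_mul, word_r (by omega), word_r (by omega)]
      simp
    refine ⟨?_, ?_⟩
    · rw [deg, hw]
      simp [deg] at h2 ⊢
      omega
    · rw [hw]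
      exact not_mem_inner_append (by rw [h2]; simp [deg])
  -- The family is indexed by positions, to which distributivity of blocks applies;
  -- `PhiInto.pos_injective` identifies the chosen generator afterwards.
  let S : Finset ℕ := (Finset.range (deg l)).filter fun c => ∃ i : PhiInto l, i.pos = c
  have hS : ∀ c ∈ S, ∃ i : PhiInto l, i.pos = c := fun c hc => (Finset.mem_filter.1 hc).2
  obtain ⟨L, hL⟩ := exists_glue S (D.phiImage l)
    (fun c => if h : ∃ i : PhiInto l, i.pos = c then f h.choose else 0) (by
      intro S' hS' j hj hjS
      -- All images share the block conditions inside the letters of `l`, so these go to the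
      -- intersection side together with `j`.
      have hd := hK.distributive (deg l) S' (insert j (inner (word l)))
        (fun c hc => by
          obtain ⟨i, rfl⟩ := hS c (hS' hc)
          exact (hbound i).1)
        (fun c hc => by
          rcases Finset.mem_insert.1 hc with rfl | hc
          · obtain ⟨i, rfl⟩ := hS c hj
            exact (hbound i).1
          · exact add_two_le_of_mem_inner hc)
        (Finset.disjoint_left.2 fun c hc hc' => by
          rcases Finset.mem_insert.1 hc' with rfl | hc'
          · exact hjS hc
          · obtain ⟨i, rfl⟩ := hS c (hS' hc)
            exact (hbound i).2 hc')
      refine (inf_le_inf_right _ (Finset.sup_mono_fun fun c _ => ?_)).trans (hd.trans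
        (Finset.sup_mono_fun fun c _ => ?_))
      · exact inf_le_right.trans (Finset.inf_le (Finset.mem_insert_self _ _))
      · refine le_inf ?_ inf_le_right
        rw [phiImage, Finset.inf_insert, Finset.inf_insert]
        refine le_inf (inf_le_right.trans inf_le_left) (le_inf inf_le_left ?_)
        exact inf_le_right.trans (inf_le_right.trans inf_le_right))
    (by
      intro c hc c' hc' A hA
      rw [dif_pos (hS c hc), dif_pos (hS c' hc')]
      refine hall _ _ A ?_
      rwa [(hS c hc).choose_spec, (hS c' hc').choose_spec])
  refine ⟨L ∘ₗ D.ev l, fun x g hg => ?_⟩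
  obtain ⟨i, rfl, rfl⟩ := hg.exists_eq
  ext z
  have hi : i.pos ∈ S := Finset.mem_filter.2
    ⟨Finset.mem_range.2 (by have := (hbound i).1; omega), i, rfl⟩
  have h2 := hL _ hi _ (phi_mem_phiImage hF i z)
  rw [dif_pos (hS _ hi), PhiInto.pos_injective (hS _ hi).choose_spec] at h2
  exact h2.trans (LinearMap.congr_fun (hf i) z)

end QuadraticData

/-! ### Duality on `Λ` and the pairing of `M(u)` with `M(σ(u))` -/

section Duality

variable {d : ℕ}

/-- The antihomomorphism of `Λ` with prescribed values on the letters and `r_d^n ↦ r_d^{-n}`. -/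
def antiHom (f : Letter d → Lam d) : Lam d →* (Lam d)ᵐᵒᵖ :=
  Lam.lift (fun a => MulOpposite.op (f a))
    { toFun := fun n => MulOpposite.op (rd d (-n.toAdd))
      map_one' := by simp
      map_mul' := fun m n => by
        rw [← MulOpposite.op_mul, rd_mul, toAdd_mul, neg_add_rev] }

/-- The right dual `σ(u)` of `u ∈ Λ`. -/
def sg (u : Lam d) : Lam d :=
  (antiHom (fun a => r d (d - a.1) * rd d (-1)) u).unop

/-- The left dual `τ(u)` of `u ∈ Λ`. -/
def tu (u : Lam d) : Lam d :=
  (antiHom (fun a => rd d (-1) * r d (d - a.1)) u).unop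

lemma sg_mul (u v : Lam d) : sg (u * v) = sg v * sg u := by rw [sg, map_mul]; rfl

lemma tu_mul (u v : Lam d) : tu (u * v) = tu v * tu u := by rw [tu, map_mul]; rfl

lemma sg_rd (n : ℤ) : sg (rd d n) = rd d (-n) := by rw [sg, antiHom, Lam.lift_rd]; rfl

lemma tu_rd (n : ℤ) : tu (rd d n) = rd d (-n) := by rw [tu, antiHom, Lam.lift_rd]; rfl

lemma sg_one : sg (1 : Lam d) = 1 := by rw [sg, map_one]; rfl

lemma tu_one : tu (1 : Lam d) = 1 := by rw [tu, map_one]; rfl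

lemma sg_r (hd : 0 < d) {a : ℕ} (ha : a ≤ d) : sg (r d a) = r d (d - a) * rd d (-1) := by
  rcases Nat.eq_zero_or_pos a with rfl | h
  · rw [r_zero, sg_one, Nat.sub_zero, r_self hd, rd_mul]; simp
  rcases ha.lt_or_eq with h' | rfl
  · rw [sg, antiHom, Lam.lift_r _ _ ⟨h, h'⟩]; rfl
  · rw [r_self hd, sg_rd]; simp

lemma tu_r (hd : 0 < d) {a : ℕ} (ha : a ≤ d) : tu (r d a) = rd d (-1) * r d (d - a) := by
  rcases Nat.eq_zero_or_pos a with rfl | h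
  · rw [r_zero, tu_one, Nat.sub_zero, r_self hd, rd_mul]; simp
  rcases ha.lt_or_eq with h' | rfl
  · rw [tu, antiHom, Lam.lift_r _ _ ⟨h, h'⟩]; rfl
  · rw [r_self hd, tu_rd]; simp

/-- This makes `sg` surjective; the other composite is not needed. -/
lemma sg_tu (u : Lam d) : sg (tu u) = u := by
  induction u using Lam.induction_left with
  | one => rw [tu_one, sg_one]
  | letter_mul a u ih =>
    have hd : 0 < d := a.2.1.trans a.2.2
    have := a.2.2
    rw [tu_mul, sg_mul, ih, ← r_eq_letter, tu_r hd (by omega), sg_mul, sg_rd, sg_r hd (by omega),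
      mul_assoc (r d _), rd_mul, Nat.sub_sub_self (by omega)]
    simp
  | rd_mul n u ih => rw [tu_mul, sg_mul, ih, tu_rd, sg_rd, neg_neg]

/-- The dual word. -/
def dualWord (d : ℕ) (l : List ℕ) : List ℕ := (l.map (d - ·)).reverse

lemma dualWord_cons (a : ℕ) (l : List ℕ) : dualWord d (a :: l) = dualWord d l ++ [d - a] := by
  simp [dualWord]

lemma word_sg (u : Lam d) : QuadraticData.word (sg u) = dualWord d (QuadraticData.word u) := by
  induction u using Lam.induction_left with
  | one => rw [sg_one, ← rd_zero, QuadraticData.word_rd]; rfl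
  | letter_mul a u ih =>
    have := a.2
    rw [sg_mul, QuadraticData.word_mul, QuadraticData.word_mul, ← r_eq_letter,
      QuadraticData.word_r a.2, sg_r (by omega) (by omega), QuadraticData.word_mul, ih,
      QuadraticData.word_rd, QuadraticData.word_r (by omega), List.append_nil, List.singleton_append,
      dualWord_cons]
  | rd_mul n u ih =>
    rw [sg_mul, QuadraticData.word_mul, QuadraticData.word_mul, ih, sg_rd, QuadraticData.word_rd,
      QuadraticData.word_rd, List.append_nil, List.nil_append]

end Duality

namespace QuadraticData

variable {k : Type u} [Field k] {V : Type u} [AddCommGroup V] [Module k V] {D : QuadraticData k V}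
  {d : ℕ} (ω : D.R d)

lemma le_of_mem_word {u : Lam d} : ∀ x ∈ word u, x ≤ d := by
  induction u using Lam.induction_left with
  | one => rw [← rd_zero, word_rd]; simp
  | letter_mul a u ih =>
    rw [word_mul, ← r_eq_letter, word_r a.2]
    intro x hx
    rcases List.mem_cons.1 hx with rfl | hx
    · exact a.2.2.le
    · exact ih x hx
  | rd_mul n u ih => rw [word_mul, word_rd]; exact ih

/-- The map `R_a → R_{d-a}^*`, extended by `0` to the indices `a > d`. -/
noncomputable def fnd (a : ℕ) : D.R a →ₗ[k] Module.Dual k (D.R (d - a)) :=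
  if h : a + (d - a) = d then D.fn ω h else 0

/-- The right contraction with the factors of an element of `R_{a_1} ⊗ (R_{a_2} ⊗ ⋯)`. -/
noncomputable def conL : ∀ l : List ℕ, D.tens l →ₗ[k] Module.End k (TensorAlgebra k V)
  | [] => LinearMap.toSpanSingleton k _ 1
  | a :: l => TensorProduct.lift ((LinearMap.mul k (Module.End k (TensorAlgebra k V))).flip.compl₁₂
      (rcon ∘ₗ fnd ω a) (conL l))

lemma conL_nil (c : k) : conL ω [] c = c • (1 : Module.End k (TensorAlgebra k V)) := rfl

lemma conL_cons (a : ℕ) (l : List ℕ) (x : D.R a) (y : D.tens l) :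
    conL ω (a :: l) (x ⊗ₜ[k] y : D.R a ⊗[k] D.tens l) = conL ω l y * rcon (fnd ω a x) := rfl

lemma conL_tensCast_symm {l l' : List ℕ} (h : l = l') (x : D.tens l') :
    conL ω l ((D.tensCast h).symm x) = conL ω l' x := by
  subst h; rfl

lemma conL_tensAppend_symm : ∀ (l l' : List ℕ) (x : D.tens l) (y : D.tens l'),
    conL ω (l ++ l') ((D.tensAppend l l').symm (x ⊗ₜ y)) = conL ω l' y * conL ω l x
  | [], l', c, y => by
    have h : ∀ c : k, conL ω l' (TensorProduct.lid k _ (c ⊗ₜ y)) = conL ω l' y * conL ω [] c := fun c => by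
      rw [TensorProduct.lid_tmul, map_smul, conL_nil, mul_smul_comm, mul_one]
    exact h c
  | a :: l, l', t, y => by
    induction t using D.tens_cons_induction with
    | zero =>
      rw [TensorProduct.zero_tmul, map_zero, map_zero, map_zero, mul_zero]
    | tmul x z =>
      rw [conL_cons, ← mul_assoc, ← conL_tensAppend_symm l l']
      rfl
    | add s t hs ht =>
      rw [TensorProduct.add_tmul, map_add, map_add, hs, ht, map_add, ← mul_add]

lemma conL_one {l : List ℕ} {a : ℕ} (h : l = [a]) (m : D.tens l) :
    conL ω l m = rcon (fnd ω a (((D.tensCast h).trans (TensorProduct.rid k (D.R a))) m)) := by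
  subst h
  have key : TensorProduct.lift ((LinearMap.mul k (Module.End k (TensorAlgebra k V))).flip.compl₁₂
      (rcon ∘ₗ fnd ω a) (LinearMap.toSpanSingleton k _ 1)) =
      (rcon ∘ₗ fnd ω a) ∘ₗ (TensorProduct.rid k (D.R a)).toLinearMap := by
    refine TensorProduct.ext' fun x c => ?_
    simp
  exact LinearMap.congr_fun key m

/-- The pairs of an element of `M(u) ⊆ TV` and the contraction with it. -/
noncomputable def conGr (u : Lam d) :
    Submodule k (TensorAlgebra k V × Module.End k (TensorAlgebra k V)) :=
  LinearMap.range ((D.ev u).prod (conL ω (word u)))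

variable {ω}

lemma mem_conGr {u : Lam d} {A : TensorAlgebra k V} {c : Module.End k (TensorAlgebra k V)} :
    (A, c) ∈ conGr ω u ↔ ∃ m, D.ev u m = A ∧ conL ω (word u) m = c := by
  simp [conGr, Prod.ext_iff]

lemma conL_eq_of_mem {u : Lam d} {A : TensorAlgebra k V} {c : Module.End k (TensorAlgebra k V)}
    (h : (A, c) ∈ conGr ω u) {m : D.obj u} (hm : D.ev u m = A) : conL ω (word u) m = c := by
  obtain ⟨m', rfl, rfl⟩ := mem_conGr.1 h
  rw [D.ev_injective u hm]

lemma exists_mem_conGr {u : Lam d} {A : TensorAlgebra k V} (h : A ∈ D.Rw u) :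
    ∃ c, (A, c) ∈ conGr ω u := by
  obtain ⟨m, rfl⟩ := D.exists_ev_eq h
  exact ⟨_, mem_conGr.2 ⟨m, rfl, rfl⟩⟩

lemma mul_mem_conGr {u v : Lam d} {A B : TensorAlgebra k V}
    {c c' : Module.End k (TensorAlgebra k V)} (h : (A, c) ∈ conGr ω u) (h' : (B, c') ∈ conGr ω v) :
    (A * B, c' * c) ∈ conGr ω (u * v) := by
  obtain ⟨m, rfl, rfl⟩ := mem_conGr.1 h
  obtain ⟨m', rfl, rfl⟩ := mem_conGr.1 h'
  refine mem_conGr.2 ⟨(D.objMul u v).symm (m ⊗ₜ m'), D.ev_objMul_symm u v m m', ?_⟩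
  rw [objMul, LinearEquiv.trans_symm, LinearEquiv.trans_apply]
  exact (conL_tensCast_symm ω _ _).trans (conL_tensAppend_symm ω _ _ m m')

lemma mem_conGr_r_of_lt {a e : ℕ} (ha : 0 < a) (had : a < d) (h : a + e = d) (z : D.R a) :
    ((z : TensorAlgebra k V), rcon (D.fn ω h z)) ∈ conGr ω (r d a) := by
  obtain rfl : e = d - a := by omega
  obtain ⟨m, hm⟩ := (D.objOne (word_r ⟨ha, had⟩)).surjective z
  refine mem_conGr.2 ⟨m, by rw [ev_objOne (word_r ⟨ha, had⟩), hm], ?_⟩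
  rw [conL_one ω (word_r ⟨ha, had⟩), fnd, dif_pos h]
  exact congrArg (fun z => rcon (D.fn ω h z)) hm

lemma one_mem_conGr_rd (n : ℤ) : ((1 : TensorAlgebra k V), 1) ∈ conGr ω (rd d n) := by
  refine mem_conGr.2 ⟨(D.objNil (word_rd n)).symm (1 : k), ?_, ?_⟩
  · rw [ev_objNil (word_rd n), LinearEquiv.apply_symm_apply, map_one]
  · refine (conL_tensCast_symm ω (word_rd n) (l' := []) _).trans ?_
    rw [conL_nil, one_smul]

lemma smul_mem_conGr {u : Lam d} {A : TensorAlgebra k V} {c : Module.End k (TensorAlgebra k V)}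
    (h : (A, c) ∈ conGr ω u) (s : k) : (s • A, s • c) ∈ conGr ω u := Submodule.smul_mem _ s h

/-- Each factor of `m` contracts away one factor of `N` from the right end, in matching order, so
the whole of `N` becomes a scalar whatever stands to its left. -/
lemma exists_scalar : ∀ (l : List ℕ) (m : D.tens l), ∀ N ∈ ((dualWord d l).map D.R).prod,
    ∃ s : k, ∀ X, conL ω l m (X * N) = s • X
  | [], c, N, hN => by
    obtain ⟨n, rfl⟩ := Submodule.mem_one.1 hN
    have : ∀ c : k, ∃ s : k, ∀ X, conL ω [] c (X * algebraMap k (TensorAlgebra k V) n) = s • X :=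
      fun c => ⟨c * n, fun X => by
        rw [conL_nil, LinearMap.smul_apply, Module.End.one_apply, ← Algebra.commutes,
          ← Algebra.smul_def, smul_smul]⟩
    exact this c
  | a :: l, m, N, hN => by
    rw [dualWord_cons, List.map_append, List.prod_append, List.map_singleton,
      List.prod_singleton] at hN
    induction m using D.tens_cons_induction with
    | zero => exact ⟨0, fun X => by rw [map_zero, LinearMap.zero_apply, zero_smul]⟩
    | tmul x m =>
      induction hN using Submodule.mul_induction_on' with
      | mem_mul_mem N' hN' y hy =>
        obtain ⟨s, hs⟩ := exists_scalar l m N' hN'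
        refine ⟨fnd ω a x ⟨y, hy⟩ * s, fun X => ?_⟩
        rw [conL_cons, Module.End.mul_apply, ← mul_assoc, rcon_mul _ ⟨y, hy⟩, map_smul, hs, smul_smul]
      | add A _ B _ hA hB =>
        obtain ⟨s, hs⟩ := hA
        obtain ⟨t, ht⟩ := hB
        exact ⟨s + t, fun X => by rw [mul_add, map_add, hs, ht, add_smul]⟩
    | add m m' hm hm' =>
      obtain ⟨s, hs⟩ := hm
      obtain ⟨t, ht⟩ := hm'
      exact ⟨s + t, fun X => by rw [map_add, LinearMap.add_apply, hs, ht, add_smul]⟩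

/-- The pairing between `M(u)` and `M(σ(u))`. -/
noncomputable def bil (ω : D.R d) (u : Lam d) : D.obj u →ₗ[k] Module.Dual k (D.obj (sg u)) :=
  (LinearMap.llcomp k (D.obj (sg u)) (TensorAlgebra k V) k TensorAlgebra.algebraMapInv.toLinearMap) ∘ₗ
    ((LinearMap.lcomp k (TensorAlgebra k V) (D.ev (sg u))) ∘ₗ conL ω (word u))

lemma bil_apply (u : Lam d) (m : D.obj u) (n : D.obj (sg u)) :
    bil ω u m n = TensorAlgebra.algebraMapInv (conL ω (word u) m (D.ev (sg u) n)) := rfl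

lemma conL_mul_ev {u : Lam d} (m : D.obj u) (n : D.obj (sg u)) (X : TensorAlgebra k V) :
    conL ω (word u) m (X * D.ev (sg u) n) = bil ω u m n • X := by
  obtain ⟨s, hs⟩ := exists_scalar (ω := ω) (word u) m (D.ev (sg u) n) (by
    rw [← word_sg]; exact D.ev_mem _ _)
  rw [hs, bil_apply]
  conv_rhs => rw [← one_mul (D.ev (sg u) n), hs, map_smul, map_one, smul_eq_mul, mul_one]

section

variable [FiniteDimensional k V]

lemma IsFrobenius.fnR_surjective (hF : D.IsFrobenius ω) {a b : ℕ} (h : a + b = d) :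
    Function.Surjective (D.fnR ω h) := by
  intro ξ
  refine ⟨IsFrobenius.rdm ω (show b + a = d by omega) ξ, hF.rdm_injective (show b + a = d by omega) ?_⟩
  exact Subtype.ext (hF.rcon_fnR h _)

/-- Contracting the first factor of `m` with `⟨·, y⟩`, which runs through all functionals by
nondegeneracy, leaves an element of the tail to which induction applies. -/
lemma IsFrobenius.eq_zero_of_conL (hF : D.IsFrobenius ω) : ∀ (l : List ℕ), (∀ a ∈ l, a ≤ d) →
    ∀ m : D.tens l, (∀ N ∈ ((dualWord d l).map D.R).prod, conL ω l m N = 0) → m = 0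
  | [], _, c, h => by
    have : ∀ c : k, conL ω (D := D) [] c 1 = 0 → c = 0 := fun c hc => by
      rw [conL_nil, LinearMap.smul_apply, Module.End.one_apply] at hc
      exact (smul_eq_zero.1 hc).resolve_right one_ne_zero
    exact this c (h 1 (Submodule.one_le.1 le_rfl))
  | a :: l, hl, m, h => by
    have ha := hl a List.mem_cons_self
    have had : a + (d - a) = d := by omega
    refine eq_zero_of_contract_left (W := D.R a) (Q := D.tens l) m fun ξ => ?_
    obtain ⟨y, rfl⟩ := hF.fnR_surjective had ξ
    refine hF.eq_zero_of_conL l (fun b hb => hl b (List.mem_cons_of_mem _ hb)) _ fun N hN => ?_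
    have h1 := h (N * y) (by
      rw [dualWord_cons, List.map_append, List.prod_append, List.map_singleton,
        List.prod_singleton]
      exact Submodule.mul_mem_mul hN y.2)
    refine Eq.trans ?_ h1
    let F : D.R a ⊗[k] D.tens l →ₗ[k] Module.End k (TensorAlgebra k V) := conL ω (a :: l)
    have key : ∀ m : D.R a ⊗[k] D.tens l,
        conL ω l (TensorProduct.lid k _ (LinearMap.rTensor _ (D.fnR ω had y) m)) N =
          F m (N * y) := fun m => by
      induction m with
      | zero => simp only [map_zero, LinearMap.zero_apply]
      | tmul x m =>
        rw [LinearMap.rTensor_tmul, TensorProduct.lid_tmul, map_smul]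
        change _ = (conL ω l m * rcon (fnd ω a x)) (N * y)
        rw [Module.End.mul_apply, rcon_mul, map_smul, LinearMap.smul_apply, fnd, dif_pos had,
          fnR_apply]
      | add s t hs ht => simp only [map_add, LinearMap.add_apply, hs, ht]
    exact key m

instance finiteDimensional_tens : ∀ l : List ℕ, FiniteDimensional k (D.tens l)
  | [] => inferInstanceAs (FiniteDimensional k k)
  | a :: l =>
    have := finiteDimensional_tens l
    inferInstanceAs (FiniteDimensional k (D.R a ⊗[k] D.tens l))

lemma finrank_tens : ∀ l : List ℕ,
    Module.finrank k (D.tens l) = (l.map fun a => Module.finrank k (D.R a)).prod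
  | [] => Module.finrank_self k
  | a :: l => by
    rw [List.map_cons, List.prod_cons, ← finrank_tens l]
    exact Module.finrank_tensorProduct

lemma IsFrobenius.finrank_sg (hF : D.IsFrobenius ω) (u : Lam d) :
    Module.finrank k (D.obj (sg u)) = Module.finrank k (D.obj u) := by
  rw [obj, obj, finrank_tens, finrank_tens, word_sg, dualWord, List.map_reverse, List.prod_reverse,
    List.map_map]
  congr 1
  refine List.map_congr_left fun a ha => ?_
  exact hF.finrank_eq (Nat.sub_add_cancel (le_of_mem_word a ha))

/-- Injectivity is nondegeneracy factor by factor; the dimensions agree because `dim R_a = dim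
R_{d-a}`. -/
lemma IsFrobenius.bil_bijective (hF : D.IsFrobenius ω) (u : Lam d) :
    Function.Bijective (bil ω u) := by
  have h1 : Function.Injective (bil ω u) := by
    rw [injective_iff_map_eq_zero]
    intro m hm
    refine hF.eq_zero_of_conL _ le_of_mem_word m fun N hN => ?_
    rw [← word_sg] at hN
    obtain ⟨n, rfl⟩ := D.exists_ev_eq (u := sg u) hN
    have := conL_mul_ev (ω := ω) m n 1
    rwa [one_mul, hm, LinearMap.zero_apply, zero_smul] at this
  refine ⟨h1, (LinearMap.injective_iff_surjective_of_finrank_eq_finrank ?_).1 h1⟩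
  rw [Subspace.dual_finrank_eq, hF.finrank_sg]

end

end QuadraticData

/-! ### Adjointness of `φ` and `θ` -/

namespace QuadraticData

variable {k : Type u} [Field k] {V : Type u} [AddCommGroup V] [Module k V] {D : QuadraticData k V}
  {d : ℕ} {ω : D.R d}

/-- The contraction with an element of `R_a ⊗ R_b`. -/
lemma exists_conGr_mul {a b a' b' : ℕ} (ha : 0 < a) (had : a < d) (hb : 0 < b) (hbd : b < d)
    (haa : a + a' = d) (hbb : b + b' = d) (s : D.R a ⊗[k] D.R b) :
    ∃ c, (Submodule.mulMap (D.R a) (D.R b) s, c) ∈ conGr ω (r d a * r d b) ∧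
      ∀ W (y : D.R b') (x : D.R a'), c (W * (y * x)) = D.fn ω haa
        (TensorProduct.rid k (D.R a) (LinearMap.lTensor (D.R a) (D.fnR ω hbb y) s)) x • W := by
  induction s with
  | zero => exact ⟨0, by rw [map_zero]; exact Submodule.zero_mem _, fun W y x => by simp⟩
  | tmul z w =>
    refine ⟨_, mul_mem_conGr (mem_conGr_r_of_lt ha had haa z) (mem_conGr_r_of_lt hb hbd hbb w), ?_⟩
    intro W y x
    rw [Module.End.mul_apply, ← mul_assoc, rcon_mul, map_smul, rcon_mul, LinearMap.lTensor_tmul,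
      TensorProduct.rid_tmul, map_smul, LinearMap.smul_apply, fnR_apply, smul_smul, smul_eq_mul,
      mul_comm]
  | add s t hs ht =>
    obtain ⟨c, hc, hs⟩ := hs
    obtain ⟨c', hc', ht⟩ := ht
    refine ⟨c + c', by rw [map_add]; exact Submodule.add_mem _ hc hc', fun W y x => ?_⟩
    simp only [LinearMap.add_apply, hs, ht, map_add, add_smul]

lemma mem_conGr_mul_mul {u w v x : Lam d} (h : x = u * w * v) {A B C : TensorAlgebra k V}
    {c c' c'' : Module.End k (TensorAlgebra k V)} (hA : (A, c) ∈ conGr ω u)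
    (hB : (B, c') ∈ conGr ω w) (hC : (C, c'') ∈ conGr ω v) :
    (A * B * C, c'' * (c' * c)) ∈ conGr ω x := by
  subst h
  exact mul_mem_conGr (mul_mem_conGr hA hB) hC

lemma le_map_ev_eqLocus {u : Lam d} {E : Type*} [AddCommGroup E] [Module k E]
    {f g : D.obj u →ₗ[k] E}
    (h : D.Rw u ≤ (LinearMap.eqLocus f g).map (D.ev u)) : f = g := by
  ext m
  obtain ⟨m', h1, h2⟩ := h (D.ev_mem u m)
  rw [← D.ev_injective u h2]
  exact h1

variable [FiniteDimensional k V]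

lemma IsFrobenius.mem_conGr_r (hF : D.IsFrobenius ω) {a e : ℕ} (ha : 0 < a) (had : a ≤ d)
    (h : a + e = d) (z : D.R a) : (jr ω a z, rcon (D.fn ω h z)) ∈ conGr ω (r d a) := by
  rcases had.lt_or_eq with h' | rfl
  · rw [jr_of_lt ω h']
    exact mem_conGr_r_of_lt ha h' h z
  · obtain rfl : e = 0 := by omega
    obtain ⟨c, rfl⟩ := hF.exists_eq_smul z
    have h1 : (1 : TensorAlgebra k V) ∈ D.R 0 := Submodule.one_le.1 le_rfl
    have h2 : D.fn ω h (c • ω) ⟨1, h1⟩ = c := by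
      have h3 := hF.lcon_fn_self h c 1
      rw [lcon_coe _ (⟨1, h1⟩ : D.R 0), ← Algebra.algebraMap_eq_smul_one] at h3
      exact (algebraMap k (TensorAlgebra k V)).injective h3
    have h4 : rcon (D.fn ω h (c • ω)) = c • (1 : Module.End k (TensorAlgebra k V)) := by
      ext1 w
      have := rcon_mul (D.fn ω h (c • ω)) ⟨1, h1⟩ w
      rw [h2] at this
      simpa using this
    rw [h4, hF.jr_self, Algebra.algebraMap_eq_smul_one, r_self ha]
    exact smul_mem_conGr (one_mem_conGr_rd 1) c

/-- The basic adjunction: pairing the pieces of `z ∈ R_{a+b}` with `y` and `x` is the same as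
pairing `z` with the contraction of `x` by `y`, by associativity of contraction. -/
lemma IsFrobenius.fn_contract (hF : D.IsFrobenius ω) {a b a' b' e : ℕ} (haa : a + a' = d)
    (hbb : b + b' = d) (he : a + b + e = d) (z : D.R (a + b)) (y : D.R b') (x : D.R a') (t : D.R e)
    (ht : (t : TensorAlgebra k V) = lcon (D.fn ω (show b' + b = d by omega) y) (x : TensorAlgebra k V)) :
    D.fn ω haa (TensorProduct.rid k (D.R a)
      (LinearMap.lTensor (D.R a) (D.fnR ω hbb y) (D.split a b z))) x = D.fn ω he z t := by
  apply (algebraMap k (TensorAlgebra k V)).injective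
  obtain rfl : b' = e + a := by omega
  rw [hF.fn_fn he (show e + a + b = d by omega) haa (by omega) z y _ x, ← ht, lcon_coe]
  rw [← rcon_mulMap, mulMap_split, hF.rcon_fnR_eq he hbb]

/-- The generators `φ` are adjoint to the generators `θ`. -/
lemma IsFrobenius.bil_phi (hF : D.IsFrobenius ω) {u v u' v' x y : Lam d} {a b a' b' : ℕ} (ha : 0 < a)
    (hb : 0 < b) (hab : a + b ≤ d) (hx : x = u * r d (a + b) * v) (hy : y = u * (r d a * r d b) * v)
    (haa : a + a' = d) (hbb : b + b' = d) (ha' : a' < d) (hb' : b' < d) (hab' : d ≤ b' + a')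
    (hu' : u' = sg v) (hv' : v' = rd d (-1) * sg u)
    (hy' : sg y = u' * (r d b' * rd d (-1) * r d a') * v')
    (hx' : sg x = u' * r d (b' + a' - d) * v') :
    bil ω y ∘ₗ D.arrowMap ω (phiA u v ha hb hab hx hy) =
      Module.Dual.transpose (D.arrowMap ω (thetaA u' v' hb' ha' hab' hy' hx')) ∘ₗ bil ω x := by
  subst hu' hv'
  have hd : 0 < d := by omega
  apply le_map_ev_eqLocus
  have hRx : D.Rw x = D.Rw u * D.Rw (r d (a + b)) * D.Rw v := by rw [hx, Rw_mul, Rw_mul]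
  rw [hRx]
  refine mul_mul_le fun P hP S hS Q hQ => ?_
  obtain ⟨z, rfl⟩ := (hF.mem_Rw_r (by omega) hab).1 hS
  obtain ⟨m, hm, hm'⟩ := mem_Gr.1 (phi_mem_Gr hF ha hb rfl hab hx hy hP hQ z)
  refine ⟨m, ?_, hm⟩
  obtain ⟨cP, hcP⟩ := exists_mem_conGr (ω := ω) hP
  obtain ⟨cQ, hcQ⟩ := exists_mem_conGr (ω := ω) hQ
  obtain ⟨e, he⟩ : ∃ e, a + b + e = d := ⟨d - (a + b), by omega⟩
  have h1 := conL_eq_of_mem (mem_conGr_mul_mul hx hcP (hF.mem_conGr_r (by omega) hab he z) hcQ) hm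
  obtain ⟨c, hc, hc'⟩ := exists_conGr_mul (ω := ω) ha (by omega) hb (by omega) haa hbb
    (D.split a b z)
  rw [mulMap_split] at hc
  have h2 := conL_eq_of_mem (mem_conGr_mul_mul hy hcP hc hcQ) hm'
  change (bil ω y) _ = (Module.Dual.transpose _) (bil ω x m)
  apply le_map_ev_eqLocus
  have hRy : D.Rw (sg y) = D.Rw (sg v) * (D.R b' * D.R a') * D.Rw (sg u) := by
    rw [hy', Rw_mul, Rw_mul, Rw_mul, Rw_mul, Rw_mul, Rw_rd, mul_one, one_mul, D.Rw_r_of_lt ha',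
      D.Rw_r_of_lt hb']
  rw [hRy]
  refine mul_mul_le fun q hq S hS p hp => mul_mem_of_mem_mul hS fun t ht w hw => ?_
  have hp' : p ∈ D.Rw (rd d (-1) * sg u) := by rwa [Rw_mul, Rw_rd, one_mul]
  have h3 := theta_mem_GrM (ω := ω) hb' ha' hd hab' (show b' + b = d by omega) hy' hx' hq hp'
    ⟨t, ht⟩ ⟨w, hw⟩
  rw [theta, dif_pos ⟨hb', ha'⟩, GrM, preM_map_arr] at h3
  obtain ⟨n, hn, hn'⟩ : ∃ n : D.obj (sg y), D.ev (sg y) n = _ ∧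
    D.ev (sg x) (D.arrowMap ω (thetaA _ _ hb' ha' hab' hy' hx') n) = _ := mem_Gr.1 h3
  refine ⟨n, ?_, hn⟩
  obtain ⟨mP, -, rfl⟩ := mem_conGr.1 hcP
  obtain ⟨np, rfl⟩ := D.exists_ev_eq hp
  change bil ω y _ n = bil ω x m (D.arrowMap ω _ n)
  rw [bil_apply, bil_apply, h1, h2, hn, hn']
  have h4 : lcon (D.fn ω (show b' + b = d by omega) ⟨t, ht⟩) w ∈ D.R e :=
    lcon_mem _ (show b + e = a' by omega) hw
  have h5 := hF.fn_contract haa hbb he z ⟨t, ht⟩ ⟨w, hw⟩ ⟨_, h4⟩ rfl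
  have h6 := hc' q ⟨t, ht⟩ ⟨w, hw⟩
  have h7 := rcon_mul (D.fn ω he z) ⟨_, h4⟩ q
  dsimp only at h6 h7
  congr 1
  -- The contraction peels factors off the right: `P` against its partner gives a common scalar, the
  -- middle factors are compared by `h5`, and the factor belonging to `Q` acts on `q` on both sides.
  simp only [Module.End.mul_apply]
  rw [conL_mul_ev, conL_mul_ev, map_smul c, map_smul (rcon _), h6, h7, h5]

end QuadraticData

/-- The whiskered generators `θ`. -/
inductive IsTheta {d : ℕ} : ∀ {x y : Lam d}, Arrow d x y → Prop
  | mk (u v : Lam d) {a b : ℕ} (ha : a < d) (hb : b < d) (hab : d ≤ a + b) {x y : Lam d}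
      (hx : x = u * (r d a * rd d (-1) * r d b) * v) (hy : y = u * r d (a + b - d) * v) :
      IsTheta (thetaA u v ha hb hab hx hy)

lemma IsTheta.exists_eq {d : ℕ} {x y : Lam d} {g : Arrow d x y} (h : IsTheta g) :
    ∃ (u v : Lam d) (a b : ℕ) (ha : a < d) (hb : b < d) (hab : d ≤ a + b) (hx : _) (hy : _),
      g = thetaA u v ha hb hab hx hy := by
  cases h with
  | mk u v ha hb hab hx hy => exact ⟨u, v, _, _, ha, hb, hab, hx, hy, rfl⟩

/-! ### Extending endomorphisms along the generators `θ` -/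

namespace QuadraticData

variable {k : Type u} [Field k] {V : Type u} [AddCommGroup V] [Module k V] {D : QuadraticData k V}
  {d : ℕ} {ω : D.R d} [FiniteDimensional k V]

lemma IsFrobenius.exists_theta (hF : D.IsFrobenius ω) {x y : Lam d} {g : Arrow d x y}
    (hg : IsPhi g) : ∃ g' : Arrow d (sg y) (sg x), IsTheta g' ∧
      bil ω y ∘ₗ D.arrowMap ω g = Module.Dual.transpose (D.arrowMap ω g') ∘ₗ bil ω x := by
  obtain @⟨u, v, a, b, ha, hb, hab, x, y, hx, hy⟩ := hg
  have hd : 0 < d := by omega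
  refine ⟨_, .mk _ _ _ _ _ _ _, hF.bil_phi ha hb hab hx hy (a' := d - a) (b' := d - b) (by omega)
    (by omega) (by omega) (by omega) (by omega) rfl rfl ?_ ?_⟩
  · rw [hy, sg_mul, sg_mul, sg_mul, sg_r hd (by omega), sg_r hd (by omega)]
    simp only [mul_assoc]
  · rw [hx, sg_mul, sg_mul, sg_r hd hab, show d - b + (d - a) - d = d - (a + b) by omega]
    simp only [mul_assoc]

/-- Every `θ` out of `sg l` is the adjoint of a `φ` into `l`, found by applying `tu`. Only `sg (tu
u) = u` is available, so `l` must be in the image of `tu`, which is what `hl` encodes. -/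
lemma IsFrobenius.exists_phi (hF : D.IsFrobenius ω) {l y : Lam d} (hl : tu (sg l) = l)
    {g : Arrow d (sg l) y} (hg : IsTheta g) : ∃ (x : Lam d) (hy : y = sg x) (g' : Arrow d x l),
      IsPhi g' ∧ bil ω l ∘ₗ D.arrowMap ω g' =
        Module.Dual.transpose (D.arrowMap ω (hy ▸ g)) ∘ₗ bil ω x := by
  obtain ⟨u, v, a, b, ha, hb, hab, hx, hy, rfl⟩ := hg.exists_eq
  have hd : 0 < d := by omega
  have hl' : l = tu v * rd d (-1) * (r d (d - b) * r d (d - a)) * tu u := by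
    rw [← hl, hx, tu_mul, tu_mul, tu_mul, tu_mul, tu_rd, tu_r hd ha.le, tu_r hd hb.le, neg_neg]
    have : ∀ w : Lam d, rd d 1 * (rd d (-1) * w) = w := fun w => by rw [← mul_assoc, rd_mul]; simp
    simp only [mul_assoc, this]
  have hy' : y = sg (tu v * rd d (-1) * r d (d - b + (d - a)) * tu u) := by
    rw [sg_mul, sg_mul, sg_mul, sg_tu, sg_tu, sg_rd, neg_neg, sg_r hd (by omega), hy,
      show d - (d - b + (d - a)) = a + b - d by omega]
    have : ∀ w : Lam d, rd d (-1) * (rd d 1 * w) = w := fun w => by rw [← mul_assoc, rd_mul]; simp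
    simp only [mul_assoc, this]
  subst hy'
  refine ⟨_, rfl, _, .mk (tu v * rd d (-1)) (tu u) (by omega) (by omega) (by omega) rfl hl', ?_⟩
  refine hF.bil_phi (a' := b) (b' := a) _ _ _ _ _ (by omega) (by omega) hb ha hab (sg_tu u).symm ?_ hx hy
  rw [sg_mul, sg_tu, sg_rd, neg_neg, ← mul_assoc, rd_mul]
  simp

lemma exists_transpose_eq {W : Type*} [AddCommGroup W] [Module k W] [FiniteDimensional k W]
    (F : Module.Dual k W →ₗ[k] Module.Dual k W) : ∃ f : W →ₗ[k] W, Module.Dual.transpose f = F := by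
  refine ⟨(Module.evalEquiv k W).symm.toLinearMap ∘ₗ Module.Dual.transpose F ∘ₗ
    (Module.evalEquiv k W).toLinearMap, ?_⟩
  ext ξ w
  have := Module.apply_evalEquiv_symm_apply k W ξ (Module.Dual.transpose F (Module.evalEquiv k W w))
  exact this

/-- Endomorphisms that commute with the generators `θ` strictly below `λ` extend to `λ`. -/
theorem IsFrobenius.exists_comm_theta (hF : D.IsFrobenius ω) (hK : D.IsKoszul) (l : Lam d)
    (η : ∀ x : Lam d, D.obj x →ₗ[k] D.obj x)
    (hη : ∀ ⦃x y⦄ (h : Arrow d l x) (g : Arrow d x y), IsTheta h → IsTheta g →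
      D.arrowMap ω g ∘ₗ η x = η y ∘ₗ D.arrowMap ω g) :
    ∃ f : D.obj l →ₗ[k] D.obj l, ∀ ⦃x⦄ (g : Arrow d l x), IsTheta g →
      D.arrowMap ω g ∘ₗ f = η x ∘ₗ D.arrowMap ω g := by
  obtain ⟨l, hl, rfl⟩ : ∃ l', tu (sg l') = l' ∧ l = sg l' := ⟨tu l, by rw [sg_tu], (sg_tu l).symm⟩
  -- The perfect pairing turns the endomorphism of `M(σ(x))` into its adjoint on `M(x)`; the
  -- commutation with `θ` becomes one with `φ`.
  have e : ∀ x : Lam d, ∃ f : D.obj x →ₗ[k] D.obj x,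
      bil ω x ∘ₗ f = Module.Dual.transpose (η (sg x)) ∘ₗ bil ω x := fun x => by
    let e := LinearEquiv.ofBijective _ (hF.bil_bijective x)
    refine ⟨e.symm.toLinearMap ∘ₗ Module.Dual.transpose (η (sg x)) ∘ₗ bil ω x, ?_⟩
    ext1 m
    exact e.apply_symm_apply _
  choose η' hη' using e
  obtain ⟨f', hf'⟩ := hF.exists_comm_phi hK l η' fun x y g h hg hh => by
    obtain ⟨g', hg', e⟩ := hF.exists_theta hg
    obtain ⟨h', hh', -⟩ := hF.exists_theta hh
    have h1 := hη h' g' hh' hg'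
    ext1 m
    apply (hF.bil_bijective y).1
    have a1 := LinearMap.congr_fun e (η' x m)
    have a2 := LinearMap.congr_fun (hη' x) m
    have a3 := LinearMap.congr_fun (hη' y) (D.arrowMap ω g m)
    have a4 := LinearMap.congr_fun e m
    simp only [LinearMap.comp_apply] at a1 a2 a3 a4 ⊢
    rw [a1, a2, a3, a4]
    ext1 n
    exact congrArg (bil ω x m) (LinearMap.congr_fun h1 n).symm
  let e := LinearEquiv.ofBijective _ (hF.bil_bijective l)
  -- The solution on `M(l)` is carried back to the dual of `M(σ(l))`, where by finite dimension it
  -- is a transpose.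
  obtain ⟨f, hf⟩ := exists_transpose_eq (e.toLinearMap ∘ₗ f' ∘ₗ e.symm.toLinearMap)
  have hf₂ : ∀ m, Module.Dual.transpose f (bil ω l m) = bil ω l (f' m) := fun m => by
    rw [hf]
    exact congrArg (fun m => bil ω l (f' m)) (e.symm_apply_apply m)
  refine ⟨f, fun y g hg => ?_⟩
  obtain ⟨x, rfl, g', hg', h1⟩ := hF.exists_phi hl hg
  have h2 := hf' g' hg'
  ext1 n
  rw [← sub_eq_zero, ← Module.forall_dual_apply_eq_zero_iff k]
  intro ξ
  obtain ⟨m, rfl⟩ := (hF.bil_bijective x).2 ξ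
  rw [map_sub, sub_eq_zero]
  have a1 := LinearMap.congr_fun h1 m
  have a2 := LinearMap.congr_fun h1 (η' x m)
  have a3 := LinearMap.congr_fun h2 m
  have a4 := LinearMap.congr_fun (hη' x) m
  have a5 := hf₂ (D.arrowMap ω g' m)
  simp only [LinearMap.comp_apply] at a1 a2 a3 a4
  rw [a3, a2, a4, a1] at a5
  exact LinearMap.congr_fun a5 n

end QuadraticData

section

variable {d : ℕ} {x y : Lam d} {g : Arrow d x y}

lemma IsPhi.lt (h : IsPhi g) : x < y := by
  cases h with
  | mk u v ha hb hab hx hy => exact phiA_lt ha hb hab hx hy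

lemma IsTheta.lt (h : IsTheta g) : y < x := by
  cases h with
  | mk u v ha hb hab hx hy => exact thetaA_lt ha hb hab hx hy

lemma isPhi_or_isTheta (g : Arrow d x y) : IsPhi g ∨ IsTheta g := by
  rcases arrow_cases g with ⟨u, v, a, b, ha, hb, hab, hx, hy, rfl⟩ |
    ⟨u, v, a, b, ha, hb, hab, hx, hy, rfl⟩
  · exact Or.inl (.mk _ _ _ _ _ _ _)
  · exact Or.inr (.mk _ _ _ _ _ _ _)

end

/-! ### Extension of endomorphisms from `Λ₁` to `Λ₂` -/

namespace QuadraticData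

variable {k : Type u} [Field k] {V : Type u} [AddCommGroup V] [Module k V] {D : QuadraticData k V}
  {d : ℕ} {ω : D.R d} {hM : D.Compatible ω} {Λ₁ Λ₂ : Set (Lam d)}

open Classical in
/-- The family of the components of a natural endomorphism, extended by `0`. -/
noncomputable def extendZero (η : EndOn (D.M ω hM) Λ₁) (x : Lam d) : D.obj x →ₗ[k] D.obj x :=
  if hx : x ∈ Λ₁ then endAt η hx else 0

lemma extendZero_of_mem (η : EndOn (D.M ω hM) Λ₁) {x : Lam d} (hx : x ∈ Λ₁) :
    extendZero η x = endAt η hx := dif_pos hx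

lemma mapU_comp_extendZero (η : EndOn (D.M ω hM) Λ₁) {x y : Lam d} (m : U.of x ⟶ U.of y)
    (hx : x ∈ Λ₁) (hy : y ∈ Λ₁) :
    mapU hM m ∘ₗ extendZero η x = extendZero η y ∘ₗ mapU hM m := by
  rw [extendZero_of_mem η hx, extendZero_of_mem η hy]
  exact mapU_comp_endAt η m hx hy

lemma arrowMap_comp_extendZero (η : EndOn (D.M ω hM) Λ₁) {x y : Lam d} (g : Arrow d x y)
    (hx : x ∈ Λ₁) (hy : y ∈ Λ₁) :
    D.arrowMap ω g ∘ₗ extendZero η x = extendZero η y ∘ₗ D.arrowMap ω g := by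
  rw [← mapU_aM hM]
  exact mapU_comp_extendZero η _ hx hy

lemma mem_of_lt (h₂ : IsLowerSet Λ₂) (hA : IsAntichain (· ≤ ·) (Λ₂ \ Λ₁)) {x l : Lam d}
    (hl : l ∈ Λ₂) (hl₁ : l ∉ Λ₁) (hx : x < l) : x ∈ Λ₁ := by
  by_contra h
  exact hA ⟨h₂ hx.le hl, h⟩ ⟨hl, hl₁⟩ hx.ne hx.le

section Extension

variable [FiniteDimensional k V]

/-- `f₁` is correct on the sum `I` of the images of the `φ` and `f₂` is correct after every `θ`.
Correcting `f₂` by `f₁ - f₂` on `I` does not disturb the second property, as this difference is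
killed by every `θ` on `I`. -/
lemma IsFrobenius.exists_component (hF : D.IsFrobenius ω) (hK : D.IsKoszul)
    (η : EndOn (D.M ω hM) Λ₁) {l : Lam d} (hl : ∀ x < l, x ∈ Λ₁) :
    ∃ f : D.obj l →ₗ[k] D.obj l,
      (∀ ⦃x⦄ (g : Arrow d x l), IsPhi g → D.arrowMap ω g ∘ₗ extendZero η x = f ∘ₗ D.arrowMap ω g) ∧
      ∀ ⦃x⦄ (g : Arrow d l x), IsTheta g → D.arrowMap ω g ∘ₗ f = extendZero η x ∘ₗ D.arrowMap ω g := by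
  obtain ⟨f₁, hf₁⟩ := hF.exists_comm_phi hK l (extendZero η) fun x y g h hg hh =>
    arrowMap_comp_extendZero η g (hl x (hg.lt.trans hh.lt)) (hl y hh.lt)
  obtain ⟨f₂, hf₂⟩ := hF.exists_comm_theta hK l (extendZero η) fun x y h g hh hg =>
    arrowMap_comp_extendZero η g (hl x hh.lt) (hl y (hg.lt.trans hh.lt))
  let I : Submodule k (D.obj l) := ⨆ i : PhiInto l, LinearMap.range (D.arrowMap ω i.arrow)
  obtain ⟨π, hπ⟩ := I.subtype.exists_leftInverse_of_injective I.ker_subtype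
  have hI : ∀ ⦃x⦄ (g : Arrow d x l), IsPhi g → ∀ m, D.arrowMap ω g m ∈ I := by
    intro x g hg m
    obtain ⟨i, rfl, rfl⟩ := hg.exists_eq
    exact Submodule.mem_iSup_of_mem i ⟨m, rfl⟩
  refine ⟨f₂ + (f₁ - f₂) ∘ₗ I.subtype ∘ₗ π, fun x g hg => ?_, fun x g hg => ?_⟩
  · ext1 m
    have h1 := LinearMap.congr_fun hπ ⟨D.arrowMap ω g m, hI g hg m⟩
    have h2 := LinearMap.congr_fun (hf₁ g hg) m
    simp only [LinearMap.comp_apply, LinearMap.add_apply, LinearMap.sub_apply, Submodule.subtype_apply,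
      LinearMap.id_apply] at h1 h2 ⊢
    rw [h1, h2]
    abel
  · have h1 : I ≤ LinearMap.ker (D.arrowMap ω g ∘ₗ (f₁ - f₂)) := by
      refine iSup_le fun i => ?_
      rintro _ ⟨m, rfl⟩
      have h3 := LinearMap.congr_fun (hf₁ i.arrow i.isPhi) m
      have h4 := LinearMap.congr_fun (hf₂ g hg) (D.arrowMap ω i.arrow m)
      -- The composite passes through `l`, but as a morphism it joins two objects of `Λ₁`, and `η`
      -- is natural on the full subcategory.
      have h5 := LinearMap.congr_fun (mapU_comp_extendZero η (aM i.arrow ≫ aM g)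
        (hl _ i.isPhi.lt) (hl _ hg.lt)) m
      rw [mapU_comp, mapU_aM, mapU_aM] at h5
      simp only [LinearMap.comp_apply] at h3 h4 h5
      rw [LinearMap.mem_ker, LinearMap.comp_apply, LinearMap.sub_apply, map_sub, h3, h4, h5, sub_self]
    ext1 m
    have h2 := LinearMap.mem_ker.1 (h1 (π m).2)
    have h3 := LinearMap.congr_fun (hf₂ g hg) m
    simp only [LinearMap.comp_apply, LinearMap.add_apply, Submodule.subtype_apply] at h2 h3 ⊢
    rw [map_add, h2, add_zero, h3]

/-- Natural endomorphisms extend from `Λ₁` to `Λ₂`. -/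
theorem IsFrobenius.restrict_surjective (hF : D.IsFrobenius ω) (hK : D.IsKoszul)
    (h₁ : IsLowerSet Λ₁) (h₂ : IsLowerSet Λ₂) (h : Λ₁ ⊆ Λ₂)
    (hA : IsAntichain (· ≤ ·) (Λ₂ \ Λ₁)) : Function.Surjective (restrict (D.M ω hM) h) := by
  classical
  intro η
  have h3 : ∀ l : Lam d, l ∈ Λ₂ → l ∉ Λ₁ → ∃ f : D.obj l →ₗ[k] D.obj l, _ := fun l hl hl₁ =>
    hF.exists_component hK η fun x hx => mem_of_lt h₂ hA hl hl₁ hx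
  choose f hfφ hfθ using h3
  let F : ∀ x : Lam d, D.obj x →ₗ[k] D.obj x := fun x =>
    if hx : x ∈ Λ₂ ∧ x ∉ Λ₁ then f x hx.1 hx.2 else extendZero η x
  have hF₁ : ∀ {x}, x ∈ Λ₁ → F x = extendZero η x := fun hx => dif_neg fun h' => h'.2 hx
  have hF₂ : ∀ {x} (hx : x ∈ Λ₂) (hx₁ : x ∉ Λ₁), F x = f x hx hx₁ := fun hx hx₁ =>
    dif_pos ⟨hx, hx₁⟩
  refine ⟨mkEnd hM F h₂ fun x y g hx hy => ?_, endAt_ext fun x hx => ?_⟩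
  -- A generator relates strictly comparable objects, so at most one end lies in the antichain; the
  -- other lies in `Λ₁`.
  · rcases isPhi_or_isTheta g with hg | hg
    · by_cases hy₁ : y ∈ Λ₁
      · have hx₁ := h₁ hg.lt.le hy₁
        rw [hF₁ hx₁, hF₁ hy₁, arrowMap_comp_extendZero η g hx₁ hy₁]
      · rw [hF₁ (mem_of_lt h₂ hA hy hy₁ hg.lt), hF₂ hy hy₁, hfφ y hy hy₁ g hg]
    · by_cases hx₁ : x ∈ Λ₁
      · have hy₁ := h₁ hg.lt.le hx₁
        rw [hF₁ hx₁, hF₁ hy₁, arrowMap_comp_extendZero η g hx₁ hy₁]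
      · rw [hF₁ (mem_of_lt h₂ hA hx hx₁ hg.lt), hF₂ hx hx₁, hfθ x hx hx₁ g hg]
  · rw [endAt_restrict, endAt_mkEnd, hF₁ hx, extendZero_of_mem]

end Extension

end QuadraticData

/-! ### The kernel of restriction -/

section Standard

variable {k : Type u} [Field k] {d : ℕ} {F : U d ⥤ ModuleCat.{u} k} {X Y : U d}

/-- The endomorphism of `M(λ)` obtained from a map `∇(λ) → Δ(λ)`. -/
def ofStd (F : U d ⥤ ModuleCat.{u} k) (X : U d) (f : costandard F X →ₗ[k] standard F X) :
    F.obj X →ₗ[k] F.obj X := (standard F X).subtype ∘ₗ f ∘ₗ (lowerImage F X).mkQ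

lemma ofStd_comp_map (h : Y.lam < X.lam) (m : Y ⟶ X) (f : costandard F X →ₗ[k] standard F X) :
    ofStd F X f ∘ₗ (F.map m).hom = 0 := by
  ext1 z
  have h1 : (F.map m).hom z ∈ lowerImage F X :=
    Submodule.mem_iSup_of_mem Y (Submodule.mem_iSup_of_mem h
      (Submodule.mem_iSup_of_mem m ⟨z, rfl⟩))
  have h2 : (lowerImage F X).mkQ ((F.map m).hom z) = 0 := (Submodule.Quotient.mk_eq_zero _).2 h1
  simp only [ofStd, LinearMap.comp_apply, h2, map_zero, LinearMap.zero_apply]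

lemma map_comp_ofStd (h : Y.lam < X.lam) (m : X ⟶ Y) (f : costandard F X →ₗ[k] standard F X) :
    (F.map m).hom ∘ₗ ofStd F X f = 0 := by
  ext1 z
  have h1 := (f ((lowerImage F X).mkQ z)).2
  simp only [standard, Submodule.mem_iInf] at h1
  exact h1 Y h m

/-- An endomorphism killing every image from below factors through the cokernel, and one killed by
every map to below lands in the kernel. -/
lemma exists_ofStd_eq (e : F.obj X →ₗ[k] F.obj X)
    (h₁ : ∀ ⦃Y : U d⦄ (_ : Y.lam < X.lam) (m : Y ⟶ X), e ∘ₗ (F.map m).hom = 0)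
    (h₂ : ∀ ⦃Y : U d⦄ (_ : Y.lam < X.lam) (m : X ⟶ Y), (F.map m).hom ∘ₗ e = 0) :
    ∃ f, ofStd F X f = e := by
  have h3 : lowerImage F X ≤ LinearMap.ker e := by
    refine iSup_le fun Y => iSup_le fun hY => iSup_le fun m => ?_
    rintro _ ⟨z, rfl⟩
    exact LinearMap.congr_fun (h₁ hY m) z
  have h4 : ∀ z, e z ∈ standard F X := by
    intro z
    simp only [standard, Submodule.mem_iInf]
    intro Y hY m
    exact LinearMap.congr_fun (h₂ hY m) z
  exact ⟨(lowerImage F X).liftQ (e.codRestrict _ h4) (by rwa [LinearMap.ker_codRestrict]), rfl⟩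

lemma ofStd_injective : Function.Injective (ofStd F X) := by
  intro f f' h
  refine LinearMap.ext fun q => Subtype.ext ?_
  obtain ⟨z, rfl⟩ := (lowerImage F X).mkQ_surjective q
  exact LinearMap.congr_fun h z

end Standard

namespace QuadraticData

variable {k : Type u} [Field k] {V : Type u} [AddCommGroup V] [Module k V] {D : QuadraticData k V}
  {d : ℕ} {ω : D.R d} {Λ₁ Λ₂ : Set (Lam d)}

variable (hM : D.Compatible ω)

open Classical in
/-- The family of endomorphisms obtained from maps `∇(λ) → Δ(λ)`. -/
noncomputable def stdFamily
    (f : ∀ l : ↥(Λ₂ \ Λ₁), costandard (D.M ω hM) (U.of l.1) →ₗ[k] standard (D.M ω hM) (U.of l.1))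
    (x : Lam d) : D.obj x →ₗ[k] D.obj x :=
  if hx : x ∈ Λ₂ \ Λ₁ then ofStd (D.M ω hM) (U.of x) (f ⟨x, hx⟩) else 0

variable {hM} {f : ∀ l : ↥(Λ₂ \ Λ₁),
  costandard (D.M ω hM) (U.of l.1) →ₗ[k] standard (D.M ω hM) (U.of l.1)}

lemma stdFamily_of_mem {x : Lam d} (hx : x ∈ Λ₂) (hx₁ : x ∉ Λ₁) :
    stdFamily hM f x = ofStd (D.M ω hM) (U.of x) (f ⟨x, hx, hx₁⟩) := dif_pos ⟨hx, hx₁⟩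

lemma stdFamily_eq_zero {x : Lam d} (hx : x ∈ Λ₁) : stdFamily hM f x = 0 := dif_neg fun h => h.2 hx

/-- For a generator meeting `Λ₂ \ Λ₁` both composites vanish: the smaller end carries `0`, and at
the larger end the map kills what comes from below and is killed by what goes below. -/
lemma stdFamily_comm (h₁ : IsLowerSet Λ₁) (h₂ : IsLowerSet Λ₂)
    (hA : IsAntichain (· ≤ ·) (Λ₂ \ Λ₁)) ⦃x y : Lam d⦄ (g : Arrow d x y) (hx : x ∈ Λ₂)
    (hy : y ∈ Λ₂) : D.arrowMap ω g ∘ₗ stdFamily hM f x = stdFamily hM f y ∘ₗ D.arrowMap ω g := by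
  rcases isPhi_or_isTheta g with hg | hg
  · by_cases hy₁ : y ∈ Λ₁
    · rw [stdFamily_eq_zero hy₁, stdFamily_eq_zero (h₁ hg.lt.le hy₁), LinearMap.comp_zero,
        LinearMap.zero_comp]
    · rw [stdFamily_eq_zero (mem_of_lt h₂ hA hy hy₁ hg.lt), LinearMap.comp_zero,
        stdFamily_of_mem hy hy₁, ← mapU_aM hM]
      exact (ofStd_comp_map (F := D.M ω hM) (X := U.of y) (Y := U.of x) hg.lt (aM g) _).symm
  · by_cases hx₁ : x ∈ Λ₁
    · rw [stdFamily_eq_zero hx₁, stdFamily_eq_zero (h₁ hg.lt.le hx₁), LinearMap.comp_zero,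
        LinearMap.zero_comp]
    · rw [stdFamily_eq_zero (mem_of_lt h₂ hA hx hx₁ hg.lt), LinearMap.zero_comp,
        stdFamily_of_mem hx hx₁, ← mapU_aM hM]
      exact map_comp_ofStd (F := D.M ω hM) (X := U.of x) (Y := U.of y) hg.lt (aM g) _

variable (hM) in
/-- The inclusion of the product of the spaces of maps `∇(λ) → Δ(λ)`. -/
noncomputable def stdMap (h₁ : IsLowerSet Λ₁) (h₂ : IsLowerSet Λ₂)
    (hA : IsAntichain (· ≤ ·) (Λ₂ \ Λ₁)) :
    (∀ l : ↥(Λ₂ \ Λ₁), costandard (D.M ω hM) (U.of l.1) →ₗ[k] standard (D.M ω hM) (U.of l.1)) →ₗ[k]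
      EndOn (D.M ω hM) Λ₂ where
  toFun f := mkEnd hM (stdFamily hM f) h₂ (stdFamily_comm h₁ h₂ hA)
  map_add' f f' := endAt_ext fun x hx => by
    rw [endAt_add, endAt_mkEnd, endAt_mkEnd, endAt_mkEnd]
    by_cases hx₁ : x ∈ Λ₁
    · rw [stdFamily_eq_zero hx₁, stdFamily_eq_zero hx₁, stdFamily_eq_zero hx₁, add_zero]
    · rw [stdFamily_of_mem hx hx₁, stdFamily_of_mem hx hx₁, stdFamily_of_mem hx hx₁]
      rfl
  map_smul' c f := endAt_ext fun x hx => by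
    rw [RingHom.id_apply, endAt_smul, endAt_mkEnd, endAt_mkEnd]
    by_cases hx₁ : x ∈ Λ₁
    · rw [stdFamily_eq_zero hx₁, stdFamily_eq_zero hx₁, smul_zero]
    · rw [stdFamily_of_mem hx hx₁, stdFamily_of_mem hx hx₁]
      rfl

section

variable (h₁ : IsLowerSet Λ₁) (h₂ : IsLowerSet Λ₂) (hA : IsAntichain (· ≤ ·) (Λ₂ \ Λ₁))

lemma endAt_stdMap {x : Lam d} (hx : x ∈ Λ₂) :
    endAt (stdMap hM h₁ h₂ hA f) hx = stdFamily hM f x := rfl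

lemma stdMap_injective : Function.Injective (stdMap hM h₁ h₂ hA) := by
  intro f f' h
  funext ⟨l, hl, hl₁⟩
  have h3 : stdFamily hM f l = stdFamily hM f' l := congrArg (fun η => endAt η hl) h
  rw [stdFamily_of_mem hl hl₁, stdFamily_of_mem hl hl₁] at h3
  exact ofStd_injective h3

/-- Vanishing on `Λ₁` together with naturality for all maps between `λ` and the elements below it
gives both hypotheses of `exists_ofStd_eq`. -/
lemma stdMap_exact (h : Λ₁ ⊆ Λ₂) :
    Function.Exact (stdMap hM h₁ h₂ hA) (restrict (D.M ω hM) h) := by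
  intro η
  constructor
  · intro hη
    have h0 : ∀ {x} (hx : x ∈ Λ₁), endAt η (h hx) = 0 := fun hx =>
      congrArg (fun η => endAt η hx) hη
    have h3 : ∀ l : ↥(Λ₂ \ Λ₁), ∃ f, ofStd (D.M ω hM) (U.of l.1) f = endAt η l.2.1 := by
      intro ⟨l, hl, hl₁⟩
      refine exists_ofStd_eq _ (fun Y hY m => ?_) fun Y hY m => ?_
      · have hY₁ := mem_of_lt h₂ hA hl hl₁ hY
        have := mapU_comp_endAt η (x := Y.lam) (y := l) m (h hY₁) hl
        rw [h0 hY₁, LinearMap.comp_zero] at this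
        exact this.symm
      · have hY₁ := mem_of_lt h₂ hA hl hl₁ hY
        have := mapU_comp_endAt η (x := l) (y := Y.lam) m hl (h hY₁)
        rw [h0 hY₁, LinearMap.zero_comp] at this
        exact this
    choose f hf using h3
    refine ⟨f, endAt_ext fun x hx => ?_⟩
    rw [endAt_stdMap]
    by_cases hx₁ : x ∈ Λ₁
    · rw [stdFamily_eq_zero hx₁, h0 hx₁]
    · rw [stdFamily_of_mem hx hx₁]
      exact hf ⟨x, hx, hx₁⟩
  · rintro ⟨f, rfl⟩
    refine endAt_ext fun x hx => ?_
    rw [endAt_restrict, endAt_stdMap, stdFamily_eq_zero hx]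
    rfl

end

end QuadraticData

end UAut

/-! ### The exact sequence -/

theorem theorem1p3p2 {k : Type u} [Field k] [IsAlgClosed k]
    {V : Type u} [AddCommGroup V] [Module k V] [FiniteDimensional k V]
    (D : UAut.QuadraticData k V) (d : ℕ) (hd : 0 < d)
    (hK : D.IsKoszul) (hAS : D.IsASRegular d) :
    Module.finrank k (D.R d) = 1 ∧ ∀ ω : D.R d, ω ≠ 0 → ∃ hM : D.Compatible ω,
      ∀ (Λ₁ Λ₂ : Set (UAut.Lam d)), IsLowerSet Λ₁ → IsLowerSet Λ₂ → ∀ h : Λ₁ ⊆ Λ₂,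
        IsAntichain (· ≤ ·) (Λ₂ \ Λ₁) →
        ∃ α : (∀ l : ↥(Λ₂ \ Λ₁), UAut.costandard (D.M ω hM) (UAut.U.of l.1) →ₗ[k]
              UAut.standard (D.M ω hM) (UAut.U.of l.1)) →ₗ[k] UAut.EndOn (D.M ω hM) Λ₂,
          (∀ f (l : UAut.Lam d) (hl : l ∈ Λ₂),
            (∀ hl₁ : l ∉ Λ₁, ((α f).app ⟨UAut.U.of l, hl⟩).hom =
              (UAut.standard (D.M ω hM) (UAut.U.of l)).subtype ∘ₗ f ⟨l, hl, hl₁⟩ ∘ₗ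
                (UAut.lowerImage (D.M ω hM) (UAut.U.of l)).mkQ) ∧
            (l ∈ Λ₁ → ((α f).app ⟨UAut.U.of l, hl⟩).hom = 0)) ∧
          Function.Injective α ∧
          Function.Exact α (UAut.restrict (D.M ω hM) h) ∧
          Function.Surjective (UAut.restrict (D.M ω hM) h) := by
  obtain ⟨P⟩ := hK.nonempty_linearResolution
  refine ⟨UAut.QuadraticData.finrank_of_isASRegular P hd hAS, fun ω hω => ?_⟩
  have hF := UAut.QuadraticData.isFrobenius hK hd hAS hω
  refine ⟨hF.compatible, fun Λ₁ Λ₂ h₁ h₂ h hA => ⟨UAut.QuadraticData.stdMap hF.compatible h₁ h₂ hA,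
    fun f l hl => ⟨fun hl₁ => ?_, fun hl₁ => ?_⟩, UAut.QuadraticData.stdMap_injective h₁ h₂ hA,
    UAut.QuadraticData.stdMap_exact h₁ h₂ hA h, hF.restrict_surjective hK h₁ h₂ h hA⟩⟩
  · exact UAut.QuadraticData.stdFamily_of_mem hl hl₁
  · exact UAut.QuadraticData.stdFamily_eq_zero hl₁
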